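/- Let $W$ be a finite group generated by orthogonal reflections of a Euclidean space $V_{\mathbb R}$ that acts irreducibly on $V_{\mathbb R}$. Put $V=\mathbb C\otimes V_{\mathbb R}$ and $\ell=\dim V$, let $\mathcal S\subset W$ be the set of all reflections in $W$, and for $s\in\mathcal S$ let $\alpha_s\in V$ be a root of $s$ (a nonzero real vector orthogonal to the mirror of $s$). By Chevalley's theorem $S(V^*)^W$ is generated by $\ell$ algebraically independent homogeneous elements (elementary invariants), whose degrees $d_1\le\dots\le d_\ell$ are uniquely determined; $h=d_\ell$ is the Coxeter number of $W$. For a conjugation-invariant function $c:\mathcal S\to\mathbb C$ and $y\in V^*$ let $$\nabla_y^{(c)}(q)=\frac{\partial q}{\partial y}-\sum_{s\in\mathcal S}c(s)\,\langle y,\alpha_s\rangle\,\frac{q-s(q)}{\alpha_s},\qquad q\in S(V),$$ be the Dunkl operator. These operators commute, so $y\mapsto\nabla_y^{(c)}$ extends to an algebra homomorphism $p\mapsto\nabla_p^{(c)}$ from $S(V^*)$ to the linear operators on $S(V)$. The function $c$ is called regular if no $x\in S(V)$ of positive degree satisfies $\nabla_y^{(c)}(x)=0$ for all $y\in V^*$.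 An element $x\in S(V)$ is called $(W,c)$-quasiharmonic if $\nabla_p^{(c)}(x)=0$ for every $p\in S(V^*)^W$ with zero constant term and $\deg p<h$. Let $c$ be regular. Then the degree of every nonzero homogeneous $(W,c)$-quasiharmonic $W$-invariant $q\in S(V)^W$ is divisible by $h$. Moreover, for every integer $k\ge 0$ there is a nonzero homogeneous $(W,c)$-quasiharmonic $W$-invariant $e_{kh}^{(c)}\in S(V)^W$ of degree $kh$, and every homogeneous $(W,c)$-quasiharmonic $W$-invariant of degree $kh$ is a scalar multiple of it. -/

import Mathlib

noncomputable section

namespace CherednikQH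

/-- The Euclidean space `V_ℝ`. -/
abbrev E (n : ℕ) := EuclideanSpace ℝ (Fin n)

/-- The symmetric algebra of `V = ℂ ⊗ V_ℝ`, as the polynomial ring on the standard basis of `V`.
The symmetric algebra of `V*` is the polynomial ring on the dual basis, hence the same ring. -/
abbrev S (n : ℕ) := MvPolynomial (Fin n) ℂ

/-- The inclusion `V_ℝ → V → S(V)`. -/
def lin {n : ℕ} (v : E n) : S n :=
  ∑ j, MvPolynomial.C ((v j : ℝ) : ℂ) * MvPolynomial.X j

/-- The action of an isometry on `S(V)`, extending its action on `V`. As isometries are orthogonal,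
the same formula in the dual basis is the (contragredient) action on `S(V*)`. -/
def act {n : ℕ} (w : E n ≃ₗᵢ[ℝ] E n) : S n →ₐ[ℂ] S n :=
  MvPolynomial.aeval fun i => lin (w (EuclideanSpace.single i 1))

/-- `s` is the orthogonal reflection in some hyperplane. -/
def IsReflection {n : ℕ} (s : E n ≃ₗᵢ[ℝ] E n) : Prop :=
  ∃ α : E n, α ≠ 0 ∧ s = (ℝ ∙ α)ᗮ.reflection

/-- The set of all reflections in `W`. -/
def reflections {n : ℕ} (W : Subgroup (E n ≃ₗᵢ[ℝ] E n)) : Set (E n ≃ₗᵢ[ℝ] E n) :=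
  {s | s ∈ W ∧ IsReflection s}

/-- `W` is a finite group generated by reflections which acts irreducibly on `V_ℝ`. -/
structure IsIrreducibleReflectionGroup {n : ℕ} (W : Subgroup (E n ≃ₗᵢ[ℝ] E n)) : Prop where
  finite : Finite W
  generated : Subgroup.closure (reflections W) = W
  nontrivial : 0 < n
  irreducible : ∀ U : Submodule ℝ (E n), (∀ w ∈ W, ∀ u ∈ U, w u ∈ U) → U = ⊥ ∨ U = ⊤

/-- The subalgebra of `W`-invariants, in `S(V)` or in `S(V*)`. -/
def invariants {n : ℕ} (W : Subgroup (E n ≃ₗᵢ[ℝ] E n)) : Subalgebra ℂ (S n) where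
  carrier := {p | ∀ w ∈ W, act w p = p}
  mul_mem' ha hb w hw := by rw [map_mul, ha w hw, hb w hw]
  add_mem' ha hb w hw := by rw [map_add, ha w hw, hb w hw]
  algebraMap_mem' r w _ := (act w).commutes r

/-- `e` is a system of elementary invariants of `W`, of degrees `d`: homogeneous, algebraically
independent generators of the algebra of invariants, as many as the rank of `W`. -/
structure IsElementaryInvariants {n : ℕ} (W : Subgroup (E n ≃ₗᵢ[ℝ] E n))
    (d : Fin n → ℕ) (e : Fin n → S n) : Prop where
  homogeneous : ∀ i, (e i).IsHomogeneous (d i)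
  algebraicIndependent : AlgebraicIndependent ℂ e
  generate : Algebra.adjoin ℂ (Set.range e) = invariants W

/-- The Coxeter number: the largest degree of an elementary invariant. -/
def coxeterNumber {n : ℕ} (W : Subgroup (E n ≃ₗᵢ[ℝ] E n)) : ℕ :=
  sSup {m | ∃ (d : Fin n → ℕ) (e : Fin n → S n), IsElementaryInvariants W d e ∧ ∃ i, d i = m}

/-- A root of a reflection. The Dunkl operators do not depend on its choice. -/
def root {n : ℕ} {W : Subgroup (E n ≃ₗᵢ[ℝ] E n)} (s : reflections W) : E n := s.2.2.choose

theorem root_ne_zero {n : ℕ} {W : Subgroup (E n ≃ₗᵢ[ℝ] E n)} (s : reflections W) :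
    root s ≠ 0 := s.2.2.choose_spec.1

theorem eq_reflection_root {n : ℕ} {W : Subgroup (E n ≃ₗᵢ[ℝ] E n)} (s : reflections W) :
    (s : E n ≃ₗᵢ[ℝ] E n) = (ℝ ∙ root s)ᗮ.reflection := s.2.2.choose_spec.2

theorem lin_add {n : ℕ} (u v : E n) : lin (u + v) = lin u + lin v := by
  simp [lin, add_mul, Finset.sum_add_distrib]

theorem lin_smul {n : ℕ} (a : ℝ) (v : E n) : lin (a • v) = MvPolynomial.C (a : ℂ) * lin v := by
  simp [lin, Finset.mul_sum, mul_assoc]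

theorem lin_single {n : ℕ} (i : Fin n) : lin (EuclideanSpace.single i 1) = MvPolynomial.X i := by
  rw [lin, Finset.sum_eq_single i]
  · simp
  · intro j _ hj
    simp [hj]
  · simp

theorem lin_ne_zero {n : ℕ} {v : E n} (hv : v ≠ 0) : lin v ≠ 0 := by
  intro h
  apply hv
  ext i
  have := congrArg (MvPolynomial.coeff (Finsupp.single i 1)) h
  simpa [lin, MvPolynomial.coeff_sum, MvPolynomial.coeff_C_mul, MvPolynomial.coeff_X,
    Finsupp.single_left_inj] using this

theorem root_dvd {n : ℕ} {W : Subgroup (E n ≃ₗᵢ[ℝ] E n)} (s : reflections W) (q : S n) :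
    lin (root s) ∣ q - act s q := by
  induction q using MvPolynomial.induction_on with
  | C a => simp [act]
  | add p q hp hq =>
    rw [map_add, add_sub_add_comm]
    exact dvd_add hp hq
  | mul_X p i hp =>
    have hX : lin (root s) ∣ MvPolynomial.X i - act s (MvPolynomial.X i) := by
      have h : (s : E n ≃ₗᵢ[ℝ] E n) (EuclideanSpace.single i 1)
          + (2 * (inner ℝ (root s) (EuclideanSpace.single i 1) / ‖root s‖ ^ 2)) • root s
          = EuclideanSpace.single i 1 := by
        rw [eq_reflection_root s, Submodule.reflection_orthogonal_apply,
          Submodule.reflection_singleton_apply]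
        simp only [RCLike.ofReal_real_eq_id, id_eq]
        module
      have h2 := congrArg lin h
      rw [lin_add, lin_smul, lin_single] at h2
      have h3 : act s (MvPolynomial.X i) = lin ((s : E n ≃ₗᵢ[ℝ] E n) (EuclideanSpace.single i 1)) := by
        rw [act, MvPolynomial.aeval_X]
      rw [h3, ← h2, add_sub_cancel_left]
      exact dvd_mul_left _ _
    rw [map_mul]
    have : p * MvPolynomial.X i - act s p * act s (MvPolynomial.X i)
        = p * (MvPolynomial.X i - act s (MvPolynomial.X i))
          + (p - act s p) * act s (MvPolynomial.X i) := by ring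
    rw [this]
    exact dvd_add (dvd_mul_of_dvd_right hX _) (dvd_mul_of_dvd_left hp _)

/-- The quotient `(q - s(q)) / α_s`. -/
def divDiff {n : ℕ} {W : Subgroup (E n ≃ₗᵢ[ℝ] E n)} (s : reflections W) : S n →ₗ[ℂ] S n where
  toFun q := (root_dvd s q).choose
  map_add' p q := by
    apply mul_left_cancel₀ (lin_ne_zero (root_ne_zero s))
    rw [mul_add, ← (root_dvd s (p + q)).choose_spec, ← (root_dvd s p).choose_spec,
      ← (root_dvd s q).choose_spec, map_add]
    ring
  map_smul' a q := by
    apply mul_left_cancel₀ (lin_ne_zero (root_ne_zero s))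
    rw [RingHom.id_apply, mul_smul_comm, ← (root_dvd s (a • q)).choose_spec,
      ← (root_dvd s q).choose_spec, map_smul, smul_sub]

theorem root_mul_divDiff {n : ℕ} {W : Subgroup (E n ≃ₗᵢ[ℝ] E n)} (s : reflections W) (q : S n) :
    lin (root s) * divDiff s q = q - act s q := (root_dvd s q).choose_spec.symm

/-- The Dunkl operator
`∇_y(q) = ∂q/∂y - ∑_{s} c(s) ⟨y, α_s⟩ (q - s(q)) / α_s` on `S(V)`, for `y ∈ V*` given by its
coordinates in the dual basis. -/
def dunkl {n : ℕ} {W : Subgroup (E n ≃ₗᵢ[ℝ] E n)} (c : reflections W → ℂ) (y : Fin n → ℂ) :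
    S n →ₗ[ℂ] S n :=
  (∑ i, y i • (MvPolynomial.pderiv i : Derivation ℂ (S n) (S n)).toLinearMap)
    - ∑ᶠ s : reflections W, (c s * ∑ i, y i * ((root s i : ℝ) : ℂ)) • divDiff s

/-- The operator `∇_p` for `p ∈ S(V*)`: the Dunkl operators of the dual basis are substituted for
the variables of `p`. (They commute, so that the order of the factors does not matter.) -/
def nabla {n : ℕ} {W : Subgroup (E n ≃ₗᵢ[ℝ] E n)} (c : reflections W → ℂ) (p : S n) :
    Module.End ℂ (S n) :=
  ∑ m ∈ p.support, p.coeff m •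
    (List.ofFn fun i => (dunkl c (Pi.single i 1) : Module.End ℂ (S n)) ^ m i).prod

/-- `c` is invariant under conjugation by elements of `W`. -/
def IsConjInvariant {n : ℕ} {W : Subgroup (E n ≃ₗᵢ[ℝ] E n)} (c : reflections W → ℂ) : Prop :=
  ∀ s t : reflections W, ∀ w ∈ W, (t : E n ≃ₗᵢ[ℝ] E n) = w * s * w⁻¹ → c t = c s

/-- `c` is singular: some `x ∈ S(V)` of positive degree is killed by all Dunkl operators. -/
def IsSingular {n : ℕ} {W : Subgroup (E n ≃ₗᵢ[ℝ] E n)} (c : reflections W → ℂ) : Prop :=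
  ∃ x : S n, 0 < x.totalDegree ∧ ∀ y : Fin n → ℂ, dunkl c y x = 0

/-- `c` is regular: conjugation-invariant and not singular. -/
def IsRegular {n : ℕ} {W : Subgroup (E n ≃ₗᵢ[ℝ] E n)} (c : reflections W → ℂ) : Prop :=
  IsConjInvariant c ∧ ¬ IsSingular c

/-- `x` is `(W,c)`-quasiharmonic: it is killed by `∇_p` for all `W`-invariant `p ∈ S(V*)` without
constant term and of degree less than the Coxeter number. -/
def IsQuasiharmonic {n : ℕ} {W : Subgroup (E n ≃ₗᵢ[ℝ] E n)} (c : reflections W → ℂ) (x : S n) :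
    Prop :=
  ∀ p ∈ invariants W, MvPolynomial.constantCoeff p = 0 → p.totalDegree < coxeterNumber W →
    nabla c p x = 0

end CherednikQH

end

noncomputable section

namespace CherednikQH

open MvPolynomial

/-! ### The action of isometries -/

section Action

variable {n : ℕ}

/-! The proof has two independent halves. The first is duality. Pair an operator symbol `p` with a
polynomial `x` of the same degree by the constant term of `∇_p x`. A nonzero polynomial of positive
degree that pairs to zero with everything would, by induction on the degree, be killed by all Dunkl
operators; so regularity of `c` says exactly that the pairing is nondegenerate
(`eq_zero_of_constantCoeff_nabla`). It is `W`-invariant, hence stays nondegenerate between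
invariants (`eq_zero_of_constantCoeff_nabla_invariants`), and every functional on the invariants of
a given degree is represented by an invariant (`exists_constantCoeff_nabla_eq`).

Suppose that exactly one elementary invariant, `e i₀`, has degree `h`. A quasiharmonic invariant is
killed by every monomial in the elementary invariants that contains some other `e i`, so it is
determined by its pairing with the powers of `e i₀`. These live in degrees `k * h`, one in each:
this gives divisibility and uniqueness up to scalars. Conversely, the invariant representing the
functional "coefficient of `e i₀ ^ k`" is quasiharmonic, because a symbol of positive degree below
`h` involves no pure power of `e i₀`, nor does any multiple of it (`quasiharmonic_invariants`).

The second and longer half shows that the largest degree is attained only once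
(`exists_elementaryInvariants`). Chevalley's lemma on syzygies (`sum_smul_mem_posIdeal`) gives
algebraic independence of minimal generators and freeness of `S(V)` over the invariants; Hilbert
series then count the generators and bound the sum of their degrees by the top degree of the
coinvariant algebra. Steinberg's argument with the product of the roots bounds that top degree by
the number `N` of reflections (`isHomogeneous_mem_posIdeal`). So the Jacobian of the generators is a
nonzero multiple of the product of the roots, and the sum of the `d i - 1` is `N`
(`jacobian_det_eq`).

Finally, take a Coxeter element `g`, with an eigenvector off all mirrors
(`exists_regular_eigenvector`). It has no fixed vectors and at most `n` inversions, which yields `2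
* N ≤ n * orderOf g`. Evaluating the Gram matrix of the differentials at the eigenvector gives a
permutation `σ` with `orderOf g ∣ (d (σ i) - 1) + (d i - 1)`; summation turns divisibility into
equality. Thus large degrees are matched with small ones, and the smallest degree, `2`, occurs once
because an irreducible group has only one quadratic invariant up to scalars (`exists_max_degree`).
Rank one is trivial and is treated separately. -/

theorem lin_zero : lin (0 : E n) = 0 := by simp [lin]

theorem lin_neg (v : E n) : lin (-v) = -lin v := by
  have := lin_smul (-1) v
  simpa using this

theorem lin_sub (u v : E n) : lin (u - v) = lin u - lin v := by
  rw [sub_eq_add_neg, lin_add, lin_neg, sub_eq_add_neg]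

theorem lin_sum {ι : Type*} (t : Finset ι) (f : ι → E n) :
    lin (∑ i ∈ t, f i) = ∑ i ∈ t, lin (f i) := by
  classical
  induction t using Finset.induction_on with
  | empty => simp [lin_zero]
  | insert a t ha ih => rw [Finset.sum_insert ha, Finset.sum_insert ha, lin_add, ih]

theorem lin_isHomogeneous (v : E n) : (lin v).IsHomogeneous 1 :=
  IsHomogeneous.sum _ _ _ fun j _ => by
    simpa using (isHomogeneous_C (Fin n) ((v j : ℝ) : ℂ)).mul (isHomogeneous_X ℂ j)

theorem eq_sum_single (v : E n) : v = ∑ i, v i • EuclideanSpace.single i (1 : ℝ) := by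
  ext j
  simp [Finset.sum_apply, Pi.single_apply]

theorem act_X (w : E n ≃ₗᵢ[ℝ] E n) (i : Fin n) :
    act w (X i) = lin (w (EuclideanSpace.single i 1)) := by
  rw [act, aeval_X]

theorem act_C (w : E n ≃ₗᵢ[ℝ] E n) (a : ℂ) : act w (C a) = C a :=
  (act w).commutes a

theorem act_lin (w : E n ≃ₗᵢ[ℝ] E n) (v : E n) : act w (lin v) = lin (w v) := by
  conv_rhs => rw [eq_sum_single v, map_sum, lin_sum]
  rw [lin, map_sum]
  refine Finset.sum_congr rfl fun i _ => ?_
  rw [map_mul, act_C, act_X, map_smul, lin_smul]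

theorem act_mul_apply (w w' : E n ≃ₗᵢ[ℝ] E n) (q : S n) :
    act (w * w') q = act w (act w' q) := by
  have : act (w * w') = (act w).comp (act w') := by
    apply algHom_ext
    intro i
    rw [AlgHom.comp_apply, act_X, act_X, act_lin]
    rfl
  rw [this]; rfl

theorem act_one_apply (q : S n) : act (1 : E n ≃ₗᵢ[ℝ] E n) q = q := by
  have : act (1 : E n ≃ₗᵢ[ℝ] E n) = AlgHom.id ℂ (S n) := by
    apply algHom_ext
    intro i
    rw [act_X]
    exact lin_single i
  rw [this]; rfl

theorem act_inv_act (w : E n ≃ₗᵢ[ℝ] E n) (q : S n) : act w⁻¹ (act w q) = q := by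
  rw [← act_mul_apply, inv_mul_cancel, act_one_apply]

theorem act_injective (w : E n ≃ₗᵢ[ℝ] E n) : Function.Injective (act w) :=
  Function.LeftInverse.injective (act_inv_act w)

theorem act_isHomogeneous (w : E n ≃ₗᵢ[ℝ] E n) {q : S n} {d : ℕ} (hq : q.IsHomogeneous d) :
    (act w q).IsHomogeneous d := by
  have := hq.aeval (fun i => lin (w (EuclideanSpace.single i 1))) (n := 1)
    fun i => lin_isHomogeneous _
  simpa [act] using this

end Action

/-! ### Reflections -/

section Reflections

variable {n : ℕ}

/-- The coefficient of `α` in `v - s_α(v)`. -/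
def reflCoeff (α v : E n) : ℝ := 2 * (inner ℝ α v / ‖α‖ ^ 2)

theorem reflection_apply (α v : E n) :
    (ℝ ∙ α)ᗮ.reflection v = v - reflCoeff α v • α := by
  rw [Submodule.reflection_orthogonal_apply, Submodule.reflection_singleton_apply, reflCoeff]
  simp only [RCLike.ofReal_real_eq_id, id_eq]
  module

theorem reflCoeff_self {α : E n} (hα : α ≠ 0) : reflCoeff α α = 2 := by
  have : ‖α‖ ≠ 0 := norm_ne_zero_iff.2 hα
  rw [reflCoeff, real_inner_self_eq_norm_sq]
  field_simp

theorem reflection_self {α : E n} (hα : α ≠ 0) : (ℝ ∙ α)ᗮ.reflection α = -α := by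
  rw [reflection_apply, reflCoeff_self hα]
  module

theorem exists_smul_of_reflection_eq {α β : E n} (hβ : β ≠ 0)
    (h : (ℝ ∙ α)ᗮ.reflection = (ℝ ∙ β)ᗮ.reflection) : ∃ t : ℝ, t ≠ 0 ∧ β = t • α := by
  have h1 := congrArg (fun f : E n ≃ₗᵢ[ℝ] E n => f β) h
  simp only [reflection_self hβ, reflection_apply α β] at h1
  have h2 : β = (reflCoeff α β / 2) • α := by
    have h3 : (2 : ℝ) • β = reflCoeff α β • α := by
      rw [two_smul, ← sub_eq_zero]
      rw [← sub_eq_zero] at h1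
      rw [← h1]
      abel
    rw [div_eq_inv_mul, mul_smul, ← h3, smul_smul]
    norm_num
  refine ⟨_, ?_, h2⟩
  intro h0
  rw [h0, zero_smul] at h2
  exact hβ h2

theorem conj_reflection (w : E n ≃ₗᵢ[ℝ] E n) (α : E n) :
    w * (ℝ ∙ α)ᗮ.reflection * w⁻¹ = (ℝ ∙ w α)ᗮ.reflection := by
  ext1 v
  change w ((ℝ ∙ α)ᗮ.reflection (w⁻¹ v)) = _
  have hw : w (w⁻¹ v) = v := w.apply_symm_apply v
  rw [reflection_apply, reflection_apply, map_sub, map_smul, hw]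
  have : reflCoeff (w α) v = reflCoeff α (w⁻¹ v) := by
    rw [reflCoeff, reflCoeff, w.norm_map]
    conv_lhs => rw [← hw, w.inner_map_map]
  rw [this]

variable {W : Subgroup (E n ≃ₗᵢ[ℝ] E n)}

theorem refl_apply (s : reflections W) (v : E n) :
    (s : E n ≃ₗᵢ[ℝ] E n) v = v - reflCoeff (root s) v • root s := by
  conv_lhs => rw [eq_reflection_root s]
  exact reflection_apply _ _

theorem refl_mul_self (s : reflections W) :
    (s : E n ≃ₗᵢ[ℝ] E n) * (s : E n ≃ₗᵢ[ℝ] E n) = 1 := by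
  have h : ∀ v, (s : E n ≃ₗᵢ[ℝ] E n) v = (ℝ ∙ root s)ᗮ.reflection v :=
    fun v => congrArg (fun f : E n ≃ₗᵢ[ℝ] E n => f v) (eq_reflection_root s)
  ext1 v
  change (s : E n ≃ₗᵢ[ℝ] E n) ((s : E n ≃ₗᵢ[ℝ] E n) v) = v
  rw [h, h, Submodule.reflection_reflection]

theorem refl_inv (s : reflections W) :
    (s : E n ≃ₗᵢ[ℝ] E n)⁻¹ = s := inv_eq_of_mul_eq_one_right (refl_mul_self s)

theorem act_refl_lin (s : reflections W) (v : E n) :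
    act s (lin v) = lin v - C (reflCoeff (root s) v : ℂ) * lin (root s) := by
  rw [act_lin, refl_apply, lin_sub, lin_smul]

theorem act_refl_root (s : reflections W) : act s (lin (root s)) = -lin (root s) := by
  rw [act_refl_lin, reflCoeff_self (root_ne_zero s)]
  have : (C ((2 : ℝ) : ℂ) : S n) = 2 := by simpa using map_ofNat (C : ℂ →+* S n) 2
  rw [this]; ring

/-- The set of reflections is stable under conjugation. -/
def conjRefl (w : W) : reflections W ≃ reflections W where
  toFun s := ⟨w * s * (w : E n ≃ₗᵢ[ℝ] E n)⁻¹, W.mul_mem (W.mul_mem w.2 s.2.1) (W.inv_mem w.2),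
    (w : E n ≃ₗᵢ[ℝ] E n) (root s), by simpa using root_ne_zero s, by
      conv_lhs => rw [eq_reflection_root s]
      exact conj_reflection _ _⟩
  invFun s := ⟨(w : E n ≃ₗᵢ[ℝ] E n)⁻¹ * s * w, W.mul_mem (W.mul_mem (W.inv_mem w.2) s.2.1) w.2,
    (w : E n ≃ₗᵢ[ℝ] E n)⁻¹ (root s), by simpa using root_ne_zero s, by
      conv_lhs => rw [eq_reflection_root s]
      simpa using conj_reflection (w : E n ≃ₗᵢ[ℝ] E n)⁻¹ (root s)⟩
  left_inv s := by
    apply Subtype.ext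
    simp [mul_assoc]
  right_inv s := by
    apply Subtype.ext
    simp [mul_assoc]

theorem coe_conjRefl (w : W) (s : reflections W) :
    (conjRefl w s : E n ≃ₗᵢ[ℝ] E n) = w * s * (w : E n ≃ₗᵢ[ℝ] E n)⁻¹ := rfl

theorem exists_root_conjRefl (w : W) (s : reflections W) :
    ∃ t : ℝ, t ≠ 0 ∧ root (conjRefl w s) = t • (w : E n ≃ₗᵢ[ℝ] E n) (root s) := by
  refine exists_smul_of_reflection_eq (root_ne_zero _) ?_
  rw [← eq_reflection_root, ← conj_reflection, ← eq_reflection_root s]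
  rfl

theorem act_conjRefl (w : W) (s : reflections W) (q : S n) :
    act (conjRefl w s) (act w q) = act w (act s q) := by
  rw [← act_mul_apply, ← act_mul_apply, coe_conjRefl, inv_mul_cancel_right]

end Reflections

/-! ### Divided differences -/

section DivDiff

variable {n : ℕ} {W : Subgroup (E n ≃ₗᵢ[ℝ] E n)}

theorem lin_root_ne_zero (s : reflections W) : lin (root s) ≠ 0 := lin_ne_zero (root_ne_zero s)

theorem divDiff_eq_of_mul_eq (s : reflections W) {p q : S n}
    (h : lin (root s) * p = q - act s q) : divDiff s q = p :=
  mul_left_cancel₀ (lin_root_ne_zero s) (by rw [root_mul_divDiff, h])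

theorem divDiff_C (s : reflections W) (a : ℂ) : divDiff s (C a) = 0 :=
  divDiff_eq_of_mul_eq s (by rw [act_C, mul_zero, sub_self])

theorem divDiff_mul (s : reflections W) (p q : S n) :
    divDiff s (p * q) = p * divDiff s q + divDiff s p * act s q := by
  apply divDiff_eq_of_mul_eq
  rw [mul_add, mul_left_comm, root_mul_divDiff, ← mul_assoc, root_mul_divDiff, map_mul]
  ring

theorem divDiff_lin (s : reflections W) (v : E n) :
    divDiff s (lin v) = C (reflCoeff (root s) v : ℂ) := by
  apply divDiff_eq_of_mul_eq
  rw [act_refl_lin]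
  ring

/-- Linearity over the invariants is what makes divided differences act on syzygies with invariant
coefficients and on the ideal `posIdeal W`. -/
theorem divDiff_invariant_mul (s : reflections W) {p : S n} (hp : p ∈ invariants W) (q : S n) :
    divDiff s (p * q) = p * divDiff s q := by
  apply divDiff_eq_of_mul_eq
  rw [mul_left_comm, root_mul_divDiff, map_mul, hp s s.2.1]
  ring

/-- Multiplication by the root shifts components by one degree and is injective, so a component in a
wrong degree would survive in `q - s(q)`. -/
theorem divDiff_isHomogeneous (s : reflections W) {q : S n} {d : ℕ}
    (hq : q.IsHomogeneous (d + 1)) : (divDiff s q).IsHomogeneous d := by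
  by_cases h : divDiff s q = 0
  · rw [h]; exact isHomogeneous_zero _ _ _
  have h1 : (lin (root s) * divDiff s q).IsHomogeneous (d + 1) := by
    rw [root_mul_divDiff]
    exact hq.sub (act_isHomogeneous _ hq)
  have h2 : ∀ k, homogeneousComponent (k + 1) (lin (root s) * divDiff s q) =
      lin (root s) * homogeneousComponent k (divDiff s q) := by
    intro k
    have := sum_homogeneousComponent (divDiff s q)
    conv_lhs => rw [← this, Finset.mul_sum, map_sum]
    have h3 : ∀ i, homogeneousComponent (k + 1)
        (lin (root s) * homogeneousComponent i (divDiff s q)) =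
        if i = k then lin (root s) * homogeneousComponent i (divDiff s q) else 0 := by
      intro i
      have h4 : (lin (root s) * homogeneousComponent i (divDiff s q)).IsHomogeneous (i + 1) := by
        rw [add_comm]
        exact (lin_isHomogeneous _).mul (homogeneousComponent_isHomogeneous _ _)
      rw [homogeneousComponent_of_mem h4]
      simp [eq_comm]
    simp only [h3, Finset.sum_ite_eq', Finset.mem_range]
    split_ifs with h5
    · rfl
    · rw [homogeneousComponent_eq_zero _ _ (by omega), mul_zero]
  have h3 : ∀ k, k ≠ d → homogeneousComponent k (divDiff s q) = 0 := by
    intro k hk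
    have := h2 k
    rw [homogeneousComponent_of_mem h1, if_neg (by omega)] at this
    exact (mul_eq_zero.1 this.symm).resolve_left (lin_root_ne_zero s)
  have h4 := sum_homogeneousComponent (divDiff s q)
  rw [← h4]
  refine IsHomogeneous.sum _ _ _ fun k _ => ?_
  by_cases hk : k = d
  · rw [hk]; exact homogeneousComponent_isHomogeneous _ _
  · rw [h3 k hk]; exact isHomogeneous_zero _ _ _

/-- The root chosen for `w s w⁻¹` is only proportional to `w` applied to the root chosen for `s`.
The factor `t` is recorded because it cancels in a Dunkl operator, where the root occurs once in the
numerator and once in the denominator. -/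
theorem act_divDiff (w : W) (s : reflections W) :
    ∃ t : ℝ, t ≠ 0 ∧ root (conjRefl w s) = t • (w : E n ≃ₗᵢ[ℝ] E n) (root s) ∧
      ∀ q, act w (divDiff s q) = C (t : ℂ) * divDiff (conjRefl w s) (act w q) := by
  obtain ⟨t, ht, h⟩ := exists_root_conjRefl w s
  refine ⟨t, ht, h, fun q => ?_⟩
  have h1 : lin ((w : E n ≃ₗᵢ[ℝ] E n) (root s)) ≠ 0 := lin_ne_zero (by simpa using root_ne_zero s)
  apply mul_left_cancel₀ h1
  have h2 := root_mul_divDiff (conjRefl w s) (act w q)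
  rw [h, lin_smul, act_conjRefl] at h2
  rw [← act_lin, ← map_mul, root_mul_divDiff, map_sub, ← h2, act_lin]
  ring

end DivDiff

end CherednikQH

end

noncomputable section

namespace CherednikQH

open MvPolynomial

/-! ### Dunkl operators -/

section Dunkl

variable {n : ℕ} {W : Subgroup (E n ≃ₗᵢ[ℝ] E n)}

theorem ofReal_inner (u v : E n) :
    ((inner ℝ u v : ℝ) : ℂ) = ∑ i, ((u i : ℝ) : ℂ) * ((v i : ℝ) : ℂ) := by
  rw [PiLp.inner_apply]
  push_cast
  refine Finset.sum_congr rfl fun i _ => ?_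
  simp [mul_comm]

/-- The derivative in the direction of a real vector. -/
def dirDeriv (v : E n) : Derivation ℂ (S n) (S n) :=
  ∑ i, ((v i : ℝ) : ℂ) • (pderiv i : Derivation ℂ (S n) (S n))

theorem dirDeriv_apply (v : E n) (q : S n) :
    dirDeriv v q = ∑ i, ((v i : ℝ) : ℂ) • pderiv i q := by
  simp only [dirDeriv, ← Derivation.coeFnAddMonoidHom_apply, map_sum, Finset.sum_apply]
  rfl

theorem dirDeriv_single (i : Fin n) (q : S n) :
    dirDeriv (EuclideanSpace.single i 1) q = pderiv i q := by
  rw [dirDeriv_apply, Finset.sum_eq_single i]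
  · simp
  · intro j _ hj
    simp [hj]
  · simp

theorem dirDeriv_lin (v u : E n) : dirDeriv v (lin u) = C ((inner ℝ v u : ℝ) : ℂ) := by
  rw [dirDeriv_apply, ofReal_inner, map_sum]
  refine Finset.sum_congr rfl fun i _ => ?_
  rw [lin, map_sum, Finset.sum_eq_single i]
  · rw [Derivation.leibniz, pderiv_X_self, pderiv_C, smul_zero, add_zero, smul_eq_mul, mul_one,
      smul_eq_C_mul, ← C_mul]
  · intro j _ hj
    rw [Derivation.leibniz, pderiv_X_of_ne hj, pderiv_C, smul_zero, smul_zero, add_zero]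
  · simp

theorem dirDeriv_isHomogeneous (v : E n) {q : S n} {d : ℕ} (hq : q.IsHomogeneous d) :
    (dirDeriv v q).IsHomogeneous (d - 1) := by
  rw [dirDeriv_apply]
  refine IsHomogeneous.sum _ _ _ fun i _ => ?_
  rw [smul_eq_C_mul]
  exact hq.pderiv.C_mul _

theorem act_dirDeriv (w : E n ≃ₗᵢ[ℝ] E n) (v : E n) (q : S n) :
    act w (dirDeriv v q) = dirDeriv (w v) (act w q) := by
  induction q using MvPolynomial.induction_on with
  | C a => simp
  | add p q hp hq => rw [map_add, map_add, hp, hq, map_add, map_add]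
  | mul_X p i hp =>
    rw [← lin_single, Derivation.leibniz, map_add, map_mul, Derivation.leibniz, smul_eq_mul,
      smul_eq_mul, map_mul, map_mul, hp, act_lin, dirDeriv_lin, dirDeriv_lin, act_C,
      w.inner_map_map, smul_eq_mul, smul_eq_mul]

/-- The Dunkl operator of a real vector. -/
def realDunkl (c : reflections W → ℂ) (v : E n) : Module.End ℂ (S n) :=
  dunkl c fun i => ((v i : ℝ) : ℂ)

theorem dunkl_single (c : reflections W → ℂ) (i : Fin n) :
    dunkl c (Pi.single i 1) = realDunkl c (EuclideanSpace.single i 1) := by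
  rw [realDunkl]
  congr 1
  ext j
  by_cases h : j = i
  · subst h; simp
  · simp [h]

variable [Fintype (reflections W)]

theorem dunkl_apply (c : reflections W → ℂ) (y : Fin n → ℂ) (q : S n) :
    dunkl c y q = ∑ i, y i • pderiv i q
      - ∑ s : reflections W, (c s * ∑ i, y i * ((root s i : ℝ) : ℂ)) • divDiff s q := by
  rw [dunkl, finsum_eq_sum_of_fintype, LinearMap.sub_apply, LinearMap.sum_apply,
    LinearMap.sum_apply]
  rfl

theorem realDunkl_apply (c : reflections W → ℂ) (v : E n) (q : S n) :
    realDunkl c v q = dirDeriv v q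
      - ∑ s : reflections W, (c s * ((inner ℝ v (root s) : ℝ) : ℂ)) • divDiff s q := by
  rw [realDunkl, dunkl_apply, dirDeriv_apply]
  simp only [ofReal_inner]

theorem dunkl_eq_sum (c : reflections W → ℂ) (y : Fin n → ℂ) :
    dunkl c y = ∑ i, y i • dunkl c (Pi.single i 1) := by
  refine LinearMap.ext fun q => ?_
  rw [LinearMap.sum_apply]
  simp only [LinearMap.smul_apply, dunkl_apply, smul_sub, Finset.sum_sub_distrib]
  congr 1
  · refine Finset.sum_congr rfl fun i _ => ?_
    rw [Finset.sum_eq_single i]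
    · simp
    · intro j _ hj
      simp [hj]
    · simp
  · simp only [Finset.smul_sum]
    rw [Finset.sum_comm]
    refine Finset.sum_congr rfl fun s _ => ?_
    rw [Finset.mul_sum, Finset.sum_smul]
    refine Finset.sum_congr rfl fun i _ => ?_
    rw [smul_smul, Finset.sum_eq_single i]
    · rw [Pi.single_eq_same, one_mul]; ring_nf
    · intro j _ hj
      simp [hj]
    · simp

theorem realDunkl_add (c : reflections W → ℂ) (u v : E n) :
    realDunkl c (u + v) = realDunkl c u + realDunkl c v := by
  refine LinearMap.ext fun q => ?_
  rw [LinearMap.add_apply]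
  simp only [realDunkl_apply, dirDeriv_apply, inner_add_left, PiLp.add_apply, Complex.ofReal_add,
    add_smul, mul_add, Finset.sum_add_distrib]
  abel

theorem realDunkl_smul (c : reflections W → ℂ) (a : ℝ) (v : E n) :
    realDunkl c (a • v) = (a : ℂ) • realDunkl c v := by
  refine LinearMap.ext fun q => ?_
  rw [LinearMap.smul_apply]
  simp only [realDunkl_apply, dirDeriv_apply, real_inner_smul_left, PiLp.smul_apply, smul_eq_mul,
    Complex.ofReal_mul, smul_sub, Finset.smul_sum, smul_smul]
  congr 1
  refine Finset.sum_congr rfl fun s _ => ?_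
  congr 1
  ring

theorem realDunkl_C (c : reflections W → ℂ) (v : E n) (a : ℂ) : realDunkl c v (C a) = 0 := by
  rw [realDunkl_apply, Finset.sum_eq_zero fun s _ => by rw [divDiff_C, smul_zero], sub_zero]
  exact (dirDeriv v).map_algebraMap a

/-- This is the defining commutation relation of the rational Cherednik algebra. It is the inductive
tool for commutativity. -/
theorem realDunkl_lin_mul (c : reflections W → ℂ) (v x : E n) (q : S n) :
    realDunkl c v (lin x * q) = ((inner ℝ v x : ℝ) : ℂ) • q + lin x * realDunkl c v q
      - ∑ s : reflections W, (c s * ((inner ℝ v (root s) : ℝ) : ℂ)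
        * (reflCoeff (root s) x : ℂ)) • act s q := by
  rw [realDunkl_apply, realDunkl_apply, Derivation.leibniz, dirDeriv_lin, mul_sub, smul_eq_mul,
    smul_eq_mul, smul_eq_C_mul]
  simp only [divDiff_mul, divDiff_lin, smul_add, Finset.sum_add_distrib, Finset.mul_sum,
    mul_smul_comm]
  rw [mul_comm q]
  have : ∀ s : reflections W, (c s * ((inner ℝ v (root s) : ℝ) : ℂ)) •
      (C (reflCoeff (root s) x : ℂ) * act s q) =
      (c s * ((inner ℝ v (root s) : ℝ) : ℂ) * (reflCoeff (root s) x : ℂ)) • act s q := by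
    intro s
    rw [← smul_eq_C_mul, smul_smul]
  simp only [this]
  abel

theorem act_realDunkl {c : reflections W → ℂ} (hc : IsConjInvariant c) (w : W) (v : E n)
    (q : S n) : act w (realDunkl c v q) = realDunkl c ((w : E n ≃ₗᵢ[ℝ] E n) v) (act w q) := by
  rw [realDunkl_apply, realDunkl_apply, map_sub, act_dirDeriv, map_sum]
  congr 1
  conv_rhs => rw [← Equiv.sum_comp (conjRefl w)]
  refine Finset.sum_congr rfl fun s _ => ?_
  obtain ⟨t, _, h1, h2⟩ := act_divDiff w s
  rw [map_smul, h2, h1, real_inner_smul_right, LinearIsometryEquiv.inner_map_map,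
    hc s (conjRefl w s) w w.2 (coe_conjRefl w s), ← smul_eq_C_mul, smul_smul]
  push_cast
  congr 1
  ring

/-- Both products kill constants, so by induction on the polynomial it suffices that the commutator
commutes with multiplication by linear forms. This follows from the commutation relation and
equivariance. -/
theorem realDunkl_comm {c : reflections W → ℂ} (hc : IsConjInvariant c) (u v : E n) :
    realDunkl c u * realDunkl c v = realDunkl c v * realDunkl c u := by
  refine LinearMap.ext fun q => ?_
  change realDunkl c u (realDunkl c v q) = realDunkl c v (realDunkl c u q)
  induction q using MvPolynomial.induction_on with
  | C a => simp [realDunkl_C]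
  | add p q hp hq => simp only [map_add, hp, hq]
  | mul_X p i hp =>
    have key : ∀ (s : reflections W) (v : E n),
        act s (realDunkl c v p) = realDunkl c v (act s p)
          - (reflCoeff (root s) v : ℂ) • realDunkl c (root s) (act s p) := by
      intro s v
      have h := act_realDunkl hc ⟨s, s.2.1⟩ v p
      rw [h]
      change realDunkl c ((s : E n ≃ₗᵢ[ℝ] E n) v) (act s p) = _
      rw [refl_apply, sub_eq_add_neg, ← neg_smul, realDunkl_add, realDunkl_smul,
        LinearMap.add_apply, LinearMap.smul_apply]
      push_cast
      rw [neg_smul, sub_eq_add_neg]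
    rw [← lin_single, mul_comm]
    set x : E n := EuclideanSpace.single i 1
    -- Everything on the right is visibly symmetric in `u` and `v` except the last sum and the term
    -- covered by induction. The last sum is symmetric because the product of `⟨u, α⟩` and the
    -- coroot value at `v` is `2⟨u, α⟩⟨v, α⟩ / ‖α‖²`.
    have expand : ∀ u v : E n, realDunkl c u (realDunkl c v (lin x * p)) =
        ((inner ℝ v x : ℝ) : ℂ) • realDunkl c u p + ((inner ℝ u x : ℝ) : ℂ) • realDunkl c v p
        + lin x * realDunkl c u (realDunkl c v p)
        - ∑ s : reflections W, ((c s * ((inner ℝ u (root s) : ℝ) : ℂ)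
        * (reflCoeff (root s) x : ℂ)) • realDunkl c v (act s p) +
          (c s * ((inner ℝ v (root s) : ℝ) : ℂ)
        * (reflCoeff (root s) x : ℂ)) • realDunkl c u (act s p)
          - (c s * ((inner ℝ u (root s) : ℝ) : ℂ)
        * (reflCoeff (root s) x : ℂ) * (reflCoeff (root s) v : ℂ)) •
          realDunkl c (root s) (act s p)) := by
      intro u v
      rw [realDunkl_lin_mul, map_sub, map_add, map_smul, realDunkl_lin_mul, map_sum]
      simp only [map_smul, key, Finset.sum_sub_distrib, Finset.sum_add_distrib, smul_sub,
        smul_smul]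
      abel
    rw [expand u v, expand v u, hp]
    congr 1
    · abel
    · refine Finset.sum_congr rfl fun s _ => ?_
      have : c s * ((inner ℝ u (root s) : ℝ) : ℂ) * (reflCoeff (root s) x : ℂ) *
          (reflCoeff (root s) v : ℂ) = c s * ((inner ℝ v (root s) : ℝ) : ℂ) *
          (reflCoeff (root s) x : ℂ) * (reflCoeff (root s) u : ℂ) := by
        have h : inner ℝ u (root s) * reflCoeff (root s) v =
            inner ℝ v (root s) * reflCoeff (root s) u := by
          rw [reflCoeff, reflCoeff, real_inner_comm u, real_inner_comm v]
          ring
        have h' := congrArg (fun t : ℝ => (t : ℂ)) h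
        push_cast at h'
        linear_combination (c s * (reflCoeff (root s) x : ℂ)) * h'
      rw [this]
      abel

theorem realDunkl_isHomogeneous (c : reflections W → ℂ) (v : E n) {q : S n} {d : ℕ}
    (hq : q.IsHomogeneous (d + 1)) : (realDunkl c v q).IsHomogeneous d := by
  rw [realDunkl_apply]
  refine (dirDeriv_isHomogeneous v hq).sub (IsHomogeneous.sum _ _ _ fun s _ => ?_)
  rw [smul_eq_C_mul]
  exact (divDiff_isHomogeneous s hq).C_mul _

end Dunkl

end CherednikQH

end

noncomputable section

namespace CherednikQH

open MvPolynomial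

/-! ### The homomorphism `p ↦ ∇_p` and the contravariant pairing -/

section Nabla

variable {n : ℕ} {W : Subgroup (E n ≃ₗᵢ[ℝ] E n)}

theorem nabla_X_apply (c : reflections W → ℂ) (i : Fin n) (x : S n) : nabla c (X i) x = dunkl c (Pi.single i 1) x := by
  rw [nabla, support_X, Finset.sum_singleton, coeff_X, if_pos rfl, one_smul]
  congr 1
  have key : ∀ (l : List (Fin n)) (T : Fin n → Module.End ℂ (S n)), l.Nodup → i ∈ l →
      (l.map fun j => T j ^ (Finsupp.single i 1 : Fin n →₀ ℕ) j).prod = T i := by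
    intro l T hl hi
    induction l with
    | nil => simp at hi
    | cons a l ih =>
      rw [List.nodup_cons] at hl
      rw [List.map_cons, List.prod_cons]
      by_cases ha : a = i
      · subst ha
        have : (l.map fun j => T j ^ (Finsupp.single a 1 : Fin n →₀ ℕ) j).prod = 1 := by
          apply List.prod_eq_one
          intro t ht
          obtain ⟨j, hj, rfl⟩ := List.mem_map.1 ht
          have hne : j ≠ a := fun h => hl.1 (h ▸ hj)
          simp [Finsupp.single_eq_of_ne hne]
        rw [this]
        simp
      · rw [ih hl.2 ((List.mem_cons.1 hi).resolve_left fun h => ha h.symm)]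
        simp [Finsupp.single_eq_of_ne ha]
  rw [List.ofFn_eq_map]
  exact key _ (fun j => dunkl c (Pi.single j 1)) (List.nodup_finRange n) (List.mem_finRange i)

variable [Fintype (reflections W)]

/-- Polynomials can be evaluated only in a commutative algebra, so the evaluation takes place in the
subalgebra generated by the commuting operators and is then included into all endomorphisms. All
formal rules for `nabla` are read off from this. -/
theorem exists_nabla_eq_algHom {c : reflections W → ℂ} (hc : IsConjInvariant c) :
    ∃ φ : S n →ₐ[ℂ] Module.End ℂ (S n), ∀ p, nabla c p = φ p := by
  let T : Fin n → Module.End ℂ (S n) := fun i => dunkl c (Pi.single i 1)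
  have hT : ∀ a ∈ Set.range T, ∀ b ∈ Set.range T, a * b = b * a := by
    rintro _ ⟨i, rfl⟩ _ ⟨j, rfl⟩
    simp only [T, dunkl_single]
    exact realDunkl_comm hc _ _
  have := Algebra.isMulCommutative_adjoin ℂ hT
  let _ : CommRing (Algebra.adjoin ℂ (Set.range T)) :=
    { (inferInstance : Ring (Algebra.adjoin ℂ (Set.range T))) with mul_comm := mul_comm' }
  let f : S n →ₐ[ℂ] Algebra.adjoin ℂ (Set.range T) :=
    aeval fun i => ⟨T i, Algebra.subset_adjoin ⟨i, rfl⟩⟩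
  refine ⟨(Algebra.adjoin ℂ (Set.range T)).val.comp f, fun p => ?_⟩
  rw [AlgHom.comp_apply]
  conv_rhs => rw [p.as_sum, map_sum, map_sum]
  rw [nabla]
  refine Finset.sum_congr rfl fun m _ => ?_
  have h1 : f (monomial m (coeff m p)) = coeff m p • (List.ofFn fun i =>
      (⟨T i, Algebra.subset_adjoin ⟨i, rfl⟩⟩ : Algebra.adjoin ℂ (Set.range T)) ^ m i).prod := by
    rw [List.prod_ofFn, Algebra.smul_def]
    simp only [f, aeval_monomial]
    rw [Finsupp.prod_fintype _ _ (by simp)]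
  rw [h1, map_smul, map_list_prod, List.map_ofFn]
  rfl

variable {c : reflections W → ℂ} (hc : IsConjInvariant c)
include hc

theorem nabla_mul_apply (p q x : S n) : nabla c (p * q) x = nabla c p (nabla c q x) := by
  obtain ⟨φ, h⟩ := exists_nabla_eq_algHom hc
  rw [h, h, h, map_mul]; rfl

theorem nabla_add_apply (p q x : S n) : nabla c (p + q) x = nabla c p x + nabla c q x := by
  obtain ⟨φ, h⟩ := exists_nabla_eq_algHom hc
  rw [h, h, h, map_add]; rfl

theorem nabla_smul_apply (a : ℂ) (p x : S n) : nabla c (a • p) x = a • nabla c p x := by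
  obtain ⟨φ, h⟩ := exists_nabla_eq_algHom hc
  rw [h, h, map_smul]; rfl

theorem nabla_C_apply (a : ℂ) (x : S n) : nabla c (C a) x = a • x := by
  obtain ⟨φ, h⟩ := exists_nabla_eq_algHom hc
  rw [h, ← algebraMap_eq, AlgHom.commutes]; rfl

theorem nabla_sum_apply {ι : Type*} (t : Finset ι) (p : ι → S n) (x : S n) :
    nabla c (∑ i ∈ t, p i) x = ∑ i ∈ t, nabla c (p i) x := by
  obtain ⟨φ, h⟩ := exists_nabla_eq_algHom hc
  simp only [h, map_sum, LinearMap.sum_apply]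

theorem nabla_lin (v : E n) (x : S n) : nabla c (lin v) x = realDunkl c v x := by
  rw [lin, nabla_sum_apply hc, realDunkl, dunkl_eq_sum, LinearMap.sum_apply]
  refine Finset.sum_congr rfl fun i _ => ?_
  rw [nabla_mul_apply hc, nabla_C_apply hc, nabla_X_apply]
  rfl

theorem act_nabla (w : W) (p x : S n) :
    act w (nabla c p x) = nabla c (act w p) (act w x) := by
  induction p using MvPolynomial.induction_on generalizing x with
  | C a => rw [act_C, nabla_C_apply hc, nabla_C_apply hc, map_smul]
  | add p q hp hq =>
    rw [map_add, nabla_add_apply hc, nabla_add_apply hc, map_add, hp, hq]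
  | mul_X p i hp =>
    rw [map_mul, nabla_mul_apply hc, nabla_mul_apply hc, hp, ← lin_single, act_lin,
      nabla_lin hc, nabla_lin hc, act_realDunkl hc]

/-- `∇_p` has degree `-d` if `p` is homogeneous of degree `d`. -/
theorem nabla_isHomogeneous_aux (m : Fin n →₀ ℕ) (k : ℕ) (x : S n)
    (hx : x.IsHomogeneous (m.degree + k)) : (nabla c (monomial m 1) x).IsHomogeneous k := by
  induction m using Finsupp.induction_linear generalizing k x with
  | zero =>
    have : (monomial 0 1 : S n) = C 1 := rfl
    rw [this, nabla_C_apply hc, one_smul]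
    simpa using hx
  | add f g hf hg =>
    have : (monomial (f + g) (1 : ℂ) : S n) = monomial f 1 * monomial g 1 := by
      rw [monomial_mul, one_mul]
    rw [this, nabla_mul_apply hc]
    refine hf _ _ (hg _ _ ?_)
    rw [map_add] at hx
    rwa [← add_assoc, add_comm g.degree]
  | single i a =>
    rw [Finsupp.degree_single] at hx
    have : (monomial (Finsupp.single i a) (1 : ℂ) : S n) = X i ^ a := by
      rw [X_pow_eq_monomial]
    rw [this]
    induction a generalizing k x with
    | zero =>
      have : (X i ^ 0 : S n) = C 1 := by simp
      rw [this, nabla_C_apply hc, one_smul]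
      simpa using hx
    | succ a ih =>
      rw [pow_succ, nabla_mul_apply hc, nabla_X_apply, dunkl_single]
      refine ih k _ (realDunkl_isHomogeneous _ _ ?_) (X_pow_eq_monomial).symm
      rwa [show a + k + 1 = a + 1 + k by ring]

theorem nabla_isHomogeneous {p x : S n} {d k : ℕ} (hp : p.IsHomogeneous d)
    (hx : x.IsHomogeneous (d + k)) : (nabla c p x).IsHomogeneous k := by
  rw [p.as_sum, nabla_sum_apply hc]
  refine IsHomogeneous.sum _ _ _ fun m hm => ?_
  have : (monomial m (coeff m p) : S n) = coeff m p • monomial m 1 := by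
    rw [smul_monomial, smul_eq_mul, mul_one]
  rw [this, nabla_smul_apply hc, smul_eq_C_mul]
  have hd : m.degree = d := (hp.degree_eq_sum_deg_support hm).symm
  exact (nabla_isHomogeneous_aux hc m k x (by rwa [hd])).C_mul _

theorem nabla_eq_zero_of_lt {p x : S n} {d e : ℕ} (hp : p.IsHomogeneous d)
    (hx : x.IsHomogeneous e) (h : e < d) : nabla c p x = 0 := by
  rw [p.as_sum, nabla_sum_apply hc]
  refine Finset.sum_eq_zero fun m hm => ?_
  have hd : m.degree = d := (hp.degree_eq_sum_deg_support hm).symm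
  have hm' : (monomial m (coeff m p) : S n) = coeff m p • monomial m 1 := by
    rw [smul_monomial, smul_eq_mul, mul_one]
  rw [hm', nabla_smul_apply hc]
  have : nabla c (monomial m 1) x = 0 := by
    have hmd : e < m.degree := by omega
    clear hm hm' hd
    -- The monomial is split so that the factor `m₂` brings `x` down to degree exactly zero; the
    -- next Dunkl operator then kills the constant.
    obtain ⟨m₁, i, m₂, rfl, h2⟩ : ∃ (m₁ : Fin n →₀ ℕ) (i : Fin n) (m₂ : Fin n →₀ ℕ),
        m = m₁ + (Finsupp.single i 1 + m₂) ∧ m₂.degree = e := by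
      clear hx
      induction e generalizing m with
      | zero =>
        have : m ≠ 0 := by rintro rfl; simp at hmd
        obtain ⟨i, hi⟩ := Finsupp.ne_iff.1 this
        refine ⟨m - Finsupp.single i 1, i, 0, ?_, by simp⟩
        rw [add_zero, tsub_add_cancel_of_le]
        simpa using Nat.one_le_iff_ne_zero.2 hi
      | succ e ih =>
        obtain ⟨m₁, i, m₂, rfl, h2⟩ := ih (by omega) m (by omega)
        have h3 : m₁ ≠ 0 := by
          rintro rfl
          simp [h2] at hmd
          omega
        obtain ⟨j, hj⟩ := Finsupp.ne_iff.1 h3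
        refine ⟨m₁ - Finsupp.single j 1, j, Finsupp.single i 1 + m₂, ?_, by simp [h2, add_comm]⟩
        rw [← add_assoc (m₁ - _), tsub_add_cancel_of_le]
        simpa using Nat.one_le_iff_ne_zero.2 hj
    have h3 : (monomial (m₁ + (Finsupp.single i 1 + m₂)) (1 : ℂ) : S n)
        = monomial m₁ 1 * (X i * monomial m₂ 1) := by
      rw [X, monomial_mul, monomial_mul, one_mul, one_mul]
    rw [h3, nabla_mul_apply hc, nabla_mul_apply hc, nabla_X_apply]
    have h4 : (nabla c (monomial m₂ 1) x).IsHomogeneous 0 :=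
      nabla_isHomogeneous_aux hc m₂ 0 x (by rwa [h2, add_zero])
    have h5 : nabla c (monomial m₂ 1) x = C (coeff 0 (nabla c (monomial m₂ 1) x)) :=
      totalDegree_eq_zero_iff_eq_C.1 (Nat.le_zero.1 h4.totalDegree_le)
    rw [h5, dunkl_single, realDunkl_C, map_zero]
  rw [this, smul_zero]

end Nabla

/-! ### Nondegeneracy of the contravariant pairing -/

section Pairing

variable {n : ℕ} {W : Subgroup (E n ≃ₗᵢ[ℝ] E n)} [Fintype (reflections W)]

/-- If `x` pairs to zero with all products `p * X i`, then the Dunkl derivative of `x` along `i`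
pairs to zero with all `p` and vanishes by induction. A nonzero `x` of positive degree would thus
make `c` singular. -/
theorem eq_zero_of_constantCoeff_nabla {c : reflections W → ℂ} (hc : IsRegular c) (d : ℕ)
    (x : S n) (hx : x.IsHomogeneous d)
    (h : ∀ p : S n, p.IsHomogeneous d → constantCoeff (nabla c p x) = 0) : x = 0 := by
  induction d generalizing x with
  | zero =>
    have h1 := h 1 (isHomogeneous_one _ _)
    have h2 : x = C (coeff 0 x) :=
      totalDegree_eq_zero_iff_eq_C.1 (Nat.le_zero.1 hx.totalDegree_le)
    rw [← C_1, nabla_C_apply hc.1, one_smul] at h1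
    rw [h2]
    rw [constantCoeff_eq] at h1
    rw [h1, C_0]
  | succ d ih =>
    have h1 : ∀ i, dunkl c (Pi.single i 1) x = 0 := by
      intro i
      refine ih _ ?_ fun p hp => ?_
      · rw [dunkl_single]; exact realDunkl_isHomogeneous _ _ hx
      · rw [← nabla_X_apply, ← nabla_mul_apply hc.1]
        exact h _ (hp.mul (isHomogeneous_X _ _))
    by_contra hne
    refine hc.2 ⟨x, ?_, fun y => ?_⟩
    · rw [hx.totalDegree hne]; omega
    · rw [dunkl_eq_sum, LinearMap.sum_apply]
      exact Finset.sum_eq_zero fun i _ => by rw [LinearMap.smul_apply, h1, smul_zero]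

theorem constantCoeff_act (w : E n ≃ₗᵢ[ℝ] E n) (q : S n) :
    constantCoeff (act w q) = constantCoeff q := by
  induction q using MvPolynomial.induction_on with
  | C a => rw [act_C]
  | add p q hp hq => rw [map_add, map_add, hp, hq, map_add]
  | mul_X p i hp =>
    rw [map_mul, map_mul, map_mul, act_X, constantCoeff_X]
    have : constantCoeff (lin (w (EuclideanSpace.single i 1))) = 0 := by
      simp [lin, map_sum]
    rw [this, mul_zero, mul_zero]

end Pairing

end CherednikQH

end

noncomputable section

namespace CherednikQH

open MvPolynomial

/-! ### Averaging -/

section Average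

variable {n : ℕ} {W : Subgroup (E n ≃ₗᵢ[ℝ] E n)}

theorem homogeneousComponent_act (w : E n ≃ₗᵢ[ℝ] E n) (k : ℕ) (q : S n) :
    homogeneousComponent k (act w q) = act w (homogeneousComponent k q) := by
  conv_lhs => rw [← sum_homogeneousComponent q, map_sum, map_sum]
  have h : ∀ i, homogeneousComponent k (act w (homogeneousComponent i q)) =
      if k = i then act w (homogeneousComponent i q) else 0 := fun i =>
    homogeneousComponent_of_mem (act_isHomogeneous w (homogeneousComponent_isHomogeneous i q))
  simp only [h, Finset.sum_ite_eq, Finset.mem_range]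
  split_ifs with h5
  · rfl
  · rw [homogeneousComponent_eq_zero _ _ (by omega), map_zero]

theorem homogeneousComponent_mem_invariants {q : S n} (hq : q ∈ invariants W) (k : ℕ) :
    homogeneousComponent k q ∈ invariants W := fun w hw => by
  rw [← homogeneousComponent_act, hq w hw]

theorem nabla_mem_invariants [Fintype (reflections W)] {c : reflections W → ℂ} (hc : IsConjInvariant c) {p x : S n}
    (hp : p ∈ invariants W) (hx : x ∈ invariants W) : nabla c p x ∈ invariants W := by
  intro w hw
  rw [act_nabla hc ⟨w, hw⟩]
  change nabla c (act w p) (act w x) = _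
  rw [hp w hw, hx w hw]

variable [Fintype W]

/-- The average of a polynomial over the group `W`. -/
def average (W : Subgroup (E n ≃ₗᵢ[ℝ] E n)) [Fintype W] : S n →ₗ[ℂ] S n :=
  (Fintype.card W : ℂ)⁻¹ • ∑ w : W, (act (w : E n ≃ₗᵢ[ℝ] E n)).toLinearMap

theorem average_apply (q : S n) :
    average W q = (Fintype.card W : ℂ)⁻¹ • ∑ w : W, act (w : E n ≃ₗᵢ[ℝ] E n) q := by
  simp [average, LinearMap.sum_apply]

theorem card_ne_zero' : (Fintype.card W : ℂ) ≠ 0 := by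
  exact_mod_cast Fintype.card_ne_zero

theorem act_sum_act (w : W) (q : S n) :
    ∑ u : W, act (w : E n ≃ₗᵢ[ℝ] E n) (act (u : E n ≃ₗᵢ[ℝ] E n) q) =
      ∑ u : W, act (u : E n ≃ₗᵢ[ℝ] E n) q := by
  have h : ∀ u : W, act (w : E n ≃ₗᵢ[ℝ] E n) (act (u : E n ≃ₗᵢ[ℝ] E n) q) =
      act ((w * u : W) : E n ≃ₗᵢ[ℝ] E n) q := fun u => by
    rw [Subgroup.coe_mul, act_mul_apply]
  simp only [h]
  exact Fintype.sum_equiv (Equiv.mulLeft w) _ (fun u : W => act (u : E n ≃ₗᵢ[ℝ] E n) q)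
    fun u => rfl

theorem average_mem (q : S n) : average W q ∈ invariants W := by
  intro w hw
  have h := act_sum_act ⟨w, hw⟩ q
  simp only at h
  rw [average_apply, map_smul, map_sum, h]

theorem average_eq_of_forall {q x : S n} (h : ∀ w ∈ W, act w q = x) : average W q = x := by
  rw [average_apply, Finset.sum_congr rfl fun (w : W) _ => h w w.2, Finset.sum_const, Finset.card_univ,
    ← Nat.cast_smul_eq_nsmul ℂ, smul_smul, inv_mul_cancel₀ card_ne_zero', one_smul]

theorem average_of_mem {q : S n} (hq : q ∈ invariants W) : average W q = q :=
  average_eq_of_forall hq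

theorem average_mul {p : S n} (hp : p ∈ invariants W) (q : S n) :
    average W (p * q) = p * average W q := by
  rw [average_apply, average_apply, mul_smul_comm, Finset.mul_sum]
  congr 1
  refine Finset.sum_congr rfl fun (w : W) _ => ?_
  rw [map_mul, hp w w.2]

theorem average_isHomogeneous {q : S n} {d : ℕ} (hq : q.IsHomogeneous d) :
    (average W q).IsHomogeneous d := by
  rw [average_apply, smul_eq_C_mul]
  exact (IsHomogeneous.sum _ _ _ fun w _ => act_isHomogeneous _ hq).C_mul _

variable [Fintype (reflections W)]

/-- The pairing is `W`-invariant, so against an invariant it sees only the average of the symbol. -/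
theorem constantCoeff_nabla_average {c : reflections W → ℂ} (hc : IsConjInvariant c) (p : S n)
    {x : S n} (hx : x ∈ invariants W) :
    constantCoeff (nabla c (average W p) x) = constantCoeff (nabla c p x) := by
  have h : ∀ w : W, constantCoeff (nabla c (act w p) x) = constantCoeff (nabla c p x) := by
    intro w
    conv_lhs => rw [← hx w w.2, ← act_nabla hc, constantCoeff_act]
  rw [average_apply, nabla_smul_apply hc, nabla_sum_apply hc, smul_eq_C_mul, map_mul, map_sum,
    Finset.sum_congr rfl fun w _ => h w, Finset.sum_const, Finset.card_univ, constantCoeff_C,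
    nsmul_eq_mul, ← mul_assoc, inv_mul_cancel₀ card_ne_zero', one_mul]

theorem eq_zero_of_constantCoeff_nabla_invariants {c : reflections W → ℂ} (hc : IsRegular c)
    {d : ℕ} {x : S n} (hx : x.IsHomogeneous d) (hxW : x ∈ invariants W)
    (h : ∀ p ∈ invariants W, p.IsHomogeneous d → constantCoeff (nabla c p x) = 0) : x = 0 := by
  refine eq_zero_of_constantCoeff_nabla hc d x hx fun p hp => ?_
  rw [← constantCoeff_nabla_average hc.1 p hxW]
  exact h _ (average_mem p) (average_isHomogeneous hp)

/-- Every linear functional on the invariants of degree `d` is given by the contravariant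
pairing. -/
theorem exists_constantCoeff_nabla_eq {c : reflections W → ℂ} (hc : IsRegular c) (d : ℕ)
    (φ : invariants W →ₗ[ℂ] ℂ) :
    ∃ x ∈ invariants W, x.IsHomogeneous d ∧
      ∀ p : invariants W, (p : S n).IsHomogeneous d → constantCoeff (nabla c p x) = φ p := by
  let V : Submodule ℂ (S n) := homogeneousSubmodule (Fin n) ℂ d ⊓
    Subalgebra.toSubmodule (invariants W)
  obtain ⟨ν, hν⟩ := exists_nabla_eq_algHom hc.1
  have hfin : Module.Finite ℂ (homogeneousSubmodule (Fin n) ℂ d) :=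
    Module.Finite.iff_fg.2 (weightedHomogeneousSubmodule_fg ℂ (1 : Fin n → ℕ) (by simp) d)
  have : Module.Finite ℂ V := Submodule.finiteDimensional_inf_left _ _
  let Ψ : V →ₗ[ℂ] Module.Dual ℂ V :=
    LinearMap.mk₂ ℂ (fun x p => lcoeff ℂ 0 (ν (p : S n) (x : S n)))
      (fun a b p => by simp) (fun a b p => by simp)
      (fun a b p => by simp) (fun a b p => by simp)
  have hΨ : ∀ x p : V, Ψ x p = constantCoeff (nabla c (p : S n) (x : S n)) := fun x p => by
    rw [hν]; rfl
  have hinj : Function.Injective Ψ := by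
    rw [injective_iff_map_eq_zero]
    intro x hx
    apply Subtype.ext
    refine eq_zero_of_constantCoeff_nabla_invariants hc ((mem_homogeneousSubmodule d _).1 x.2.1)
      x.2.2 fun p hp hpd => ?_
    have := hΨ x ⟨p, (mem_homogeneousSubmodule d _).2 hpd, hp⟩
    rw [hx] at this
    exact this.symm
  -- The invariants of a fixed degree form a finite-dimensional space, so the injective map into the
  -- dual is onto.
  have hsurj : Function.Surjective Ψ :=
    (LinearMap.injective_iff_surjective_of_finrank_eq_finrank
      Subspace.dual_finrank_eq.symm).1 hinj
  obtain ⟨x, hx⟩ := hsurj (φ ∘ₗ Submodule.inclusion (inf_le_right : V ≤ _))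
  refine ⟨x, x.2.2, (mem_homogeneousSubmodule d _).1 x.2.1, fun p hp => ?_⟩
  have := hΨ x ⟨p, (mem_homogeneousSubmodule d _).2 hp, p.2⟩
  rw [hx] at this
  exact this.symm

end Average

/-! ### Quasiharmonic invariants from elementary invariants -/

section Elementary

theorem aeval_isHomogeneous_of_isWeightedHomogeneous {n : ℕ} {ι : Type*} {d : ι → ℕ}
    {e : ι → S n} (he : ∀ i, (e i).IsHomogeneous (d i)) {P : MvPolynomial ι ℂ} {k : ℕ}
    (hP : P.IsWeightedHomogeneous d k) : (aeval e P).IsHomogeneous k := by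
  rw [P.as_sum, map_sum]
  refine IsHomogeneous.sum _ _ _ fun m hm => ?_
  rw [aeval_monomial, algebraMap_eq]
  refine IsHomogeneous.C_mul ?_ _
  have := IsHomogeneous.prod m.support (fun i => e i ^ m i) (fun i => d i * m i)
    fun i _ => (he i).pow _
  have h2 : ∑ i ∈ m.support, d i * m i = k := by
    rw [← hP (mem_support_iff.1 hm), Finsupp.weight_apply, Finsupp.sum]
    exact Finset.sum_congr rfl fun i _ => by rw [smul_eq_mul, mul_comm]
  rwa [h2] at this

/-- Giving the `i`th variable the weight `d i` makes substitution of the `e i` a graded map;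
relations and preimages can therefore be taken weighted homogeneous. -/
theorem homogeneousComponent_aeval {n : ℕ} {ι : Type*} {d : ι → ℕ}
    {e : ι → S n} (he : ∀ i, (e i).IsHomogeneous (d i)) (P : MvPolynomial ι ℂ) (k : ℕ) :
    homogeneousComponent k (aeval e P) = aeval e (weightedHomogeneousComponent d k P) := by
  classical
  induction P using MvPolynomial.induction_on' with
  | add p q hp hq => rw [map_add, map_add, map_add, map_add, hp, hq]
  | monomial m a =>
    have h := isWeightedHomogeneous_monomial d m a rfl
    rw [homogeneousComponent_of_mem (aeval_isHomogeneous_of_isWeightedHomogeneous he h),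
      weightedHomogeneousComponent_of_mem (p := monomial m a) h]
    split_ifs with h1
    · rfl
    · rw [map_zero]

variable {n : ℕ} {W : Subgroup (E n ≃ₗᵢ[ℝ] E n)} {d : Fin n → ℕ} {e : Fin n → S n}

theorem IsElementaryInvariants.mem (he : IsElementaryInvariants W d e) (i : Fin n) :
    e i ∈ invariants W := by
  rw [← he.generate]
  exact Algebra.subset_adjoin ⟨i, rfl⟩

theorem IsElementaryInvariants.exists_aeval (he : IsElementaryInvariants W d e) {p : S n}
    (hp : p ∈ invariants W) : ∃ P : MvPolynomial (Fin n) ℂ, aeval e P = p := by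
  rw [← he.generate, Algebra.adjoin_range_eq_range_aeval] at hp
  exact hp

theorem IsElementaryInvariants.exists_aeval_isWeightedHomogeneous
    (he : IsElementaryInvariants W d e) {p : S n} {k : ℕ}
    (hp : p ∈ invariants W) (hk : p.IsHomogeneous k) :
    ∃ P : MvPolynomial (Fin n) ℂ, P.IsWeightedHomogeneous d k ∧ aeval e P = p := by
  obtain ⟨P, hP⟩ := he.exists_aeval hp
  refine ⟨weightedHomogeneousComponent d k P,
    weightedHomogeneousComponent_isWeightedHomogeneous _ _, ?_⟩
  rw [← homogeneousComponent_aeval he.homogeneous, hP, homogeneousComponent_of_mem hk, if_pos rfl]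

/-- The inverse of the evaluation of polynomials at elementary invariants. -/
theorem IsElementaryInvariants.exists_algHom (he : IsElementaryInvariants W d e) :
    ∃ ψ : invariants W →ₐ[ℂ] MvPolynomial (Fin n) ℂ, ∀ p, aeval e (ψ p) = (p : S n) :=
  ⟨he.algebraicIndependent.repr.comp (Subalgebra.equivOfEq _ _ he.generate.symm).toAlgHom,
    fun _ => he.algebraicIndependent.aeval_repr _⟩

/-- Polynomials without pure powers of `X i` are those that vanish when all other variables are set
to zero, hence an ideal. This is why the representing invariant is quasiharmonic. -/
theorem coeff_mul_single_eq_zero {ι : Type*} {p : MvPolynomial ι ℂ} {i : ι}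
    (hp : ∀ k, coeff (Finsupp.single i k) p = 0) (r : MvPolynomial ι ℂ) (k : ℕ) :
    coeff (Finsupp.single i k) (r * p) = 0 := by
  classical
  rw [coeff_mul]
  refine Finset.sum_eq_zero fun x hx => ?_
  have h : x.2 = Finsupp.single i (x.2 i) := by
    ext j
    by_cases hj : j = i
    · subst hj; simp
    · have := DFunLike.congr_fun (Finset.HasAntidiagonal.mem_antidiagonal.1 hx) j
      rw [Finsupp.add_apply, Finsupp.single_eq_of_ne hj] at this
      rw [Finsupp.single_eq_of_ne hj]
      omega
  rw [h, hp, mul_zero]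

variable [Fintype (reflections W)] {c : reflections W → ℂ}

theorem constantCoeff_eq_zero_of_isHomogeneous {p : S n} {k : ℕ} (hp : p.IsHomogeneous k)
    (hk : 0 < k) : constantCoeff p = 0 := by
  rw [constantCoeff_eq]
  exact hp.coeff_eq_zero (by rw [map_zero]; omega)

/-- Such a monomial has a factor `e i` with `i ≠ i₀`, of degree below `h`, and the operator of that
factor may be applied to `q` first. -/
theorem nabla_monomial_eq_zero (hc : IsConjInvariant c) (he : IsElementaryInvariants W d e)
    (hpos : ∀ i, 0 < d i) {i₀ : Fin n} (hlt : ∀ i ≠ i₀, d i < coxeterNumber W) {q : S n}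
    (hq : IsQuasiharmonic c q) (m : Fin n →₀ ℕ) (hm : ∀ k, m ≠ Finsupp.single i₀ k) :
    nabla c (aeval e (monomial m (1 : ℂ))) q = 0 := by
  obtain ⟨i, hi, hmi⟩ : ∃ i ≠ i₀, m i ≠ 0 := by
    by_contra! h
    refine hm (m i₀) ?_
    ext j
    by_cases hj : j = i₀
    · subst hj; simp
    · rw [h j hj, Finsupp.single_eq_of_ne hj]
  have h1 : (monomial m (1 : ℂ)) = monomial (m - Finsupp.single i 1) 1 * X i := by
    rw [X, monomial_mul, one_mul, tsub_add_cancel_of_le]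
    simpa using Nat.one_le_iff_ne_zero.2 hmi
  rw [h1, map_mul, nabla_mul_apply hc, aeval_X, hq (e i) (he.mem i), map_zero]
  · exact constantCoeff_eq_zero_of_isHomogeneous (he.homogeneous i) (hpos i)
  · exact lt_of_le_of_lt (he.homogeneous i).totalDegree_le (hlt i hi)

/-- Only pure powers of `X i₀` survive, and weighted homogeneity together with `hk` leaves at most
one exponent. It is not required that `k * d i₀ = D`: if this fails, both sides are zero. -/
theorem constantCoeff_nabla_quasiharmonic (hc : IsConjInvariant c)
    (he : IsElementaryInvariants W d e)
    (hpos : ∀ i, 0 < d i) {i₀ : Fin n} (hlt : ∀ i ≠ i₀, d i < coxeterNumber W) {q : S n}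
    (hq : IsQuasiharmonic c q) {P : MvPolynomial (Fin n) ℂ} {D : ℕ}
    (hP : P.IsWeightedHomogeneous d D) (k : ℕ) (hk : ∀ j, j * d i₀ = D → j = k) :
    nabla c (aeval e P) q = coeff (Finsupp.single i₀ k) P • nabla c (e i₀ ^ k) q := by
  have h0 : ∀ m : Fin n →₀ ℕ, nabla c (aeval e (monomial m (coeff m P))) q =
      coeff m P • nabla c (aeval e (monomial m (1 : ℂ))) q := by
    intro m
    rw [← nabla_smul_apply hc, ← map_smul, smul_monomial, smul_eq_mul, mul_one]
  conv_lhs => rw [P.as_sum, map_sum, nabla_sum_apply hc]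
  rw [Finset.sum_eq_single (Finsupp.single i₀ k)]
  · rw [h0]
    congr 3
    rw [aeval_monomial]
    simp
  · intro m hm hne
    rw [h0, nabla_monomial_eq_zero hc he hpos hlt hq, smul_zero]
    rintro j rfl
    have h1 := hP (mem_support_iff.1 hm)
    rw [Finsupp.weight_single, smul_eq_mul] at h1
    exact hne (by rw [hk j h1])
  · intro h
    rw [notMem_support_iff.1 h]
    simp [nabla]

end Elementary

/-! ### Quasiharmonic invariants when the largest degree is simple -/

section Reduction

variable {n : ℕ} {W : Subgroup (E n ≃ₗᵢ[ℝ] E n)} {d : Fin n → ℕ} {e : Fin n → S n}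
  [Fintype W] [Fintype (reflections W)] {c : reflections W → ℂ}

theorem coxeterNumber_dvd_of_quasiharmonic (hc : IsRegular c) (he : IsElementaryInvariants W d e)
    (hpos : ∀ i, 0 < d i) {i₀ : Fin n} (hi₀ : d i₀ = coxeterNumber W)
    (hlt : ∀ i ≠ i₀, d i < coxeterNumber W) {q : S n} {D : ℕ} (hq0 : q ≠ 0)
    (hqD : q.IsHomogeneous D) (hqW : q ∈ invariants W)
    (hq : IsQuasiharmonic c q) : coxeterNumber W ∣ D := by
  by_contra hdvd
  refine hq0 (eq_zero_of_constantCoeff_nabla_invariants hc hqD hqW fun p hp hpD => ?_)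
  obtain ⟨P, hP, rfl⟩ := he.exists_aeval_isWeightedHomogeneous hp hpD
  -- No exponent has the right weight, so `0` serves as a dummy; its coefficient vanishes because `D
  -- = 0` would be divisible by `h`.
  have h0 : coeff (Finsupp.single i₀ 0) P = 0 := by
    apply hP.coeff_eq_zero
    rw [Finsupp.weight_single, zero_smul]
    rintro rfl
    exact hdvd (dvd_zero _)
  rw [constantCoeff_nabla_quasiharmonic hc.1 he hpos hlt hq hP 0, h0, zero_smul, map_zero]
  intro j hj
  rw [← hj, hi₀] at hdvd
  exact absurd (dvd_mul_left _ _) hdvd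

theorem exists_smul_eq_of_quasiharmonic (hc : IsRegular c) (he : IsElementaryInvariants W d e)
    (hpos : ∀ i, 0 < d i) {i₀ : Fin n} (hi₀ : d i₀ = coxeterNumber W)
    (hlt : ∀ i ≠ i₀, d i < coxeterNumber W) {x q : S n} {k : ℕ}
    (hxD : x.IsHomogeneous (k * coxeterNumber W)) (hxW : x ∈ invariants W)
    (hx : IsQuasiharmonic c x) (hx0 : constantCoeff (nabla c (e i₀ ^ k) x) = 1)
    (hqD : q.IsHomogeneous (k * coxeterNumber W)) (hqW : q ∈ invariants W)
    (hq : IsQuasiharmonic c q) : ∃ a : ℂ, q = a • x := by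
  set a := constantCoeff (nabla c (e i₀ ^ k) q) with ha
  refine ⟨a, sub_eq_zero.1 ?_⟩
  refine eq_zero_of_constantCoeff_nabla_invariants hc (d := k * coxeterNumber W)
    (hqD.sub ?_) (sub_mem hqW (Subalgebra.smul_mem _ hxW a)) fun p hp hpD => ?_
  · rw [smul_eq_C_mul]; exact hxD.C_mul _
  obtain ⟨P, hP, rfl⟩ := he.exists_aeval_isWeightedHomogeneous hp hpD
  have hk : ∀ j, j * d i₀ = k * coxeterNumber W → j = k := by
    intro j hj
    rw [← hi₀] at hj
    exact Nat.eq_of_mul_eq_mul_right (hpos i₀) hj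
  rw [map_sub, map_smul, constantCoeff_nabla_quasiharmonic hc.1 he hpos hlt hq hP k hk,
    constantCoeff_nabla_quasiharmonic hc.1 he hpos hlt hx hP k hk, smul_eq_C_mul, smul_eq_C_mul,
    smul_eq_C_mul, map_sub, map_mul, map_mul, map_mul, hx0, ← ha]
  simp only [constantCoeff_C]
  ring

/-- The invariant wanted represents the functional that reads off the coefficient of `e i₀ ^ k`. Its
quasiharmonicity is tested by pairing `∇_p x` with all invariants `r`, which by multiplicativity is
the value of the functional at `r * p`. -/
theorem exists_quasiharmonic (hc : IsRegular c) (he : IsElementaryInvariants W d e)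
    {i₀ : Fin n} (hi₀ : d i₀ = coxeterNumber W) (k : ℕ) :
    ∃ x ∈ invariants W, x.IsHomogeneous (k * coxeterNumber W) ∧ IsQuasiharmonic c x ∧
      constantCoeff (nabla c (e i₀ ^ k) x) = 1 := by
  obtain ⟨ψ, hψ⟩ := he.exists_algHom
  have hinj : Function.Injective (aeval e : MvPolynomial (Fin n) ℂ → S n) :=
    he.algebraicIndependent
  obtain ⟨x, hxW, hxD, hx⟩ := exists_constantCoeff_nabla_eq hc (k * coxeterNumber W)
    (lcoeff ℂ (Finsupp.single i₀ k) ∘ₗ ψ.toLinearMap)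
  refine ⟨x, hxW, hxD, ?_, ?_⟩
  · intro p hp hp0 hpdeg
    have key : ∀ j, nabla c (homogeneousComponent j p) x = 0 := by
      intro j
      have hpj := homogeneousComponent_isHomogeneous j p
      rcases Nat.eq_zero_or_pos j with rfl | hj0
      · rw [homogeneousComponent_zero, ← constantCoeff_eq, hp0, nabla_C_apply hc.1, zero_smul]
      rcases le_or_gt (coxeterNumber W) j with hjh | hjh
      · rw [homogeneousComponent_eq_zero _ _ (by omega)]
        simp [nabla]
      rcases lt_or_ge (k * coxeterNumber W) j with hjk | hjk
      · exact nabla_eq_zero_of_lt hc.1 hpj hxD hjk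
      have hpW := homogeneousComponent_mem_invariants hp j
      obtain ⟨P, hP, hPp⟩ := he.exists_aeval_isWeightedHomogeneous hpW hpj
      refine eq_zero_of_constantCoeff_nabla_invariants hc (d := k * coxeterNumber W - j)
        (nabla_isHomogeneous hc.1 hpj (by rwa [Nat.add_sub_cancel' hjk]))
        (nabla_mem_invariants hc.1 hpW hxW) fun r hr hrd => ?_
      rw [← nabla_mul_apply hc.1]
      have h1 := hx (⟨r, hr⟩ * ⟨_, hpW⟩) (by
        have := hrd.mul hpj
        rwa [Nat.sub_add_cancel hjk] at this)
      refine h1.trans ?_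
      have h2 : ψ ⟨_, hpW⟩ = P := hinj (by rw [hψ, hPp])
      change coeff _ (ψ (_ * _)) = 0
      rw [map_mul, h2]
      -- A pure power `X i₀ ^ l` in `P` would have weight `l * h = j`, which is impossible for `0 <
      -- j < h`.
      refine coeff_mul_single_eq_zero (fun l => hP.coeff_eq_zero _ ?_) _ _
      rw [Finsupp.weight_single, smul_eq_mul, hi₀]
      rintro rfl
      rcases Nat.eq_zero_or_pos l with rfl | hl
      · simp at hj0
      · exact absurd (Nat.le_mul_of_pos_left (coxeterNumber W) hl) (by omega)
    rw [← sum_homogeneousComponent p, nabla_sum_apply hc.1]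
    exact Finset.sum_eq_zero fun j _ => key j
  · have h1 := hx (⟨e i₀, he.mem i₀⟩ ^ k) (by
      have := (he.homogeneous i₀).pow k
      rw [hi₀, mul_comm] at this
      simpa using this)
    refine h1.trans ?_
    have h2 : ψ (⟨e i₀, he.mem i₀⟩ ^ k) = X i₀ ^ k := hinj (by
      rw [hψ, map_pow, aeval_X]; rfl)
    change coeff _ (ψ _) = 1
    rw [h2, X_pow_eq_monomial, coeff_monomial, if_pos rfl]

theorem quasiharmonic_invariants (hc : IsRegular c) (he : IsElementaryInvariants W d e)
    (hpos : ∀ i, 0 < d i) {i₀ : Fin n} (hi₀ : d i₀ = coxeterNumber W)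
    (hlt : ∀ i ≠ i₀, d i < coxeterNumber W) :
    (∀ (D : ℕ) (q : S n), q ≠ 0 → q.IsHomogeneous D →
      q ∈ invariants W → IsQuasiharmonic c q → coxeterNumber W ∣ D) ∧
    (∀ k : ℕ, ∃ x : S n,
      (x ≠ 0 ∧ x.IsHomogeneous (k * coxeterNumber W) ∧
        x ∈ invariants W ∧ IsQuasiharmonic c x) ∧
      ∀ q : S n, q.IsHomogeneous (k * coxeterNumber W) →
        q ∈ invariants W → IsQuasiharmonic c q → ∃ a : ℂ, q = a • x) := by
  refine ⟨fun D q h1 h2 h3 h4 =>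
    coxeterNumber_dvd_of_quasiharmonic hc he hpos hi₀ hlt h1 h2 h3 h4, fun k => ?_⟩
  obtain ⟨x, hxW, hxD, hx, hx1⟩ := exists_quasiharmonic hc he hi₀ k
  refine ⟨x, ⟨?_, hxD, hxW, hx⟩, fun q h1 h2 h3 =>
    exists_smul_eq_of_quasiharmonic hc he hpos hi₀ hlt hxD hxW hx hx1 h1 h2 h3⟩
  rintro rfl
  simp at hx1

end Reduction

end CherednikQH

end

noncomputable section

namespace CherednikQH

open MvPolynomial

/-! ### The Coxeter number is the largest degree -/

section CoxeterNumber

variable {n : ℕ} {W : Subgroup (E n ≃ₗᵢ[ℝ] E n)} {d : Fin n → ℕ} {e : Fin n → S n}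

theorem pderiv_aeval_eq_zero {ι κ : Type*} {P : ι → MvPolynomial κ ℂ} {j : κ}
    (h : ∀ i, pderiv j (P i) = 0) (Q : MvPolynomial ι ℂ) : pderiv j (aeval P Q) = 0 := by
  induction Q using MvPolynomial.induction_on with
  | C a => simp [algebraMap_eq]
  | add p q hp hq => rw [map_add, map_add, hp, hq, add_zero]
  | mul_X p i hp => rw [map_mul, aeval_X, Derivation.leibniz, h, hp, smul_zero, smul_zero, add_zero]

/-- If every `d i` were below `d' j`, then for reasons of weight no `e i` would involve `e' j` when
written in the system `e'`. So neither would `e' j` itself, as a polynomial in the `e i`;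
differentiating `X j = aeval P Q` along `j` exposes this as `0 = 1`. -/
theorem IsElementaryInvariants.degree_le (he : IsElementaryInvariants W d e) {d' : Fin n → ℕ}
    {e' : Fin n → S n} (he' : IsElementaryInvariants W d' e') (j : Fin n) :
    ∃ i, d' j ≤ d i := by
  by_contra! h
  choose P hP hPe using fun i =>
    he'.exists_aeval_isWeightedHomogeneous (he.mem i) (he.homogeneous i)
  obtain ⟨Q, hQ⟩ := he.exists_aeval (he'.mem j)
  have h1 : (X j : MvPolynomial (Fin n) ℂ) = aeval P Q := by
    apply he'.algebraicIndependent
    rw [aeval_X, ← hQ, ← AlgHom.comp_apply]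
    congr 1
    apply algHom_ext
    intro i
    rw [aeval_X, AlgHom.comp_apply, aeval_X, hPe]
  have h2 : ∀ i, pderiv j (P i) = 0 := by
    intro i
    rw [(P i).as_sum, map_sum]
    refine Finset.sum_eq_zero fun m hm => ?_
    have hmj : m j = 0 := by
      by_contra hne
      have h3 := hP i (mem_support_iff.1 hm)
      have h4 := Finsupp.le_weight_of_ne_zero (w := d') (fun _ => Nat.zero_le _) hne
      have := h i
      omega
    rw [pderiv_monomial, hmj, Nat.cast_zero, mul_zero, monomial_zero]
  have h3 := congrArg (pderiv j) h1
  rw [pderiv_aeval_eq_zero h2, pderiv_X_self] at h3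
  exact one_ne_zero h3

/-- The supremum ranges over all elementary systems, so one system computes it only once its largest
degree is known to bound the degrees of every other. -/
theorem coxeterNumber_eq (he : IsElementaryInvariants W d e) {i₀ : Fin n}
    (hmax : ∀ i, d i ≤ d i₀) : coxeterNumber W = d i₀ := by
  refine le_antisymm (csSup_le ⟨_, d, e, he, i₀, rfl⟩ ?_) (le_csSup ⟨d i₀, ?_⟩ ⟨d, e, he, i₀, rfl⟩)
  all_goals
    rintro _ ⟨d', e', he', j, rfl⟩
    obtain ⟨i, hi⟩ := he.degree_le he' j
    exact hi.trans (hmax i)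

end CoxeterNumber

/-! ### The ideal generated by the invariants of positive degree -/

section PosIdeal

variable {n : ℕ} {W : Subgroup (E n ≃ₗᵢ[ℝ] E n)}

/-- The homogeneous invariants of positive degree. -/
def posInvariants (W : Subgroup (E n ≃ₗᵢ[ℝ] E n)) : Set (S n) :=
  {f | f ∈ invariants W ∧ ∃ d, 0 < d ∧ f.IsHomogeneous d}

/-- The ideal of `S(V)` generated by the invariants of positive degree. -/
def posIdeal (W : Subgroup (E n ≃ₗᵢ[ℝ] E n)) : Ideal (S n) := Ideal.span (posInvariants W)

theorem mem_posIdeal {f : S n} (hf : f ∈ invariants W) {d : ℕ} (hd : 0 < d)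
    (hfd : f.IsHomogeneous d) : f ∈ posIdeal W :=
  Ideal.subset_span ⟨hf, d, hd, hfd⟩

theorem mem_posIdeal_of_constantCoeff {f : S n} (hf : f ∈ invariants W)
    (h : constantCoeff f = 0) : f ∈ posIdeal W := by
  rw [← sum_homogeneousComponent f]
  refine Ideal.sum_mem _ fun k _ => ?_
  rcases Nat.eq_zero_or_pos k with rfl | hk
  · rw [homogeneousComponent_zero, ← constantCoeff_eq, h, C_0]
    exact Ideal.zero_mem _
  · exact mem_posIdeal (homogeneousComponent_mem_invariants hf k) hk
      (homogeneousComponent_isHomogeneous k f)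

theorem homogeneousComponent_mem_span {T : Set (S n)} (hT : ∀ f ∈ T, ∃ d, f.IsHomogeneous d)
    {q : S n} (hq : q ∈ Ideal.span T) (k : ℕ) : homogeneousComponent k q ∈ Ideal.span T := by
  let _ := weightedGradedAlgebra ℂ (1 : Fin n → ℕ)
  have h : (Ideal.span T).IsHomogeneous (weightedHomogeneousSubmodule ℂ (1 : Fin n → ℕ)) :=
    Ideal.homogeneous_span _ _ fun f hf => by
      obtain ⟨d, hd⟩ := hT f hf
      exact ⟨d, (mem_homogeneousSubmodule d f).2 hd⟩
  exact weightedHomogeneousComponent_mem_of_mem ℂ _ h hq k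

theorem act_mem_posIdeal {w : E n ≃ₗᵢ[ℝ] E n} (hw : w ∈ W) {q : S n} (hq : q ∈ posIdeal W) :
    act w q ∈ posIdeal W := by
  refine Submodule.span_induction (p := fun q _ => act w q ∈ posIdeal W) ?_ ?_ ?_ ?_ hq
  · rintro f hf
    rw [hf.1 w hw]
    exact Ideal.subset_span hf
  · rw [map_zero]; exact Ideal.zero_mem _
  · intro x y _ _ hx hy
    rw [map_add]; exact Ideal.add_mem _ hx hy
  · intro a x _ hx
    rw [smul_eq_mul, map_mul]; exact Ideal.mul_mem_left _ _ hx

theorem divDiff_mem_posIdeal (s : reflections W) {q : S n} (hq : q ∈ posIdeal W) :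
    divDiff s q ∈ posIdeal W := by
  -- Divided differences are not `S(V)`-linear, so the induction must carry all multiples `r * q`.
  refine Submodule.span_induction (p := fun q _ => ∀ r, divDiff s (r * q) ∈ posIdeal W)
    ?_ ?_ ?_ ?_ hq 1 |> fun h => by simpa using h
  · rintro f hf r
    rw [mul_comm, divDiff_invariant_mul s hf.1]
    exact Ideal.mul_mem_right _ _ (Ideal.subset_span hf)
  · intro r
    rw [mul_zero, map_zero]; exact Ideal.zero_mem _
  · intro x y _ _ hx hy r
    rw [mul_add, map_add]; exact Ideal.add_mem _ (hx r) (hy r)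
  · intro a x _ hx r
    rw [smul_eq_mul, ← mul_assoc]; exact hx _

theorem sub_act_mem_posIdeal (hgen : Subgroup.closure (reflections W) = W) {y : S n}
    (h : ∀ s : reflections W, y - act s y ∈ posIdeal W) {w : E n ≃ₗᵢ[ℝ] E n} (hw : w ∈ W) :
    y - act w y ∈ posIdeal W := by
  have hw' : w ∈ Subgroup.closure (reflections W) := by rwa [hgen]
  induction hw' using Subgroup.closure_induction with
  | mem s hs => exact h ⟨s, hs⟩
  | one => rw [act_one_apply, sub_self]; exact Ideal.zero_mem _
  | mul u v hu hv hu' hv' =>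
    rw [hgen] at hu hv
    have : y - act (u * v) y = (y - act u y) + act u (y - act v y) := by
      rw [act_mul_apply, map_sub]; ring
    rw [this]
    exact Ideal.add_mem _ (hu' hu) (act_mem_posIdeal hu (hv' hv))
  | inv u hu hu' =>
    rw [hgen] at hu
    have : y - act u⁻¹ y = -act u⁻¹ (y - act u y) := by
      rw [map_sub, act_inv_act]; ring
    rw [this]
    exact neg_mem (act_mem_posIdeal (W.inv_mem hu) (hu' hu))

theorem sub_average_mem_posIdeal [Fintype W] (hgen : Subgroup.closure (reflections W) = W)
    {y : S n} (h : ∀ s : reflections W, y - act s y ∈ posIdeal W) :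
    y - average W y ∈ posIdeal W := by
  have h1 : y - average W y = C (Fintype.card W : ℂ)⁻¹ *
      ∑ w : W, (y - act (w : E n ≃ₗᵢ[ℝ] E n) y) := by
    rw [average_apply, Finset.sum_sub_distrib, Finset.sum_const, Finset.card_univ, mul_sub,
      ← smul_eq_C_mul, ← smul_eq_C_mul, ← Nat.cast_smul_eq_nsmul ℂ, smul_smul,
      inv_mul_cancel₀ card_ne_zero', one_smul]
  rw [h1]
  exact Ideal.mul_mem_left _ _
    (Ideal.sum_mem _ fun (w : W) _ => sub_act_mem_posIdeal hgen h w.2)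

theorem eq_C_of_totalDegree_eq_zero {q : S n} (hq : q.totalDegree = 0) :
    q = C (constantCoeff q) :=
  totalDegree_eq_zero_iff_eq_C.1 hq

theorem totalDegree_divDiff_le (s : reflections W) {q : S n} {k : ℕ}
    (hq : q.totalDegree ≤ k + 1) : (divDiff s q).totalDegree ≤ k := by
  rw [← sum_homogeneousComponent q, map_sum]
  refine totalDegree_finsetSum_le fun i hi => ?_
  rcases i with _ | i
  · rw [homogeneousComponent_zero, divDiff_C]; simp
  · refine (divDiff_isHomogeneous s (homogeneousComponent_isHomogeneous _ q)).totalDegree_le.trans ?_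
    rw [Finset.mem_range] at hi
    omega

/-- Chevalley's lemma, in a form which allows to replace the coefficients `r_j` of a syzygy by the
values of an arbitrary linear functional. -/
theorem sum_smul_mem_posIdeal [Fintype W] (hgen : Subgroup.closure (reflections W) = W)
    {ι : Type*} (t : Finset ι) (r : ι → S n) (hr : ∀ j ∈ t, r j ∈ invariants W)
    (L : S n →ₗ[ℂ] ℂ) (k : ℕ) (y : ι → S n) (hy : ∀ j ∈ t, (y j).totalDegree ≤ k)
    (hsum : ∑ j ∈ t, r j * y j = 0) (hk : (∑ j ∈ t, L (r j) • y j).IsHomogeneous k) :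
    ∑ j ∈ t, L (r j) • y j ∈ posIdeal W := by
  induction k generalizing y with
  | zero =>
    -- With constant `y j` the sum is the value of `L` at the syzygy itself, hence zero.
    have h1 : ∀ j ∈ t, y j = C (constantCoeff (y j)) := fun j hj =>
      eq_C_of_totalDegree_eq_zero (Nat.le_zero.1 (hy j hj))
    have h2 := congrArg L hsum
    rw [map_sum, map_zero] at h2
    have h3 : ∑ j ∈ t, L (r j) • y j = C (∑ j ∈ t, L (r j * y j)) := by
      rw [map_sum]
      refine Finset.sum_congr rfl fun j hj => ?_
      rw [h1 j hj, mul_comm (r j), ← smul_eq_C_mul, map_smul, smul_eq_C_mul, ← C_mul,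
        smul_eq_mul, mul_comm]
    rw [h3, h2, C_0]
    exact Ideal.zero_mem _
  | succ k ih =>
    set Y := ∑ j ∈ t, L (r j) • y j with hY
    -- A divided difference keeps the `r j` and lowers the degrees of the `y j`, so the induction
    -- hypothesis applies. Modulo the ideal `Y` is then `W`-invariant, hence equal to its average,
    -- which is an invariant of positive degree.
    have h1 : ∀ s : reflections W, Y - act s Y ∈ posIdeal W := by
      intro s
      rw [← root_mul_divDiff]
      refine Ideal.mul_mem_left _ _ ?_
      have h2 : divDiff s Y = ∑ j ∈ t, L (r j) • divDiff s (y j) := by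
        rw [hY, map_sum]
        exact Finset.sum_congr rfl fun j _ => map_smul _ _ _
      rw [h2]
      refine ih _ (fun j hj => totalDegree_divDiff_le s (hy j hj)) ?_ ?_
      · have h3 := congrArg (divDiff s) hsum
        rw [map_sum, map_zero] at h3
        rw [← h3]
        exact Finset.sum_congr rfl fun j hj => (divDiff_invariant_mul s (hr j hj) _).symm
      · rw [← h2]; exact divDiff_isHomogeneous s hk
    have h2 := sub_average_mem_posIdeal hgen h1
    have h3 : average W Y ∈ posIdeal W :=
      mem_posIdeal (average_mem Y) (Nat.succ_pos k) (average_isHomogeneous hk)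
    simpa using Ideal.add_mem _ h2 h3

end PosIdeal

end CherednikQH

end

noncomputable section

namespace CherednikQH

open MvPolynomial

/-! ### Minimal generators of the ideal of positive degree invariants -/

section MinimalGenerators

variable {n : ℕ} {W : Subgroup (E n ≃ₗᵢ[ℝ] E n)}

theorem homogeneousComponent_mul_of_isHomogeneous {f : S n} {d : ℕ} (hf : f.IsHomogeneous d)
    (a : S n) (k : ℕ) : homogeneousComponent k (a * f) =
      if d ≤ k then homogeneousComponent (k - d) a * f else 0 := by
  conv_lhs => rw [← sum_homogeneousComponent a, Finset.sum_mul, map_sum]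
  have h : ∀ i, homogeneousComponent k (homogeneousComponent i a * f) =
      if k = i + d then homogeneousComponent i a * f else 0 := fun i =>
    homogeneousComponent_of_mem ((homogeneousComponent_isHomogeneous i a).mul hf)
  simp only [h]
  split_ifs with hd
  · have h2 : ∀ i, k = i + d ↔ k - d = i := fun i => by omega
    simp only [h2, Finset.sum_ite_eq, Finset.mem_range]
    split_ifs with h3
    · rfl
    · rw [homogeneousComponent_eq_zero _ _ (by omega), zero_mul]
  · exact Finset.sum_eq_zero fun i _ => if_neg (by omega)

theorem aeval_derivation {ι : Type*} [Fintype ι] (f : ι → S n) (D : Derivation ℂ (S n) (S n))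
    (P : MvPolynomial ι ℂ) :
    D (aeval f P) = ∑ i, aeval f (pderiv i P) * D (f i) := by
  classical
  induction P using MvPolynomial.induction_on with
  | C a => simp [algebraMap_eq]
  | add p q hp hq => simp only [map_add, hp, hq, add_mul, Finset.sum_add_distrib]
  | mul_X p i hp =>
    have h : ∀ j, aeval f (pderiv j (p * X i)) * D (f j) =
        aeval f (pderiv j p) * D (f j) * f i
          + if j = i then aeval f p * D (f j) else 0 := by
      intro j
      rw [Derivation.leibniz, smul_eq_mul, smul_eq_mul, map_add, map_mul, map_mul, aeval_X]
      split_ifs with hj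
      · subst hj; rw [pderiv_X_self, map_one]; ring
      · rw [pderiv_X_of_ne (Ne.symm hj), map_zero]; ring
    simp only [h, Finset.sum_add_distrib, Finset.sum_ite_eq', Finset.mem_univ, if_true]
    rw [← Finset.sum_mul, ← hp, map_mul, aeval_X, Derivation.leibniz, smul_eq_mul, smul_eq_mul]
    ring

/-- A minimal family of homogeneous invariants generating the ideal `posIdeal W`. -/
structure IsMinimalGenerators (W : Subgroup (E n ≃ₗᵢ[ℝ] E n)) {ι : Type*} (d : ι → ℕ)
    (f : ι → S n) : Prop where
  mem : ∀ i, f i ∈ invariants W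
  pos : ∀ i, 0 < d i
  homogeneous : ∀ i, (f i).IsHomogeneous (d i)
  span_range : Ideal.span (Set.range f) = posIdeal W
  notMem : ∀ i, f i ∉ Ideal.span (f '' {i}ᶜ)

/-- The ideal is finitely generated, and by homogeneous invariants; a generating family of least
cardinality has no redundant member. -/
theorem exists_isMinimalGenerators (W : Subgroup (E n ≃ₗᵢ[ℝ] E n)) :
    ∃ (m : ℕ) (d : Fin m → ℕ) (f : Fin m → S n), IsMinimalGenerators W d f := by
  classical
  have hex : ∃ m, ∃ f : Fin m → S n, (∀ i, f i ∈ posInvariants W) ∧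
      Ideal.span (Set.range f) = posIdeal W := by
    obtain ⟨t, ht, hspan⟩ := (Submodule.fg_span_iff_fg_span_finset_subset (R := S n)
      (posInvariants W)).1 ((isNoetherianRing_iff_ideal_fg _).1 inferInstance _)
    refine ⟨t.card, fun i => t.equivFin.symm i, fun i => ht (t.equivFin.symm i).2, ?_⟩
    have : Set.range (fun i => (t.equivFin.symm i : S n)) = t := by
      ext x
      constructor
      · rintro ⟨i, rfl⟩; exact (t.equivFin.symm i).2
      · intro hx; exact ⟨t.equivFin ⟨x, hx⟩, by simp⟩
    rw [this]
    exact hspan.symm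
  obtain ⟨f, hf, hspan⟩ := Nat.find_spec hex
  choose d hd hfd using fun i => (hf i).2
  refine ⟨Nat.find hex, d, f, fun i => (hf i).1, hd, hfd, hspan, fun i hi => ?_⟩
  obtain ⟨k, hk⟩ : ∃ k, Nat.find hex = k + 1 :=
    Nat.exists_eq_succ_of_ne_zero (by rintro h; exact (Fin.cast h i).elim0)
  have hmin := Nat.find_min hex (m := k) (by omega)
  revert f d i
  rw [hk]
  intro f hf hspan d hd hfd i hi
  refine hmin ⟨f ∘ i.succAbove, fun j => hf _, ?_⟩
  rw [← hspan, Set.range_comp, Fin.range_succAbove]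
  refine le_antisymm (Ideal.span_mono (Set.image_subset_range _ _)) (Ideal.span_le.2 ?_)
  rintro _ ⟨j, rfl⟩
  by_cases hj : j = i
  · rw [hj]; exact hi
  · exact Ideal.subset_span ⟨j, hj, rfl⟩

variable {ι : Type*} [Fintype ι] {d : ι → ℕ} {f : ι → S n}

/-- Hilbert's argument: averaging makes the coefficients of the ideal representation invariant, and
their relevant components have smaller degree. -/
theorem IsMinimalGenerators.homogeneous_mem_adjoin [Fintype W] (hf : IsMinimalGenerators W d f)
    (k : ℕ) (p : S n) (hp : p ∈ invariants W) (hpk : p.IsHomogeneous k) :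
    p ∈ Algebra.adjoin ℂ (Set.range f) := by
  induction k using Nat.strong_induction_on generalizing p with
  | _ k ih =>
    rcases Nat.eq_zero_or_pos k with rfl | hk
    · rw [eq_C_of_totalDegree_eq_zero (Nat.le_zero.1 hpk.totalDegree_le)]
      exact Subalgebra.algebraMap_mem _ _
    · have h1 := mem_posIdeal hp hk hpk
      rw [← hf.span_range, Ideal.mem_span_range_iff_exists_fun] at h1
      obtain ⟨a, ha⟩ := h1
      have h2 : p = ∑ i, average W (a i) * f i := by
        rw [← average_of_mem hp, ← ha, map_sum]
        refine Finset.sum_congr rfl fun i _ => ?_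
        rw [mul_comm, average_mul (hf.mem i), mul_comm]
      have h3 : homogeneousComponent k p = p := by rw [homogeneousComponent_of_mem hpk, if_pos rfl]
      rw [← h3, h2, map_sum]
      refine Subalgebra.sum_mem _ fun i _ => ?_
      rw [homogeneousComponent_mul_of_isHomogeneous (hf.homogeneous i)]
      split_ifs with hdk
      · refine Subalgebra.mul_mem _ (ih _ ?_ _ ?_ (homogeneousComponent_isHomogeneous _ _))
          (Algebra.subset_adjoin ⟨i, rfl⟩)
        · have := hf.pos i; omega
        · exact homogeneousComponent_mem_invariants (average_mem _) _
      · exact Subalgebra.zero_mem _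

theorem IsMinimalGenerators.adjoin_eq [Fintype W] (hf : IsMinimalGenerators W d f) :
    Algebra.adjoin ℂ (Set.range f) = invariants W := by
  refine le_antisymm (Algebra.adjoin_le ?_) fun p hp => ?_
  · rintro _ ⟨i, rfl⟩; exact hf.mem i
  · rw [← sum_homogeneousComponent p]
    exact Subalgebra.sum_mem _ fun k _ => hf.homogeneous_mem_adjoin k _
      (homogeneousComponent_mem_invariants hp k) (homogeneousComponent_isHomogeneous k p)

/-- A homogeneous relation between the differentials of minimal generators with invariant
coefficients is trivial. -/
theorem IsMinimalGenerators.eq_zero_of_sum_mul_pderiv_aux [Fintype W]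
    (hgen : Subgroup.closure (reflections W) = W)
    (hf : IsMinimalGenerators W d f) (r : ι → S n) (hr : ∀ i, r i ∈ invariants W) (D : ℕ)
    (hrd : ∀ i, r i ≠ 0 → d i ≤ D ∧ (r i).IsHomogeneous (D - d i))
    (hsum : ∀ k, ∑ i, r i * pderiv k (f i) = 0) (i : ι) : r i = 0 := by
  classical
  by_contra hi
  -- Maximality of `d i₀` bounds the degrees of all differentials in the syzygy, as Chevalley's
  -- lemma requires. The functional used is the coefficient at a monomial `m` of `r i₀`; by
  -- homogeneity it is nonzero only on those `r i` with `d i = d i₀`.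
  obtain ⟨i₀, hi₀, hmax⟩ := Finset.exists_max_image (Finset.univ.filter fun i => r i ≠ 0) d
    ⟨i, by simpa using hi⟩
  rw [Finset.mem_filter] at hi₀
  obtain ⟨m, hm⟩ := ne_zero_iff.1 hi₀.2
  set t := Finset.univ.filter fun i => r i ≠ 0 with ht
  have hL : ∀ i ∈ t, lcoeff ℂ m (r i) ≠ 0 → d i = d i₀ := by
    intro i hit hne
    have h1 := hrd i (Finset.mem_filter.1 hit).2
    have h2 := hrd i₀ hi₀.2
    have h3 : m.degree = D - d i := by
      by_contra h; exact hne (h1.2.coeff_eq_zero h)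
    have h4 : m.degree = D - d i₀ := by
      by_contra h; exact hm (h2.2.coeff_eq_zero h)
    omega
  have hY : ∀ k, ∑ i ∈ t, lcoeff ℂ m (r i) • pderiv k (f i) ∈ posIdeal W := by
    intro k
    refine sum_smul_mem_posIdeal hgen t r (fun i _ => hr i) _ (d i₀ - 1) _ (fun i hi => ?_) ?_ ?_
    · exact ((hf.homogeneous i).pderiv.totalDegree_le).trans
        (Nat.sub_le_sub_right (hmax i hi) 1)
    · rw [← hsum k]
      refine Finset.sum_subset (Finset.subset_univ _) fun i _ hi => ?_
      have : r i = 0 := by simpa [ht] using hi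
      rw [this, zero_mul]
    · refine IsHomogeneous.sum _ _ _ fun i hi => ?_
      by_cases h0 : lcoeff ℂ m (r i) = 0
      · rw [h0, zero_smul]; exact isHomogeneous_zero _ _ _
      · rw [smul_eq_C_mul, ← hL i hi h0]
        exact (hf.homogeneous i).pderiv.C_mul _
  choose a ha using fun k => Ideal.mem_span_range_iff_exists_fun.1 (hf.span_range ▸ hY k)
  -- Multiplying by the coordinates and summing turns the differentials back into the generators, by
  -- Euler's identity. The new coefficients on the right have no constant term.
  have hZ : ∑ i ∈ t, C (lcoeff ℂ m (r i) * d i₀) * f i = ∑ l, (∑ k, X k * a k l) * f l := by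
    have h1 : ∀ i ∈ t, C (lcoeff ℂ m (r i) * d i₀) * f i =
        ∑ k, X k * (lcoeff ℂ m (r i) • pderiv k (f i)) := by
      intro i hi
      by_cases h0 : lcoeff ℂ m (r i) = 0
      · rw [h0]; simp
      · have h2 := (hf.homogeneous i).sum_X_mul_pderiv
        simp only [mul_smul_comm]
        rw [← Finset.smul_sum, h2, hL i hi h0, C_mul, mul_assoc, smul_eq_C_mul, nsmul_eq_mul]
        simp
    rw [Finset.sum_congr rfl h1, Finset.sum_comm]
    simp only [← Finset.mul_sum, ← ha]
    simp only [Finset.mul_sum, Finset.sum_mul]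
    rw [Finset.sum_comm]
    simp only [mul_assoc]
  refine hf.notMem i₀ ?_
  set K := Ideal.span (f '' {i₀}ᶜ) with hK
  have hmemK : ∀ l, l ≠ i₀ → f l ∈ K := fun l hl => Ideal.subset_span ⟨l, hl, rfl⟩
  have hdiff : (C (lcoeff ℂ m (r i₀) * d i₀) - ∑ k, X k * a k i₀) * f i₀ ∈ K := by
    have hit : i₀ ∈ t := by rw [ht, Finset.mem_filter]; exact hi₀
    rw [← Finset.add_sum_erase _ _ hit, ← Finset.add_sum_erase _ _ (Finset.mem_univ i₀)] at hZ
    have h1 : (C (lcoeff ℂ m (r i₀) * d i₀) - ∑ k, X k * a k i₀) * f i₀ =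
        ∑ l ∈ Finset.univ.erase i₀, (∑ k, X k * a k l) * f l -
          ∑ i ∈ t.erase i₀, C (lcoeff ℂ m (r i) * d i₀) * f i := by
      linear_combination hZ
    rw [h1]
    exact Ideal.sub_mem _
      (Ideal.sum_mem _ fun l hl => Ideal.mul_mem_left _ _ (hmemK l (Finset.ne_of_mem_erase hl)))
      (Ideal.sum_mem _ fun l hl => Ideal.mul_mem_left _ _ (hmemK l (Finset.ne_of_mem_erase hl)))
  -- In degree `d i₀` only the constant term of the factor of `f i₀` remains, and it is nonzero. So
  -- `f i₀` lies in the ideal of the other generators, against minimality.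
  have h2 := homogeneousComponent_mem_span (T := f '' {i₀}ᶜ)
    (by rintro _ ⟨l, _, rfl⟩; exact ⟨_, hf.homogeneous l⟩) hdiff (d i₀)
  rw [homogeneousComponent_mul_of_isHomogeneous (hf.homogeneous i₀), if_pos le_rfl, Nat.sub_self,
    homogeneousComponent_zero] at h2
  have h3 : coeff 0 (C (lcoeff ℂ m (r i₀) * d i₀) - ∑ k, X k * a k i₀) =
      coeff m (r i₀) * d i₀ := by
    rw [← constantCoeff_eq]
    simp
  rw [h3] at h2
  have h4 : coeff m (r i₀) * d i₀ ≠ 0 :=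
    mul_ne_zero hm (Nat.cast_ne_zero.2 (hf.pos i₀).ne')
  have h5 := Ideal.mul_mem_left _ (C (coeff m (r i₀) * d i₀)⁻¹ : S n) h2
  rwa [← mul_assoc, ← C_mul, inv_mul_cancel₀ h4, C_1, one_mul] at h5

theorem IsMinimalGenerators.eq_zero_of_sum_mul_pderiv [Fintype W]
    (hgen : Subgroup.closure (reflections W) = W)
    (hf : IsMinimalGenerators W d f) (r : ι → S n) (hr : ∀ i, r i ∈ invariants W)
    (hsum : ∀ k, ∑ i, r i * pderiv k (f i) = 0) (i : ι) : r i = 0 := by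
  -- The relation is split by the degree `D` counted with the generators; the differentials have
  -- degree `d i - 1`, so the component to take is `D - 1`, and truncated subtraction requires `0 <
  -- D`.
  have key : ∀ D, 0 < D → ∀ i,
      (if d i ≤ D then homogeneousComponent (D - d i) (r i) else 0) = 0 := by
    intro D hD
    refine hf.eq_zero_of_sum_mul_pderiv_aux hgen _ (fun i => ?_) D (fun i hi => ?_) (fun k => ?_)
    · split_ifs
      · exact homogeneousComponent_mem_invariants (hr i) _
      · exact Subalgebra.zero_mem _
    · have hdi : d i ≤ D := by by_contra h; simp [h] at hi
      rw [if_pos hdi]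
      exact ⟨hdi, homogeneousComponent_isHomogeneous _ _⟩
    · have h1 := congrArg (homogeneousComponent (D - 1)) (hsum k)
      rw [map_sum, map_zero] at h1
      refine (Finset.sum_congr rfl fun i _ => ?_).trans h1
      have := hf.pos i
      rw [homogeneousComponent_mul_of_isHomogeneous (hf.homogeneous i).pderiv, ite_mul, zero_mul]
      refine if_congr (by omega) ?_ rfl
      rw [show D - 1 - (d i - 1) = D - d i by omega]
  rw [← sum_homogeneousComponent (r i)]
  refine Finset.sum_eq_zero fun k _ => ?_
  have := key (d i + k) (by have := hf.pos i; omega) i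
  rwa [if_pos (by omega), Nat.add_sub_cancel_left] at this

/-- The differential of a weighted homogeneous relation `P` is a relation between the differentials
of the generators with invariant coefficients. Hence all partial derivatives of `P` are relations,
of smaller weight, and vanish by induction. -/
theorem IsMinimalGenerators.algebraicIndependent [Fintype W]
    (hgen : Subgroup.closure (reflections W) = W)
    (hf : IsMinimalGenerators W d f) : AlgebraicIndependent ℂ f := by
  classical
  rw [algebraicIndependent_iff]
  have key : ∀ (D : ℕ) (P : MvPolynomial ι ℂ), P.IsWeightedHomogeneous d D →
      aeval f P = 0 → P = 0 := by
    intro D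
    induction D using Nat.strong_induction_on with
    | _ D ih =>
      intro P hP hP0
      have h1 : ∀ i, aeval f (pderiv i P) = 0 := by
        refine hf.eq_zero_of_sum_mul_pderiv hgen _ (fun i => ?_) fun k => ?_
        · rw [← hf.adjoin_eq, Algebra.adjoin_range_eq_range_aeval]; exact ⟨_, rfl⟩
        · rw [← aeval_derivation, hP0, map_zero]
      have h2 : ∀ i, pderiv i P = 0 := by
        intro i
        by_cases hi : d i ≤ D
        · refine ih (D - d i) (by have := hf.pos i; omega) _ (hP.pderiv (by omega)) (h1 i)
        · rw [P.as_sum, map_sum]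
          refine Finset.sum_eq_zero fun m hm => ?_
          have hmj : m i = 0 := by
            by_contra hne
            have h3 := hP (mem_support_iff.1 hm)
            have h4 := Finsupp.le_weight_of_ne_zero (w := d) (fun _ => Nat.zero_le _) hne
            omega
          rw [pderiv_monomial, hmj, Nat.cast_zero, mul_zero, monomial_zero]
      -- The weighted Euler identity now says `D • P = 0`; in weight zero `P` is a constant, and is
      -- zero as its value is.
      have h3 := hP.sum_weight_X_mul_pderiv
      simp only [h2, mul_zero, smul_zero, Finset.sum_const_zero] at h3
      rcases smul_eq_zero.1 h3.symm with h4 | h4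
      · subst h4
        have h5 : P = C (coeff 0 P) := by
          ext m
          rw [coeff_C]
          split_ifs with hm
          · rw [hm]
          · by_contra hne
            obtain ⟨i, hi⟩ := Finsupp.ne_iff.1 (Ne.symm hm)
            have h6 := Finsupp.le_weight_of_ne_zero (w := d) (fun _ => Nat.zero_le _) hi
            have := hP hne
            have := hf.pos i
            omega
        rw [h5, aeval_C, algebraMap_eq, C_eq_zero] at hP0
        rw [h5, hP0, C_0]
      · exact h4
  intro P hP
  have h1 : ∀ D, weightedHomogeneousComponent d D P = 0 := fun D =>
    key D _ (weightedHomogeneousComponent_isWeightedHomogeneous _ _) (by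
      rw [← homogeneousComponent_aeval hf.homogeneous, hP, map_zero])
  ext m
  have := congrArg (coeff m) (h1 (Finsupp.weight d m))
  rwa [coeff_weightedHomogeneousComponent, if_pos rfl] at this

end MinimalGenerators

end CherednikQH

end

noncomputable section

namespace CherednikQH

open MvPolynomial

/-! ### The coinvariant algebra and the degrees -/

section Hilbert

variable {n : ℕ} {W : Subgroup (E n ≃ₗᵢ[ℝ] E n)}

/-- Chevalley's lemma replaces the invariant coefficients by numbers, one of them nonzero, and so
turns the relation into a linear relation in the coinvariant algebra. -/
theorem eq_zero_of_sum_mul_of_linearIndependent_aux [Fintype W]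
    (hgen : Subgroup.closure (reflections W) = W) {β : Type*} {b : β → S n} {δ : β → ℕ}
    (hδ : ∀ j, (b j).IsHomogeneous (δ j))
    (hb : LinearIndependent ℂ fun j => Ideal.Quotient.mk (posIdeal W) (b j))
    (t : Finset β) (r : β → S n) (hr : ∀ j, r j ∈ invariants W) (D : ℕ)
    (hrd : ∀ j, r j ≠ 0 → δ j ≤ D ∧ (r j).IsHomogeneous (D - δ j))
    (hsum : ∑ j ∈ t, r j * b j = 0) (j : β) (hj : j ∈ t) : r j = 0 := by
  classical
  by_contra hjr
  obtain ⟨i₀, hi₀, hmax⟩ := Finset.exists_max_image (t.filter fun i => r i ≠ 0) δ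
    ⟨j, by simpa using ⟨hj, hjr⟩⟩
  have hri₀ := (Finset.mem_filter.1 hi₀).2
  obtain ⟨m, hm⟩ := ne_zero_iff.1 hri₀
  set t' := t.filter fun i => r i ≠ 0 with ht
  have hY : ∑ i ∈ t', lcoeff ℂ m (r i) • b i ∈ posIdeal W := by
    refine sum_smul_mem_posIdeal hgen t' r (fun i _ => hr i) _ (δ i₀) _ (fun i hi => ?_) ?_ ?_
    · exact (hδ i).totalDegree_le.trans (hmax i hi)
    · rw [← hsum]
      refine Finset.sum_subset (Finset.filter_subset _ _) fun i hit hi => ?_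
      have : r i = 0 := by simpa [ht, hit] using hi
      rw [this, zero_mul]
    · refine IsHomogeneous.sum _ _ _ fun i hi => ?_
      by_cases h0 : lcoeff ℂ m (r i) = 0
      · rw [h0, zero_smul]; exact isHomogeneous_zero _ _ _
      · have h1 := hrd i (Finset.mem_filter.1 hi).2
        have h2 := hrd i₀ hri₀
        have h3 : m.degree = D - δ i := by
          by_contra h; exact h0 (h1.2.coeff_eq_zero h)
        have h4 : m.degree = D - δ i₀ := by
          by_contra h; exact hm (h2.2.coeff_eq_zero h)
        rw [smul_eq_C_mul, show δ i₀ = δ i by omega]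
        exact (hδ i).C_mul _
  rw [← Ideal.Quotient.eq_zero_iff_mem, map_sum] at hY
  refine hm (linearIndependent_iff'.1 hb t' (fun i => lcoeff ℂ m (r i)) ?_ i₀ hi₀)
  exact hY

theorem eq_zero_of_sum_mul_of_linearIndependent [Fintype W]
    (hgen : Subgroup.closure (reflections W) = W) {β : Type*} {b : β → S n} {δ : β → ℕ}
    (hδ : ∀ j, (b j).IsHomogeneous (δ j))
    (hb : LinearIndependent ℂ fun j => Ideal.Quotient.mk (posIdeal W) (b j))
    (t : Finset β) (r : β → S n) (hr : ∀ j, r j ∈ invariants W)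
    (hsum : ∑ j ∈ t, r j * b j = 0) (j : β) (hj : j ∈ t) : r j = 0 := by
  have key : ∀ D, ∀ j ∈ t,
      (if δ j ≤ D then homogeneousComponent (D - δ j) (r j) else 0) = 0 := by
    intro D
    refine eq_zero_of_sum_mul_of_linearIndependent_aux hgen hδ hb t _ (fun i => ?_) D
      (fun i hi => ?_) ?_
    · split_ifs
      · exact homogeneousComponent_mem_invariants (hr i) _
      · exact Subalgebra.zero_mem _
    · have hdi : δ i ≤ D := by by_contra h; simp [h] at hi
      rw [if_pos hdi]
      exact ⟨hdi, homogeneousComponent_isHomogeneous _ _⟩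
    · have h1 := congrArg (homogeneousComponent D) hsum
      rw [map_sum, map_zero] at h1
      refine (Finset.sum_congr rfl fun i _ => ?_).trans h1
      rw [homogeneousComponent_mul_of_isHomogeneous (hδ i), ite_mul, zero_mul]
  rw [← sum_homogeneousComponent (r j)]
  refine Finset.sum_eq_zero fun k _ => ?_
  have := key (δ j + k) j hj
  rwa [if_pos (by omega), Nat.add_sub_cancel_left] at this

theorem exists_homogeneous_basis_quotient (W : Subgroup (E n ≃ₗᵢ[ℝ] E n)) :
    ∃ (β : Type) (b : β → S n) (δ : β → ℕ), (∀ j, (b j).IsHomogeneous (δ j)) ∧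
      (LinearIndependent ℂ fun j => Ideal.Quotient.mk (posIdeal W) (b j)) ∧
      ∀ q : S n, ∃ y ∈ Submodule.span ℂ (Set.range b), q - y ∈ posIdeal W := by
  obtain ⟨B, hB, hspan, hli⟩ := exists_linearIndependent ℂ
    (Ideal.Quotient.mk (posIdeal W) '' {q : S n | ∃ k, q.IsHomogeneous k})
  choose b hb using fun j : B => hB j.2
  choose δ hδ using fun j => (hb j).1
  refine ⟨B, b, δ, hδ, ?_, fun q => ?_⟩
  · have : (fun j => Ideal.Quotient.mk (posIdeal W) (b j)) = ((↑) : B → _) := by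
      funext j; exact (hb j).2
    rwa [this]
  · have h1 : Ideal.Quotient.mk (posIdeal W) q ∈ Submodule.span ℂ B := by
      rw [hspan, ← sum_homogeneousComponent q, map_sum]
      exact Submodule.sum_mem _ fun k _ => Submodule.subset_span
        ⟨_, ⟨k, homogeneousComponent_isHomogeneous k q⟩, rfl⟩
    have h2 : B = (Ideal.Quotient.mkₐ ℂ (posIdeal W)).toLinearMap '' Set.range b := by
      rw [← Set.range_comp]
      ext x
      constructor
      · intro hx; exact ⟨⟨x, hx⟩, (hb ⟨x, hx⟩).2⟩
      · rintro ⟨j, rfl⟩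
        exact Set.mem_of_eq_of_mem (hb j).2 j.2
    rw [h2, Submodule.span_image] at h1
    obtain ⟨y, hy, hyq⟩ := h1
    refine ⟨y, hy, ?_⟩
    rw [← Ideal.Quotient.eq_zero_iff_mem, map_sub, sub_eq_zero]
    exact hyq.symm

variable {ι : Type*} [Fintype ι] {d : ι → ℕ} {f : ι → S n} {β : Type*} {b : β → S n} {δ : β → ℕ}

/-- With `span_monomial_mul` this says that `S(V)` is free over the invariants on a lift of a basis
of the coinvariant algebra, phrased as a homogeneous `ℂ`-basis in order to count degrees. -/
theorem linearIndependent_monomial_mul [Fintype W]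
    (hgen : Subgroup.closure (reflections W) = W) (hf : IsMinimalGenerators W d f)
    (hδ : ∀ j, (b j).IsHomogeneous (δ j))
    (hb : LinearIndependent ℂ fun j => Ideal.Quotient.mk (posIdeal W) (b j)) :
    LinearIndependent ℂ fun x : (ι →₀ ℕ) × β => aeval f (monomial x.1 (1 : ℂ)) * b x.2 := by
  classical
  rw [linearIndependent_iff']
  intro s g hg x hx
  let r : β → MvPolynomial ι ℂ := fun j => ∑ y ∈ s with y.2 = j, monomial y.1 (g y)
  have h1 : ∑ j ∈ s.image Prod.snd, aeval f (r j) * b j = 0 := by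
    rw [← hg, ← Finset.sum_fiberwise_of_maps_to (g := Prod.snd) (t := s.image Prod.snd)
      fun y hy => Finset.mem_image_of_mem _ hy]
    refine Finset.sum_congr rfl fun j _ => ?_
    simp only [r]
    rw [map_sum, Finset.sum_mul]
    refine Finset.sum_congr rfl fun y hy => ?_
    rw [← (Finset.mem_filter.1 hy).2, ← smul_mul_assoc, ← map_smul, smul_monomial, smul_eq_mul,
      mul_one]
  have h2 := eq_zero_of_sum_mul_of_linearIndependent hgen hδ hb _ (fun j => aeval f (r j))
    (fun j => by rw [← hf.adjoin_eq, Algebra.adjoin_range_eq_range_aeval]; exact ⟨_, rfl⟩) h1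
    x.2 (Finset.mem_image_of_mem _ hx)
  have h3 : r x.2 = 0 := (hf.algebraicIndependent hgen) (by rw [h2, map_zero])
  have h4 := congrArg (coeff x.1) h3
  simp only [r] at h4
  rw [coeff_sum, coeff_zero, Finset.sum_eq_single x] at h4
  · rwa [coeff_monomial, if_pos rfl] at h4
  · intro y hy hne
    rw [coeff_monomial, if_neg]
    intro h
    exact hne (Prod.ext h (Finset.mem_filter.1 hy).2)
  · intro h
    exact (h (by simpa using hx)).elim

theorem homogeneousComponent_mem_span_of_mem_span (hδ : ∀ j, (b j).IsHomogeneous (δ j)) {q : S n}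
    (hq : q ∈ Submodule.span ℂ (Set.range b)) (k : ℕ) :
    homogeneousComponent k q ∈ Submodule.span ℂ (b '' {j | δ j = k}) := by
  refine Submodule.span_induction (p := fun q _ => homogeneousComponent k q ∈
    Submodule.span ℂ (b '' {j | δ j = k})) ?_ ?_ ?_ ?_ hq
  · rintro _ ⟨j, rfl⟩
    rw [homogeneousComponent_of_mem (hδ j)]
    split_ifs with h
    · exact Submodule.subset_span ⟨j, h.symm, rfl⟩
    · exact Submodule.zero_mem _
  · rw [map_zero]; exact Submodule.zero_mem _
  · intro x y _ _ hx hy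
    rw [map_add]; exact Submodule.add_mem _ hx hy
  · intro a x _ hx
    rw [map_smul]; exact Submodule.smul_mem _ _ hx

/-- Graded Nakayama: modulo the span of the lifts everything is a combination of the `f i`, whose
coefficients have smaller degree. -/
theorem span_monomial_mul (hf : IsMinimalGenerators W d f)
    (hδ : ∀ j, (b j).IsHomogeneous (δ j))
    (hb : ∀ q : S n, ∃ y ∈ Submodule.span ℂ (Set.range b), q - y ∈ posIdeal W) :
    Submodule.span ℂ (Set.range fun x : (ι →₀ ℕ) × β =>
      aeval f (monomial x.1 (1 : ℂ)) * b x.2) = ⊤ := by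
  set M := Submodule.span ℂ (Set.range fun x : (ι →₀ ℕ) × β =>
      aeval f (monomial x.1 (1 : ℂ)) * b x.2) with hM
  have hbM : Submodule.span ℂ (Set.range b) ≤ M := by
    refine Submodule.span_le.2 ?_
    rintro _ ⟨j, rfl⟩
    refine Submodule.subset_span ⟨(0, j), ?_⟩
    have : (monomial 0 1 : MvPolynomial ι ℂ) = 1 := rfl
    simp only [this]
    rw [map_one, one_mul]
  have hmul : ∀ i, ∀ q ∈ M, q * f i ∈ M := by
    intro i q hq
    refine Submodule.span_induction (p := fun q _ => q * f i ∈ M) ?_ ?_ ?_ ?_ hq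
    · rintro _ ⟨⟨a, j⟩, rfl⟩
      refine Submodule.subset_span ⟨(a + Finsupp.single i 1, j), ?_⟩
      have : (monomial (a + Finsupp.single i 1) 1 : MvPolynomial ι ℂ) = monomial a 1 * X i := by
        rw [X, monomial_mul, one_mul]
      simp only [this]
      rw [map_mul, aeval_X]
      ring
    · rw [zero_mul]; exact Submodule.zero_mem _
    · intro x y _ _ hx hy
      rw [add_mul]; exact Submodule.add_mem _ hx hy
    · intro a x _ hx
      rw [smul_mul_assoc]; exact Submodule.smul_mem _ _ hx
  have key : ∀ (k : ℕ) (q : S n), q.IsHomogeneous k → q ∈ M := by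
    intro k
    induction k using Nat.strong_induction_on with
    | _ k ih =>
      intro q hq
      obtain ⟨y, hy, hqy⟩ := hb q
      rw [← hf.span_range, Ideal.mem_span_range_iff_exists_fun] at hqy
      obtain ⟨a, ha⟩ := hqy
      have h1 : q = homogeneousComponent k y + ∑ i, homogeneousComponent k (a i * f i) := by
        rw [← map_sum, ha, ← map_add, add_sub_cancel, homogeneousComponent_of_mem hq, if_pos rfl]
      rw [h1]
      refine Submodule.add_mem _ ?_ (Submodule.sum_mem _ fun i _ => ?_)
      · exact hbM (Submodule.span_mono (Set.image_subset_range _ _)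
          (homogeneousComponent_mem_span_of_mem_span hδ hy k))
      · rw [homogeneousComponent_mul_of_isHomogeneous (hf.homogeneous i)]
        split_ifs with hdk
        · refine hmul i _ (ih _ ?_ _ (homogeneousComponent_isHomogeneous _ _))
          have := hf.pos i
          omega
        · exact Submodule.zero_mem _
  rw [eq_top_iff]
  intro q _
  rw [← sum_homogeneousComponent q]
  exact Submodule.sum_mem _ fun k _ => key k _ (homogeneousComponent_isHomogeneous k q)

theorem nonempty_basis_homogeneousSubmodule (hδ : ∀ j, (b j).IsHomogeneous (δ j))
    (hli : LinearIndependent ℂ b) (hspan : Submodule.span ℂ (Set.range b) = ⊤) (k : ℕ) :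
    Nonempty (Module.Basis {j // δ j = k} ℂ (homogeneousSubmodule (Fin n) ℂ k)) := by
  let v : {j // δ j = k} → homogeneousSubmodule (Fin n) ℂ k := fun j =>
    ⟨b j, (mem_homogeneousSubmodule _ _).2 (by have := hδ j; rwa [j.2] at this)⟩
  refine ⟨Module.Basis.mk (v := v) ?_ ?_⟩
  · refine LinearIndependent.of_comp (Submodule.subtype _) ?_
    exact hli.comp _ Subtype.val_injective
  · intro q _
    have h1 : (q : S n) ∈ Submodule.span ℂ (b '' {j | δ j = k}) := by
      have := homogeneousComponent_mem_span_of_mem_span hδ (q := q) (hspan ▸ Submodule.mem_top) k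
      rwa [homogeneousComponent_of_mem q.2, if_pos rfl] at this
    have h2 : b '' {j | δ j = k} = Submodule.subtype _ '' Set.range v := by
      rw [← Set.range_comp]
      ext x
      constructor
      · rintro ⟨j, hj, rfl⟩; exact ⟨⟨j, hj⟩, rfl⟩
      · rintro ⟨j, rfl⟩; exact ⟨j, j.2, rfl⟩
    rw [h2, Submodule.span_image] at h1
    obtain ⟨y, hy, hyq⟩ := h1
    rwa [Subtype.val_injective hyq] at hy

/-- Two homogeneous bases of `S(V)` have the same generating function. -/
theorem tsum_degree_eq {κ : Type*} {v : κ → S n} {ε : κ → ℕ}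
    (hδ : ∀ j, (b j).IsHomogeneous (δ j))
    (hb : LinearIndependent ℂ b) (hbs : Submodule.span ℂ (Set.range b) = ⊤)
    (hε : ∀ j, (v j).IsHomogeneous (ε j))
    (hv : LinearIndependent ℂ v) (hvs : Submodule.span ℂ (Set.range v) = ⊤) (g : ℕ → ENNReal) :
    ∑' j, g (δ j) = ∑' j, g (ε j) := by
  have e : ∀ k, {j // δ j = k} ≃ {j // ε j = k} := fun k =>
    (nonempty_basis_homogeneousSubmodule hδ hb hbs k).some.indexEquiv
      (nonempty_basis_homogeneousSubmodule hε hv hvs k).some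
  let eq : β ≃ κ := (Equiv.sigmaFiberEquiv δ).symm.trans
    ((Equiv.sigmaCongrRight e).trans (Equiv.sigmaFiberEquiv ε))
  rw [← eq.tsum_eq (fun j => g (ε j))]
  refine tsum_congr fun j => ?_
  congr 1
  exact ((e (δ j)) ⟨j, rfl⟩).2.symm

/-- In the extended nonnegative reals the product of geometric series may be expanded without
convergence conditions. -/
theorem tsum_pow_sum_mul {m : ℕ} (d : Fin m → ℕ) (t : ENNReal) :
    ∑' a : Fin m → ℕ, t ^ (∑ i, a i * d i) = ∏ i, (1 - t ^ d i)⁻¹ := by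
  induction m with
  | zero =>
    rw [Fin.prod_univ_zero, tsum_eq_single (fun i => i.elim0) fun a ha =>
      absurd (Subsingleton.elim _ _) ha]
    simp
  | succ m ih =>
    rw [Fin.prod_univ_succ, ← ih, ← (Fin.consEquiv fun _ => ℕ).tsum_eq, ENNReal.tsum_prod',
      ← ENNReal.tsum_geometric, ← ENNReal.tsum_mul_right]
    refine tsum_congr fun k => ?_
    rw [← ENNReal.tsum_mul_left]
    refine tsum_congr fun a => ?_
    rw [Fin.sum_univ_succ, pow_add, ← pow_mul, mul_comm (d 0)]
    simp [Fin.consEquiv]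

theorem tsum_pow_weight {m : ℕ} (d : Fin m → ℕ) (t : ENNReal) :
    ∑' a : Fin m →₀ ℕ, t ^ (Finsupp.weight d a) = ∏ i, (1 - t ^ d i)⁻¹ := by
  rw [← tsum_pow_sum_mul,
    ← Equiv.tsum_eq (Finsupp.equivFunOnFinite : (Fin m →₀ ℕ) ≃ (Fin m → ℕ))]
  refine tsum_congr fun a => ?_
  rw [Finsupp.weight_apply, Finsupp.sum_fintype _ _ (by simp)]
  simp [Finsupp.equivFunOnFinite]

end Hilbert

end CherednikQH

end

noncomputable section

namespace CherednikQH

open MvPolynomial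

/-! ### Number and sum of the degrees from Hilbert series -/

section Degrees

variable {n : ℕ} {W : Subgroup (E n ≃ₗᵢ[ℝ] E n)}

theorem finite_of_linearIndependent_quotient {I : Ideal (S n)} {N : ℕ}
    (hN : ∀ (q : S n) (k : ℕ), N < k → q.IsHomogeneous k → q ∈ I) {β : Type*} {b : β → S n}
    (hb : LinearIndependent ℂ fun j => Ideal.Quotient.mk I (b j)) : Finite β := by
  have hfin : Module.Finite ℂ (S n ⧸ I) := by
    rw [Module.finite_def, Submodule.fg_def]
    refine ⟨(fun m : Fin n →₀ ℕ => Ideal.Quotient.mk I (monomial m 1)) '' {m | m.degree ≤ N},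
      (Finsupp.finite_of_degree_le N).image _, ?_⟩
    rw [eq_top_iff]
    intro x _
    obtain ⟨q, rfl⟩ := Ideal.Quotient.mk_surjective x
    rw [q.as_sum, map_sum]
    refine Submodule.sum_mem _ fun m _ => ?_
    have : (monomial m (coeff m q) : S n) = coeff m q • monomial m 1 := by
      rw [smul_monomial, smul_eq_mul, mul_one]
    rw [this]
    refine Submodule.smul_mem _ (coeff m q) (x := Ideal.Quotient.mk I (monomial m 1)) ?_
    rcases le_or_gt m.degree N with h | h
    · exact Submodule.subset_span ⟨m, h, rfl⟩
    · rw [Ideal.Quotient.eq_zero_iff_mem.2 (hN _ _ h (isHomogeneous_monomial _ rfl))]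
      exact Submodule.zero_mem _
  exact hb.finite

theorem monomial_basis_span : Submodule.span ℂ (Set.range fun m : Fin n →₀ ℕ =>
    (monomial m 1 : S n)) = ⊤ := by
  rw [eq_top_iff]
  intro q _
  rw [q.as_sum]
  refine Submodule.sum_mem _ fun m _ => ?_
  have : (monomial m (coeff m q) : S n) = coeff m q • monomial m 1 := by
    rw [smul_monomial, smul_eq_mul, mul_one]
  rw [this]
  exact Submodule.smul_mem _ _ (Submodule.subset_span ⟨m, rfl⟩)

theorem monomial_linearIndependent : LinearIndependent ℂ fun m : Fin n →₀ ℕ =>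
    (monomial m 1 : S n) := (basisMonomials (Fin n) ℂ).linearIndependent

theorem toReal_one_sub_pow (t : NNReal) (ht : t < 1) (d : ℕ) :
    (1 - (t : ENNReal) ^ d).toReal = 1 - (t : ℝ) ^ d := by
  rw [ENNReal.toReal_sub_of_le _ ENNReal.one_ne_top, ENNReal.toReal_pow]
  · simp
  · exact pow_le_one₀ (zero_le) (by exact_mod_cast ht.le)

/-- A comparison of generating functions as an identity of polynomials. -/
theorem polynomial_identity {m : ℕ} {d : Fin m → ℕ} (hd : ∀ i, 0 < d i) {β : Type*} [Fintype β]
    {δ : β → ℕ}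
    (h : ∀ t : ENNReal, (∏ i, (1 - t ^ d i)⁻¹) * ∑ j, t ^ δ j = ∏ _i : Fin n, (1 - t ^ 1)⁻¹) :
    (∑ j, (Polynomial.X : Polynomial ℝ) ^ δ j) * (1 - Polynomial.X) ^ n =
      ∏ i, (1 - (Polynomial.X : Polynomial ℝ) ^ d i) := by
  -- On the open unit interval all the factors are finite and nonzero, so the identity of series may
  -- be cleared of denominators there.
  refine Polynomial.eq_of_infinite_eval_eq _ _ (Set.Infinite.mono (s := Set.Ioo (0 : ℝ) 1) ?_
    (Set.Ioo_infinite one_pos))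
  intro t ht
  lift t to NNReal using ht.1.le
  have h1 := congrArg ENNReal.toReal (h t)
  have h2 : t < 1 := by exact_mod_cast ht.2
  rw [ENNReal.toReal_mul, ENNReal.toReal_prod, ENNReal.toReal_prod, ENNReal.toReal_sum
    fun j _ => ENNReal.pow_ne_top ENNReal.coe_ne_top] at h1
  simp only [ENNReal.toReal_inv, toReal_one_sub_pow _ h2, ENNReal.toReal_pow,
    ENNReal.coe_toReal, Finset.prod_const, Finset.card_univ, Fintype.card_fin] at h1
  rw [pow_one] at h1
  have h3 : ∏ i, (1 - (t : ℝ) ^ d i) ≠ 0 := Finset.prod_ne_zero_iff.2 fun i _ =>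
    (sub_pos.2 (pow_lt_one₀ t.2 ht.2 (hd i).ne')).ne'
  have h4 : (1 - (t : ℝ)) ^ n ≠ 0 := pow_ne_zero _ (sub_pos.2 ht.2).ne'
  simp only [Set.mem_ofPred_eq, Polynomial.eval_mul, Polynomial.eval_finsetSum,
    Polynomial.eval_pow, Polynomial.eval_X, Polynomial.eval_sub, Polynomial.eval_one,
    Polynomial.eval_prod]
  rw [Finset.prod_inv_distrib, inv_pow] at h1
  field_simp at h1
  exact h1

/-- The orders of vanishing at `1` are `n` and `m`, since the Hilbert polynomial of the coinvariants
and the geometric sums are positive there. Comparison of polynomial degrees gives the bound. -/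
theorem card_eq_and_sum_le_of_polynomial_identity {m N : ℕ} {d : Fin m → ℕ} (hd : ∀ i, 0 < d i)
    {β : Type*} [Fintype β] {δ : β → ℕ} (hδ : ∀ j, δ j ≤ N)
    (h : (∑ j, (Polynomial.X : Polynomial ℝ) ^ δ j) * (1 - Polynomial.X) ^ n =
      ∏ i, (1 - (Polynomial.X : Polynomial ℝ) ^ d i)) :
    m = n ∧ ∑ i, d i ≤ N + n := by
  have hdeg : ∀ i, (1 - (Polynomial.X : Polynomial ℝ) ^ d i).natDegree = d i := fun i => by
    have := Polynomial.natDegree_X_pow_sub_C (n := d i) (r := (1 : ℝ))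
    rw [← neg_sub, Polynomial.natDegree_neg]
    simpa using this
  have hne : ∀ i, (1 - (Polynomial.X : Polynomial ℝ) ^ d i) ≠ 0 := fun i h0 => by
    have := hdeg i
    rw [h0, Polynomial.natDegree_zero] at this
    exact (hd i).ne this
  have hprod : ∏ i, (1 - (Polynomial.X : Polynomial ℝ) ^ d i) ≠ 0 :=
    Finset.prod_ne_zero_iff.2 fun i _ => hne i
  constructor
  · have hQ1 : (∑ j, (Polynomial.X : Polynomial ℝ) ^ δ j).eval 1 ≠ 0 := by
      have hβ : Nonempty β := by
        by_contra hβ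
        rw [not_nonempty_iff] at hβ
        rw [← h, Finset.univ_eq_empty, Finset.sum_empty, zero_mul] at hprod
        exact hprod rfl
      rw [Polynomial.eval_finsetSum]
      simp
    have hG1 : (∏ i, (∑ k ∈ Finset.range (d i), (Polynomial.X : Polynomial ℝ) ^ k)).eval 1 ≠ 0 := by
      rw [Polynomial.eval_prod]
      refine Finset.prod_ne_zero_iff.2 fun i _ => ?_
      rw [Polynomial.eval_finsetSum]
      simpa using (hd i).ne'
    have h1 : ∏ i, (1 - (Polynomial.X : Polynomial ℝ) ^ d i) =
        (∏ i, (∑ k ∈ Finset.range (d i), (Polynomial.X : Polynomial ℝ) ^ k)) *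
          (1 - Polynomial.X) ^ m := by
      have : (1 - Polynomial.X : Polynomial ℝ) ^ m = ∏ _i : Fin m, (1 - Polynomial.X) := by simp
      rw [this, ← Finset.prod_mul_distrib]
      refine Finset.prod_congr rfl fun i _ => ?_
      have := geom_sum_mul_neg (Polynomial.X : Polynomial ℝ) (d i)
      exact this.symm
    rw [h1] at h
    have h0 : (1 - Polynomial.X : Polynomial ℝ) ≠ 0 := by
      intro h0
      have := congrArg (Polynomial.eval 0) h0
      simp at this
    generalize ∏ i, (∑ k ∈ Finset.range (d i), (Polynomial.X : Polynomial ℝ) ^ k) = G at h hG1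
    rcases lt_trichotomy m n with hlt | heq | hlt
    · obtain ⟨k, rfl⟩ := Nat.exists_eq_add_of_lt hlt
      have h3 : (1 - Polynomial.X : Polynomial ℝ) ^ (m + k + 1) =
          (1 - Polynomial.X) ^ (k + 1) * (1 - Polynomial.X) ^ m := by ring
      rw [h3, ← mul_assoc] at h
      have h2 := mul_right_cancel₀ (pow_ne_zero m h0) h
      exact absurd (by rw [← h2]; simp) hG1
    · exact heq
    · obtain ⟨k, rfl⟩ := Nat.exists_eq_add_of_lt hlt
      have h3 : (1 - Polynomial.X : Polynomial ℝ) ^ (n + k + 1) =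
          (1 - Polynomial.X) ^ (k + 1) * (1 - Polynomial.X) ^ n := by ring
      rw [h3, ← mul_assoc] at h
      have h2 := mul_right_cancel₀ (pow_ne_zero n h0) h
      exact absurd (by rw [h2]; simp) hQ1
  · have h1 := congrArg Polynomial.natDegree h
    rw [Polynomial.natDegree_prod _ _ fun i _ => hne i, Finset.sum_congr rfl fun i _ => hdeg i] at h1
    rw [← h1]
    refine Polynomial.natDegree_mul_le.trans (add_le_add ?_ ?_)
    · refine Polynomial.natDegree_sum_le_of_forall_le _ _ fun j _ => ?_
      rw [Polynomial.natDegree_X_pow]; exact hδ j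
    · refine Polynomial.natDegree_pow_le.trans ?_
      have : (1 - Polynomial.X : Polynomial ℝ).natDegree ≤ 1 := by
        refine (Polynomial.natDegree_sub_le _ _).trans ?_
        simp
      exact (Nat.mul_le_mul_left n this).trans (by simp)

/-- The number of minimal generators is the rank, and the sum of their degrees is bounded in terms
of the top degree of the coinvariant algebra. -/
theorem IsMinimalGenerators.card_eq_and_sum_le [Fintype W]
    (hgen : Subgroup.closure (reflections W) = W) {m : ℕ} {d : Fin m → ℕ} {f : Fin m → S n}
    (hf : IsMinimalGenerators W d f) {N : ℕ}
    (hN : ∀ (q : S n) (k : ℕ), N < k → q.IsHomogeneous k → q ∈ posIdeal W) :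
    m = n ∧ ∑ i, d i ≤ N + n := by
  obtain ⟨β, b, δ, hδ, hb, hspan⟩ := exists_homogeneous_basis_quotient W
  have : Finite β := finite_of_linearIndependent_quotient hN hb
  have : Fintype β := Fintype.ofFinite β
  refine card_eq_and_sum_le_of_polynomial_identity hf.pos (δ := δ) (fun j => ?_)
    (polynomial_identity hf.pos fun t => ?_)
  · by_contra! h
    refine hb.ne_zero j ?_
    exact Ideal.Quotient.eq_zero_iff_mem.2 (hN _ _ h (hδ j))
  -- The two homogeneous bases compared are the one from freeness over the invariants and the one of
  -- monomials.
  · have h1 := tsum_degree_eq (ε := fun m => Finsupp.weight (fun _ : Fin n => 1) m)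
      (δ := fun x : (Fin m →₀ ℕ) × β => Finsupp.weight d x.1 + δ x.2)
      (fun x => (aeval_isHomogeneous_of_isWeightedHomogeneous hf.homogeneous
        (isWeightedHomogeneous_monomial d x.1 1 rfl)).mul (hδ x.2))
      (linearIndependent_monomial_mul hgen hf hδ hb) (span_monomial_mul hf hδ hspan)
      (fun m => isWeightedHomogeneous_monomial _ m 1 rfl)
      monomial_linearIndependent monomial_basis_span (fun k => t ^ k)
    rw [tsum_pow_weight, ENNReal.tsum_prod'] at h1
    rw [← h1, ← tsum_pow_weight, ← ENNReal.tsum_mul_right]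
    refine tsum_congr fun a => ?_
    simp only [pow_add]
    rw [ENNReal.tsum_mul_left, tsum_fintype]

end Degrees

end CherednikQH

end

noncomputable section

namespace CherednikQH

open MvPolynomial

/-! ### Antiinvariants -/

section Anti

variable {n : ℕ} {W : Subgroup (E n ≃ₗᵢ[ℝ] E n)}

theorem lin_totalDegree {v : E n} (hv : v ≠ 0) : (lin v).totalDegree = 1 :=
  (lin_isHomogeneous v).totalDegree (lin_ne_zero hv)

theorem coeff_lin (v : E n) (i : Fin n) :
    coeff (Finsupp.single i 1) (lin v) = ((v i : ℝ) : ℂ) := by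
  simp [lin, coeff_sum, coeff_C_mul, coeff_X, Finsupp.single_left_inj]

theorem lin_irreducible {v : E n} (hv : v ≠ 0) : Irreducible (lin v) := by
  refine irreducible_of_totalDegree_eq_one (lin_totalDegree hv) fun x hx => ?_
  rw [isUnit_iff_ne_zero]
  rintro rfl
  refine hv ?_
  ext i
  have := zero_dvd_iff.1 (hx (Finsupp.single i 1))
  rw [coeff_lin] at this
  simpa using this

theorem exists_smul_of_lin_dvd_lin {u v : E n} (hv : v ≠ 0) (h : lin u ∣ lin v) :
    ∃ t : ℝ, t ≠ 0 ∧ v = t • u := by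
  obtain ⟨q, hq⟩ := h
  have hu : lin u ≠ 0 := by
    intro hu
    rw [hu, zero_mul] at hq
    exact lin_ne_zero hv hq
  have hu0 : u ≠ 0 := by rintro rfl; exact hu lin_zero
  have hq0 : q ≠ 0 := by
    rintro rfl
    rw [mul_zero] at hq
    exact lin_ne_zero hv hq
  have h1 := congrArg totalDegree hq
  rw [totalDegree_mul_of_isDomain hu hq0, lin_totalDegree hu0, lin_totalDegree hv] at h1
  have h2 := eq_C_of_totalDegree_eq_zero (q := q) (by omega)
  set a := constantCoeff q
  have h3 : ∀ i, ((v i : ℝ) : ℂ) = a * ((u i : ℝ) : ℂ) := by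
    intro i
    rw [← coeff_lin, hq, h2, mul_comm, coeff_C_mul, coeff_lin]
  obtain ⟨i, hi⟩ : ∃ i, u i ≠ 0 := by
    by_contra! h
    exact hu0 (by ext i; exact h i)
  have h4 : a = ((v i / u i : ℝ) : ℂ) := by
    rw [Complex.ofReal_div, h3 i, mul_div_assoc, div_self (by exact_mod_cast hi), mul_one]
  have h5 : v = (v i / u i) • u := by
    ext j
    have := h3 j
    rw [h4] at this
    exact_mod_cast this
  refine ⟨_, ?_, h5⟩
  intro h0
  rw [h0, zero_smul] at h5
  exact hv h5

theorem reflection_smul {a : ℝ} (ha : a ≠ 0) (u : E n) :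
    (ℝ ∙ a • u)ᗮ.reflection = (ℝ ∙ u)ᗮ.reflection := by
  ext1 v
  rw [reflection_apply, reflection_apply, smul_smul]
  congr 2
  rw [reflCoeff, reflCoeff, real_inner_smul_left, norm_smul, mul_pow, Real.norm_eq_abs, sq_abs]
  by_cases hu : ‖u‖ = 0
  · simp [hu]
  · field_simp

theorem not_lin_root_dvd {s t : reflections W} (hst : s ≠ t) :
    ¬ lin (root s) ∣ lin (root t) := by
  intro h
  obtain ⟨a, ha, h1⟩ := exists_smul_of_lin_dvd_lin (root_ne_zero t) h
  refine hst (Subtype.ext ?_)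
  have h2 : (ℝ ∙ root t)ᗮ.reflection = (ℝ ∙ a • root s)ᗮ.reflection := by simp only [h1]
  rw [eq_reflection_root s, eq_reflection_root t, h2, reflection_smul ha]

/-- A polynomial which changes its sign under every reflection of `W`. -/
def IsAntiinvariant (W : Subgroup (E n ≃ₗᵢ[ℝ] E n)) (q : S n) : Prop :=
  ∀ s : reflections W, act s q = -q

theorem IsAntiinvariant.lin_root_dvd {q : S n} (hq : IsAntiinvariant W q) (s : reflections W) :
    lin (root s) ∣ q := by
  refine ⟨C (1 / 2) * divDiff s q, ?_⟩
  rw [mul_left_comm, root_mul_divDiff, hq s, sub_neg_eq_add, ← two_mul, ← mul_assoc]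
  have : (C (1 / 2) * 2 : S n) = 1 := by
    rw [show (2 : S n) = C 2 from (map_ofNat C 2).symm, ← C_mul]
    norm_num
  rw [this, one_mul]

theorem mem_invariants_of_refl (hgen : Subgroup.closure (reflections W) = W) {q : S n}
    (h : ∀ s : reflections W, act s q = q) : q ∈ invariants W := by
  intro w hw
  rw [← hgen] at hw
  induction hw using Subgroup.closure_induction with
  | mem s hs => exact h ⟨s, hs⟩
  | one => exact act_one_apply q
  | mul u v _ _ hu hv => rw [act_mul_apply, hv, hu]
  | inv u _ hu =>
    conv_lhs => rw [← hu]
    exact act_inv_act u q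

/-- The determinant of an isometry. -/
def sgn (w : E n ≃ₗᵢ[ℝ] E n) : ℂ :=
  ((LinearMap.det (w.toLinearEquiv : E n →ₗ[ℝ] E n) : ℝ) : ℂ)

theorem sgn_mul (u v : E n ≃ₗᵢ[ℝ] E n) : sgn (u * v) = sgn u * sgn v := by
  rw [sgn, sgn, sgn, ← Complex.ofReal_mul, ← LinearMap.det_comp]
  rfl

theorem sgn_one : sgn (1 : E n ≃ₗᵢ[ℝ] E n) = 1 := by
  have : ((1 : E n ≃ₗᵢ[ℝ] E n).toLinearEquiv : E n →ₗ[ℝ] E n) = LinearMap.id := rfl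
  rw [sgn, this, LinearMap.det_id, Complex.ofReal_one]

theorem sgn_refl (s : reflections W) : sgn (s : E n ≃ₗᵢ[ℝ] E n) = -1 := by
  have h := Submodule.det_reflection (𝕜 := ℝ) ((ℝ ∙ root s)ᗮ)
  rw [Submodule.orthogonal_orthogonal, finrank_span_singleton (root_ne_zero s), pow_one] at h
  have h2 : ((s : E n ≃ₗᵢ[ℝ] E n).toLinearEquiv : E n →ₗ[ℝ] E n) =
      ((ℝ ∙ root s)ᗮ.reflection).toLinearMap := by
    conv_lhs => rw [eq_reflection_root s]
  rw [sgn, h2, h]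
  simp

theorem sgn_ne_zero (w : E n ≃ₗᵢ[ℝ] E n) : sgn w ≠ 0 := by
  intro h
  have := sgn_mul w w⁻¹
  rw [mul_inv_cancel, sgn_one, h, zero_mul] at this
  exact one_ne_zero this

theorem act_of_isAntiinvariant (hgen : Subgroup.closure (reflections W) = W) {q : S n}
    (hq : IsAntiinvariant W q) {w : E n ≃ₗᵢ[ℝ] E n} (hw : w ∈ W) : act w q = sgn w • q := by
  rw [← hgen] at hw
  induction hw using Subgroup.closure_induction with
  | mem s hs =>
    rw [hq ⟨s, hs⟩, sgn_refl ⟨s, hs⟩, neg_one_smul]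
  | one => rw [act_one_apply, sgn_one, one_smul]
  | mul u v _ _ hu hv => rw [act_mul_apply, hv, map_smul, hu, sgn_mul, smul_smul, mul_comm]
  | inv u _ hu =>
    have h1 := act_inv_act u q
    rw [hu, map_smul] at h1
    apply smul_right_injective _ (sgn_ne_zero u)
    simp only
    rw [h1, smul_smul, ← sgn_mul, mul_inv_cancel, sgn_one, one_smul]

section AntiAverage

variable [Fintype W]

/-- The projection to the antiinvariants. -/
def antiAverage (W : Subgroup (E n ≃ₗᵢ[ℝ] E n)) [Fintype W] (q : S n) : S n :=
  (Fintype.card W : ℂ)⁻¹ • ∑ w : W, sgn (w : E n ≃ₗᵢ[ℝ] E n) • act (w : E n ≃ₗᵢ[ℝ] E n) q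

theorem antiAverage_isAntiinvariant (q : S n) : IsAntiinvariant W (antiAverage W q) := by
  intro s
  rw [antiAverage, map_smul, map_sum, ← smul_neg, ← Finset.sum_neg_distrib]
  congr 1
  have h : ∀ u : W, act (s : E n ≃ₗᵢ[ℝ] E n) (sgn (u : E n ≃ₗᵢ[ℝ] E n) •
      act (u : E n ≃ₗᵢ[ℝ] E n) q) =
      -(sgn ((⟨s, s.2.1⟩ * u : W) : E n ≃ₗᵢ[ℝ] E n) •
        act ((⟨s, s.2.1⟩ * u : W) : E n ≃ₗᵢ[ℝ] E n) q) := fun u => by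
    rw [Subgroup.coe_mul, act_mul_apply, map_smul, sgn_mul, sgn_refl, ← neg_smul]
    ring_nf
  simp only [h]
  exact Fintype.sum_equiv (Equiv.mulLeft (⟨s, s.2.1⟩ : W)) _
    (fun u : W => -(sgn (u : E n ≃ₗᵢ[ℝ] E n) • act (u : E n ≃ₗᵢ[ℝ] E n) q)) fun u => rfl

end AntiAverage

variable [Fintype (reflections W)]

/-- The product of the roots. -/
def rootProduct (W : Subgroup (E n ≃ₗᵢ[ℝ] E n)) [Fintype (reflections W)] : S n :=
  ∏ s : reflections W, lin (root s)

theorem rootProduct_ne_zero : rootProduct W ≠ 0 :=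
  Finset.prod_ne_zero_iff.2 fun s _ => lin_root_ne_zero s

theorem rootProduct_isHomogeneous :
    (rootProduct W).IsHomogeneous (Fintype.card (reflections W)) := by
  have := IsHomogeneous.prod (Finset.univ : Finset (reflections W)) (fun s => lin (root s))
    (fun _ => 1) fun s _ => lin_isHomogeneous _
  rwa [Finset.sum_const, smul_eq_mul, mul_one, Finset.card_univ] at this

/-- Each root divides `q`, since `q - s(q) = 2 * q`; roots of distinct reflections are coprime
because they are nonproportional linear forms. -/
theorem rootProduct_dvd {q : S n} (hq : IsAntiinvariant W q) : rootProduct W ∣ q := by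
  refine Fintype.prod_dvd_of_isRelPrime (fun s t hst => ?_) hq.lin_root_dvd
  exact (lin_irreducible (root_ne_zero s)).isRelPrime_iff_not_dvd.2 (not_lin_root_dvd hst)

theorem exists_act_rootProduct (w : W) :
    ∃ a : ℂ, act w (rootProduct W) = a • rootProduct W := by
  choose t ht h using exists_root_conjRefl w
  have h1 : rootProduct W = C (∏ s, (t s : ℂ)) * act w (rootProduct W) := by
    conv_lhs => rw [rootProduct, ← Equiv.prod_comp (conjRefl w)]
    rw [rootProduct, map_prod, map_prod, ← Finset.prod_mul_distrib]
    exact Finset.prod_congr rfl fun s _ => by rw [h, lin_smul, act_lin]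
  have h2 : ∏ s, (t s : ℂ) ≠ 0 :=
    Finset.prod_ne_zero_iff.2 fun s _ => Complex.ofReal_ne_zero.2 (ht s)
  refine ⟨(∏ s, (t s : ℂ))⁻¹, ?_⟩
  conv_rhs => rw [h1]
  rw [smul_eq_C_mul, ← mul_assoc, ← C_mul, inv_mul_cancel₀ h2, C_1, one_mul]

/-- A reflection permutes the root lines, so it scales the product by some `a` with `a * a = 1`. If
`a` were `1`, the product of the other roots would change sign under `s` and be divisible by the
root of `s`, which is proportional to none of them. This spares any choice of normalised roots. -/
theorem rootProduct_isAntiinvariant : IsAntiinvariant W (rootProduct W) := by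
  classical
  intro s
  obtain ⟨a, ha⟩ := exists_act_rootProduct (⟨s, s.2.1⟩ : W)
  simp only at ha
  have h1 : act s (act s (rootProduct W)) = rootProduct W := by
    rw [← act_mul_apply, refl_mul_self, act_one_apply]
  rw [ha, map_smul, ha, smul_smul] at h1
  have h2 : a * a = 1 := by
    have h3 : (a * a - 1) • rootProduct W = 0 := by rw [sub_smul, h1, one_smul, sub_self]
    exact sub_eq_zero.1 ((smul_eq_zero.1 h3).resolve_right rootProduct_ne_zero)
  rcases mul_self_eq_one_iff.1 h2 with rfl | rfl
  · exfalso
    rw [one_smul] at ha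
    set Q := ∏ t ∈ Finset.univ.erase s, lin (root t) with hQ
    have h3 : rootProduct W = lin (root s) * Q :=
      (Finset.mul_prod_erase _ (fun t : reflections W => lin (root t)) (Finset.mem_univ s)).symm
    rw [h3, map_mul, act_refl_root] at ha
    have h4 : act s Q = -Q := by
      apply mul_left_cancel₀ (lin_root_ne_zero s)
      linear_combination -ha
    have h5 : lin (root s) ∣ Q := by
      refine ⟨C (1 / 2) * divDiff s Q, ?_⟩
      rw [mul_left_comm, root_mul_divDiff, h4, sub_neg_eq_add, ← two_mul, ← mul_assoc]
      have : (C (1 / 2) * 2 : S n) = 1 := by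
        rw [show (2 : S n) = C 2 from (map_ofNat C 2).symm, ← C_mul]
        norm_num
      rw [this, one_mul]
    obtain ⟨t, ht, h6⟩ := (lin_irreducible (root_ne_zero s)).prime.exists_mem_finset_dvd h5
    exact not_lin_root_dvd (Finset.ne_of_mem_erase ht).symm h6
  · rw [ha, neg_one_smul]

theorem IsAntiinvariant.exists_eq_mul (hgen : Subgroup.closure (reflections W) = W) {q : S n}
    (hq : IsAntiinvariant W q) : ∃ g ∈ invariants W, q = rootProduct W * g := by
  obtain ⟨g, rfl⟩ := rootProduct_dvd hq
  refine ⟨g, mem_invariants_of_refl hgen fun s => ?_, rfl⟩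
  have h := hq s
  rw [map_mul, rootProduct_isAntiinvariant s, neg_mul, neg_inj] at h
  exact mul_left_cancel₀ rootProduct_ne_zero h

end Anti

end CherednikQH

end

noncomputable section

namespace CherednikQH

open MvPolynomial

/-! ### The top degree of the coinvariant algebra -/

section Steinberg

variable {n : ℕ} {W : Subgroup (E n ≃ₗᵢ[ℝ] E n)}

theorem isConjInvariant_zero : IsConjInvariant (0 : reflections W → ℂ) :=
  fun _ _ _ _ _ => rfl

/-- For `c = 0` the Dunkl operators are the partial derivatives. The nondegenerate pairing at this
parameter governs the coinvariant algebra, whatever the parameter of the theorem. -/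
theorem isRegular_zero : IsRegular (0 : reflections W → ℂ) := by
  refine ⟨isConjInvariant_zero, ?_⟩
  rintro ⟨x, hx, h⟩
  have h1 : ∀ i, pderiv i x = 0 := by
    intro i
    have := h (Pi.single i 1)
    rw [dunkl, finsum_eq_zero_of_forall_eq_zero (fun s => by simp), sub_zero, LinearMap.sum_apply,
      Finset.sum_eq_single i (fun j _ hj => by simp [hj]) (by simp)] at this
    simpa using this
  have h2 : x = C (coeff 0 x) := by
    ext m
    rw [coeff_C]
    split_ifs with hm
    · rw [hm]
    · obtain ⟨i, hi⟩ := Finsupp.ne_iff.1 (Ne.symm hm)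
      have h3 := congrArg (coeff (m - Finsupp.single i 1)) (h1 i)
      have hle : Finsupp.single i 1 ≤ m := by
        simpa using Nat.one_le_iff_ne_zero.2 hi
      rw [coeff_pderiv, coeff_zero, tsub_add_cancel_of_le hle] at h3
      refine (mul_eq_zero.1 h3).resolve_right ?_
      exact Nat.cast_add_one_ne_zero _
  rw [h2, totalDegree_C] at hx
  exact lt_irrefl _ hx

variable [Fintype (reflections W)]

/-- The result is antiinvariant, hence divisible by the product of the roots, but has smaller
degree. -/
theorem nabla_posInvariants_rootProduct {f : S n} (hf : f ∈ posInvariants W) :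
    nabla (0 : reflections W → ℂ) f (rootProduct W) = 0 := by
  obtain ⟨hfW, d, hd, hfd⟩ := hf
  have hc := isConjInvariant_zero (W := W)
  rcases lt_or_ge (Fintype.card (reflections W)) d with h | h
  · exact nabla_eq_zero_of_lt hc hfd rootProduct_isHomogeneous h
  have h1 : IsAntiinvariant W (nabla (0 : reflections W → ℂ) f (rootProduct W)) := by
    intro s
    have h2 := act_nabla hc ⟨s, s.2.1⟩ f (rootProduct W)
    simp only at h2
    rw [h2, hfW s s.2.1, rootProduct_isAntiinvariant s, map_neg]
  obtain ⟨g, hg⟩ := rootProduct_dvd h1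
  have h2 : (nabla (0 : reflections W → ℂ) f (rootProduct W)).IsHomogeneous
      (Fintype.card (reflections W) - d) :=
    nabla_isHomogeneous hc hfd (by rw [Nat.add_sub_cancel' h]; exact rootProduct_isHomogeneous)
  by_contra hne
  have hg0 : g ≠ 0 := by rintro rfl; rw [mul_zero] at hg; exact hne hg
  have h3 := h2.totalDegree hne
  rw [hg, totalDegree_mul_of_isDomain rootProduct_ne_zero hg0,
    rootProduct_isHomogeneous.totalDegree rootProduct_ne_zero] at h3
  omega

theorem nabla_posIdeal_rootProduct {f : S n} (hf : f ∈ posIdeal W) :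
    nabla (0 : reflections W → ℂ) f (rootProduct W) = 0 := by
  have hc := isConjInvariant_zero (W := W)
  refine Submodule.span_induction (p := fun f _ =>
    nabla (0 : reflections W → ℂ) f (rootProduct W) = 0) ?_ ?_ ?_ ?_ hf
  · exact fun f hf => nabla_posInvariants_rootProduct hf
  · simp [nabla]
  · intro x y _ _ hx hy
    rw [nabla_add_apply hc, hx, hy, add_zero]
  · intro a x _ hx
    rw [smul_eq_mul, nabla_mul_apply hc, hx, map_zero]

theorem IsAntiinvariant.sub_mem_posIdeal (hgen : Subgroup.closure (reflections W) = W) {q : S n}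
    (hq : IsAntiinvariant W q) : ∃ a : ℂ, q - a • rootProduct W ∈ posIdeal W := by
  obtain ⟨g, hg, rfl⟩ := hq.exists_eq_mul hgen
  refine ⟨constantCoeff g, ?_⟩
  have : rootProduct W * g - constantCoeff g • rootProduct W =
      rootProduct W * (g - C (constantCoeff g)) := by
    rw [smul_eq_C_mul]; ring
  rw [this]
  refine Ideal.mul_mem_left _ _ (mem_posIdeal_of_constantCoeff
    (Subalgebra.sub_mem _ hg (Subalgebra.algebraMap_mem _ _)) ?_)
  rw [map_sub, constantCoeff_C, sub_self]

variable [Fintype W]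

theorem constantCoeff_nabla_antiAverage (hgen : Subgroup.closure (reflections W) = W) (p : S n) :
    constantCoeff (nabla (0 : reflections W → ℂ) (antiAverage W p) (rootProduct W)) =
      constantCoeff (nabla (0 : reflections W → ℂ) p (rootProduct W)) := by
  have hc := isConjInvariant_zero (W := W)
  have h : ∀ w : W, constantCoeff (nabla (0 : reflections W → ℂ)
      (sgn (w : E n ≃ₗᵢ[ℝ] E n) • act (w : E n ≃ₗᵢ[ℝ] E n) p) (rootProduct W)) =
      constantCoeff (nabla (0 : reflections W → ℂ) p (rootProduct W)) := by
    intro w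
    have h1 := act_nabla hc w p (rootProduct W)
    rw [act_of_isAntiinvariant hgen rootProduct_isAntiinvariant w.2, map_smul] at h1
    rw [nabla_smul_apply hc, ← h1, constantCoeff_act]
  rw [antiAverage, nabla_smul_apply hc, nabla_sum_apply hc, smul_eq_C_mul, map_mul, map_sum,
    Finset.sum_congr rfl fun w _ => h w, Finset.sum_const, Finset.card_univ, constantCoeff_C,
    nsmul_eq_mul, ← mul_assoc, inv_mul_cancel₀ card_ne_zero', one_mul]

/-- The pairing of `p` with the product of the roots depends only on the antiinvariant part of `p`,
which is a multiple of that product modulo `posIdeal W`. If the product paired to zero with itself,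
it would be in the kernel of a nondegenerate pairing. -/
theorem nabla_rootProduct_rootProduct_ne_zero (hgen : Subgroup.closure (reflections W) = W) :
    nabla (0 : reflections W → ℂ) (rootProduct W) (rootProduct W) ≠ 0 := by
  have hc := isConjInvariant_zero (W := W)
  intro h0
  refine rootProduct_ne_zero (eq_zero_of_constantCoeff_nabla (isRegular_zero (W := W)) _
    (rootProduct W)
    rootProduct_isHomogeneous fun p _ => ?_)
  rw [← constantCoeff_nabla_antiAverage hgen]
  obtain ⟨a, ha⟩ := (antiAverage_isAntiinvariant (W := W) p).sub_mem_posIdeal hgen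
  have h1 := nabla_posIdeal_rootProduct ha
  rw [sub_eq_add_neg, ← neg_smul, nabla_add_apply hc, nabla_smul_apply hc, h0, smul_zero,
    add_zero] at h1
  rw [h1, map_zero]

omit [Fintype (reflections W)] in
-- `X i` is a root of the monic polynomial whose roots are its images under `W`; the lower
-- coefficients are invariants without constant term. This makes the coinvariant algebra
-- finite-dimensional, with a crude bound on its degrees.
theorem X_pow_mem_posIdeal (i : Fin n) : (X i : S n) ^ Fintype.card W ∈ posIdeal W := by
  let p : Polynomial (S n) := ∏ w : W, (Polynomial.X - Polynomial.C
    (act (w : E n ≃ₗᵢ[ℝ] E n) (X i)))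
  have hp : ∀ u : W, p.map (act (u : E n ≃ₗᵢ[ℝ] E n) : S n →+* S n) = p := by
    intro u
    simp only [p]
    rw [Polynomial.map_prod]
    have h : ∀ w : W, Polynomial.map (act (u : E n ≃ₗᵢ[ℝ] E n) : S n →+* S n)
        (Polynomial.X - Polynomial.C (act (w : E n ≃ₗᵢ[ℝ] E n) (X i))) =
        Polynomial.X - Polynomial.C (act ((u * w : W) : E n ≃ₗᵢ[ℝ] E n) (X i)) := fun w => by
      rw [Subgroup.coe_mul, act_mul_apply, Polynomial.map_sub, Polynomial.map_X, Polynomial.map_C]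
      rfl
    simp only [h]
    exact Fintype.prod_equiv (Equiv.mulLeft u) _
      (fun w : W => Polynomial.X - Polynomial.C (act (w : E n ≃ₗᵢ[ℝ] E n) (X i))) fun w => rfl
  have hinv : ∀ k, p.coeff k ∈ invariants W := by
    intro k w hw
    have := congrArg (fun q => Polynomial.coeff q k) (hp ⟨w, hw⟩)
    simp only [Polynomial.coeff_map] at this
    exact this
  have hconst : p.map (constantCoeff : S n →+* ℂ) = Polynomial.X ^ Fintype.card W := by
    simp only [p]
    rw [Polynomial.map_prod]
    have h : ∀ w : W, Polynomial.map (constantCoeff : S n →+* ℂ)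
        (Polynomial.X - Polynomial.C (act (w : E n ≃ₗᵢ[ℝ] E n) (X i))) = Polynomial.X := fun w => by
      rw [Polynomial.map_sub, Polynomial.map_X, Polynomial.map_C, constantCoeff_act,
        constantCoeff_X, Polynomial.C_0, sub_zero]
    simp only [h]
    rw [Finset.prod_const, Finset.card_univ]
  have heval : p.eval (X i) = 0 := by
    simp only [p]
    rw [Polynomial.eval_prod]
    refine Finset.prod_eq_zero (Finset.mem_univ (1 : W)) ?_
    rw [OneMemClass.coe_one, act_one_apply]
    simp
  have hsub : (p - (p.map (constantCoeff : S n →+* ℂ)).map (C : ℂ →+* S n)).eval (X i) ∈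
      posIdeal W := by
    rw [Polynomial.eval_eq_sum, Polynomial.sum]
    refine Ideal.sum_mem _ fun k _ => Ideal.mul_mem_right _ _ ?_
    rw [Polynomial.coeff_sub, Polynomial.coeff_map, Polynomial.coeff_map]
    refine mem_posIdeal_of_constantCoeff
      (Subalgebra.sub_mem _ (hinv k) (Subalgebra.algebraMap_mem _ _)) ?_
    rw [map_sub, constantCoeff_C, sub_self]
  rw [hconst, Polynomial.eval_sub, heval, zero_sub, Polynomial.map_pow, Polynomial.map_X,
    Polynomial.eval_pow, Polynomial.eval_X] at hsub
  simpa using neg_mem hsub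

omit [Fintype (reflections W)] in
theorem isHomogeneous_mem_posIdeal_of_lt {q : S n} {k : ℕ} (hk : n * Fintype.card W < k)
    (hq : q.IsHomogeneous k) : q ∈ posIdeal W := by
  rw [q.as_sum]
  refine Ideal.sum_mem _ fun m hm => ?_
  obtain ⟨i, hi⟩ : ∃ i, Fintype.card W ≤ m i := by
    by_contra! h
    have h1 : k = m.degree := hq.degree_eq_sum_deg_support hm
    have h2 : m.degree ≤ n * Fintype.card W := by
      rw [Finsupp.degree_eq_sum]
      refine (Finset.sum_le_card_nsmul _ _ _ fun i _ => (h i).le).trans ?_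
      simp
    omega
  have h1 : (monomial m (coeff m q) : S n) =
      monomial (m - Finsupp.single i (Fintype.card W)) (coeff m q) * X i ^ Fintype.card W := by
    rw [X_pow_eq_monomial, monomial_mul, mul_one, tsub_add_cancel_of_le]
    simpa using hi
  rw [h1]
  exact Ideal.mul_mem_left _ _ (X_pow_mem_posIdeal i)

omit [Fintype (reflections W)] in
theorem sub_antiAverage_mem_posIdeal (hgen : Subgroup.closure (reflections W) = W) {q : S n}
    (h : ∀ s : reflections W, q + act s q ∈ posIdeal W) : q - antiAverage W q ∈ posIdeal W := by
  have key : ∀ w ∈ W, q - sgn w • act w q ∈ posIdeal W := by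
    intro w hw
    have hw' : w ∈ Subgroup.closure (reflections W) := by rwa [hgen]
    induction hw' using Subgroup.closure_induction with
    | mem s hs =>
      rw [sgn_refl ⟨s, hs⟩, neg_one_smul, sub_neg_eq_add]
      exact h ⟨s, hs⟩
    | one => rw [act_one_apply, sgn_one, one_smul, sub_self]; exact Ideal.zero_mem _
    | mul u v hu hv hu' hv' =>
      rw [hgen] at hu hv
      have : q - sgn (u * v) • act (u * v) q = (q - sgn u • act u q) +
          sgn u • act u (q - sgn v • act v q) := by
        rw [act_mul_apply, map_sub, map_smul, smul_sub, smul_smul, sgn_mul]; ring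
      rw [this]
      refine Ideal.add_mem _ (hu' hu) ?_
      rw [smul_eq_C_mul]
      exact Ideal.mul_mem_left _ _ (act_mem_posIdeal hu (hv' hv))
    | inv u hu hu' =>
      rw [hgen] at hu
      have : q - sgn u⁻¹ • act u⁻¹ q = -(sgn u⁻¹ • act u⁻¹ (q - sgn u • act u q)) := by
        rw [map_sub, map_smul, act_inv_act, smul_sub, smul_smul, ← sgn_mul, inv_mul_cancel,
          sgn_one, one_smul]; ring
      rw [this, smul_eq_C_mul (act u⁻¹ (q - sgn u • act u q))]
      exact neg_mem (Ideal.mul_mem_left _ _ (act_mem_posIdeal (W.inv_mem hu) (hu' hu)))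
  have h1 : q - antiAverage W q = C (Fintype.card W : ℂ)⁻¹ *
      ∑ w : W, (q - sgn (w : E n ≃ₗᵢ[ℝ] E n) • act (w : E n ≃ₗᵢ[ℝ] E n) q) := by
    rw [antiAverage, Finset.sum_sub_distrib, Finset.sum_const, Finset.card_univ, mul_sub,
      ← smul_eq_C_mul, ← smul_eq_C_mul, ← Nat.cast_smul_eq_nsmul ℂ, smul_smul,
      inv_mul_cancel₀ card_ne_zero', one_smul]
  rw [h1]
  exact Ideal.mul_mem_left _ _ (Ideal.sum_mem _ fun (w : W) _ => key w w.2)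

/-- Steinberg's argument, by descending induction on the degree `k`; `j` bounds the distance to the
range where the crude degree bound puts everything in the ideal. -/
theorem mem_posIdeal_of_nabla_rootProduct (hgen : Subgroup.closure (reflections W) = W) (j : ℕ) :
    ∀ (k : ℕ) (q : S n), n * Fintype.card W < k + j → q.IsHomogeneous k →
      nabla (0 : reflections W → ℂ) q (rootProduct W) = 0 → q ∈ posIdeal W := by
  have hc := isConjInvariant_zero (W := W)
  induction j with
  | zero => exact fun k q hk hq _ => isHomogeneous_mem_posIdeal_of_lt hk hq
  | succ j ih =>
    intro k q hk hq h0
    have h1 : ∀ s : reflections W, q + act s q ∈ posIdeal W := by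
      intro s
      -- The product with a root still annihilates the product of the roots and has larger degree.
      -- Its divided difference is `q + s(q)`, so modulo the ideal `q` is antiinvariant, hence a
      -- multiple of the product of the roots; pairing with that product shows that the multiple is
      -- zero.
      have h2 : lin (root s) * q ∈ posIdeal W := by
        refine ih (k + 1) _ (by omega) ?_ ?_
        · rw [add_comm]; exact (lin_isHomogeneous _).mul hq
        · rw [nabla_mul_apply hc, h0, map_zero]
      have h3 := divDiff_mem_posIdeal s h2
      rwa [divDiff_eq_of_mul_eq s (p := q + act s q)
        (by rw [map_mul, act_refl_root]; ring)] at h3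
    have h2 := sub_antiAverage_mem_posIdeal hgen h1
    obtain ⟨a, ha⟩ := (antiAverage_isAntiinvariant (W := W) q).sub_mem_posIdeal hgen
    have h3 : q - a • rootProduct W ∈ posIdeal W := by
      simpa using Ideal.add_mem _ h2 ha
    have h4 := nabla_posIdeal_rootProduct h3
    rw [sub_eq_add_neg, ← neg_smul, nabla_add_apply hc, nabla_smul_apply hc, h0, zero_add] at h4
    have h5 : a = 0 := by
      simpa using (smul_eq_zero.1 h4).resolve_right (nabla_rootProduct_rootProduct_ne_zero hgen)
    rwa [h5, zero_smul, sub_zero] at h3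

theorem isHomogeneous_mem_posIdeal (hgen : Subgroup.closure (reflections W) = W) (q : S n) (k : ℕ)
    (hk : Fintype.card (reflections W) < k) (hq : q.IsHomogeneous k) : q ∈ posIdeal W :=
  mem_posIdeal_of_nabla_rootProduct hgen (n * Fintype.card W + 1) k q (by omega) hq
    (nabla_eq_zero_of_lt isConjInvariant_zero hq rootProduct_isHomogeneous hk)

end Steinberg

end CherednikQH

end

noncomputable section

namespace CherednikQH

open MvPolynomial

/-! ### The Jacobian of the elementary invariants -/

section Jacobian

variable {n : ℕ} {W : Subgroup (E n ≃ₗᵢ[ℝ] E n)} {d : Fin n → ℕ} {f : Fin n → S n}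

/-- The Jacobian matrix. -/
def jacobian (f : Fin n → S n) : Matrix (Fin n) (Fin n) (S n) :=
  Matrix.of fun i j => pderiv j (f i)

theorem jacobian_apply (f : Fin n → S n) (i j : Fin n) : jacobian f i j = pderiv j (f i) := rfl

/-- A vector `v` over `S(V)` annihilated by the Jacobian matrix stays so after multiplication by any
`z` and averaging, and then has invariant entries, which vanish. -/
theorem jacobian_det_ne_zero [Fintype W] (hgen : Subgroup.closure (reflections W) = W)
    (hf : IsMinimalGenerators W d f) : (jacobian f).det ≠ 0 := by
  classical
  intro hdet
  obtain ⟨v, hv0, hv⟩ := Matrix.exists_vecMul_eq_zero_iff.2 hdet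
  have h1 : ∀ u : E n, ∑ i, v i * dirDeriv u (f i) = 0 := by
    intro u
    simp only [dirDeriv_apply, Finset.mul_sum, mul_smul_comm]
    rw [Finset.sum_comm]
    refine Finset.sum_eq_zero fun j _ => ?_
    have := congrFun hv j
    rw [Matrix.vecMul, dotProduct] at this
    rw [← Finset.smul_sum]
    exact smul_eq_zero_of_right _ this
  have h2 : ∀ w ∈ W, ∀ j, ∑ i, act w (v i) * pderiv j (f i) = 0 := by
    intro w hw j
    have := congrArg (act w) (h1 (w⁻¹ (EuclideanSpace.single j 1)))
    rw [map_sum, map_zero] at this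
    rw [← this]
    refine Finset.sum_congr rfl fun i _ => ?_
    have h3 : w (w⁻¹ (EuclideanSpace.single j (1 : ℝ))) = EuclideanSpace.single j 1 :=
      w.apply_symm_apply _
    rw [map_mul, act_dirDeriv, h3, hf.mem i w hw, dirDeriv_single]
  have h3 : ∀ (z : S n) (i : Fin n), average W (z * v i) = 0 := by
    intro z
    refine hf.eq_zero_of_sum_mul_pderiv hgen _ (fun i => average_mem _) fun j => ?_
    simp only [average_apply, smul_mul_assoc, Finset.sum_mul]
    rw [← Finset.smul_sum, Finset.sum_comm]
    refine smul_eq_zero_of_right _ (Finset.sum_eq_zero fun (w : W) _ => ?_)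
    simp only [map_mul, mul_assoc]
    rw [← Finset.mul_sum, h2 w w.2, mul_zero]
  obtain ⟨i, hi⟩ := Function.ne_iff.1 hv0
  have hmem : ∏ w : W, act (w : E n ≃ₗᵢ[ℝ] E n) (v i) ∈ invariants W := by
    intro u hu
    rw [map_prod]
    have h : ∀ w : W, act u (act (w : E n ≃ₗᵢ[ℝ] E n) (v i)) =
        act (((⟨u, hu⟩ : W) * w : W) : E n ≃ₗᵢ[ℝ] E n) (v i) := fun w => by
      rw [Subgroup.coe_mul, act_mul_apply]
    simp only [h]
    exact Fintype.prod_equiv (Equiv.mulLeft (⟨u, hu⟩ : W)) _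
      (fun w : W => act (w : E n ≃ₗᵢ[ℝ] E n) (v i)) fun w => rfl
  -- With `z` the product of the other conjugates, `z * v i` is the norm of `v i`: it is already
  -- invariant, and nonzero if `v i` is.
  have h4 := h3 (∏ w ∈ Finset.univ.erase (1 : W), act (w : E n ≃ₗᵢ[ℝ] E n) (v i)) i
  have h5 : (∏ w ∈ Finset.univ.erase (1 : W), act (w : E n ≃ₗᵢ[ℝ] E n) (v i)) * v i =
      ∏ w : W, act (w : E n ≃ₗᵢ[ℝ] E n) (v i) := by
    rw [← Finset.prod_erase_mul _ _ (Finset.mem_univ (1 : W)), OneMemClass.coe_one, act_one_apply]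
  rw [h5, average_of_mem hmem] at h4
  refine Finset.prod_ne_zero_iff.2 (fun w _ => ?_) h4
  intro h0
  exact hi (act_injective _ (by rw [h0]; exact (map_zero _).symm))

/-- The complex matrix of an isometry. -/
def isomMatrix (w : E n ≃ₗᵢ[ℝ] E n) : Matrix (Fin n) (Fin n) ℂ :=
  Matrix.of fun k j => ((w (EuclideanSpace.single j 1) k : ℝ) : ℂ)

theorem isomMatrix_det (w : E n ≃ₗᵢ[ℝ] E n) : (isomMatrix w).det = sgn w := by
  have h := LinearMap.det_toMatrix (EuclideanSpace.basisFun (Fin n) ℝ).toBasis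
    (w.toLinearEquiv : E n →ₗ[ℝ] E n)
  rw [sgn, ← h, ← Complex.ofRealHom_eq_coe, RingHom.map_det]
  congr 1

theorem map_act_jacobian (hf : ∀ i, f i ∈ invariants W) {w : E n ≃ₗᵢ[ℝ] E n} (hw : w ∈ W) :
    (jacobian f).map (act w) = jacobian f * (isomMatrix w).map C := by
  refine Matrix.ext fun i j => ?_
  rw [Matrix.map_apply, jacobian_apply, ← dirDeriv_single, act_dirDeriv, hf i w hw, dirDeriv_apply,
    Matrix.mul_apply]
  refine Finset.sum_congr rfl fun k _ => ?_
  rw [Matrix.map_apply, jacobian_apply, smul_eq_C_mul, mul_comm]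
  rfl

theorem jacobian_det_isAntiinvariant (hf : ∀ i, f i ∈ invariants W) :
    IsAntiinvariant W (jacobian f).det := by
  intro s
  have h1 : act s (jacobian f).det = ((jacobian f).map (act s)).det :=
    (act (s : E n ≃ₗᵢ[ℝ] E n)).toRingHom.map_det _
  have h2 : ((isomMatrix (s : E n ≃ₗᵢ[ℝ] E n)).map (C : ℂ → S n)).det =
      C (isomMatrix (s : E n ≃ₗᵢ[ℝ] E n)).det := ((C : ℂ →+* S n).map_det _).symm
  rw [h1, map_act_jacobian hf s.2.1, Matrix.det_mul, h2, isomMatrix_det, sgn_refl]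
  simp

theorem jacobian_det_isHomogeneous (hf : ∀ i, (f i).IsHomogeneous (d i)) :
    (jacobian f).det.IsHomogeneous (∑ i, (d i - 1)) := by
  rw [Matrix.det_apply]
  refine IsHomogeneous.sum _ _ _ fun σ _ => ?_
  have h1 := IsHomogeneous.prod Finset.univ (fun i => jacobian f (σ i) i)
    (fun i => d (σ i) - 1) fun i _ => (hf (σ i)).pderiv
  rw [Equiv.sum_comp σ fun i => d i - 1] at h1
  rcases Int.units_eq_one_or (Equiv.Perm.sign σ) with h | h <;> rw [h]
  · simpa using h1
  · rw [Units.neg_smul, one_smul]; exact h1.neg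

variable [Fintype W] [Fintype (reflections W)]

/-- The determinant is antiinvariant and nonzero, so its degree, the sum of the `d i - 1`, is at
least the number of reflections. The hypothesis `hd` is the opposite inequality, and the cofactor
must be constant. -/
theorem jacobian_det_eq (hgen : Subgroup.closure (reflections W) = W)
    (hf : IsMinimalGenerators W d f) (hd : ∑ i, d i ≤ Fintype.card (reflections W) + n) :
    ∑ i, (d i - 1) = Fintype.card (reflections W) ∧
      ∃ a : ℂ, a ≠ 0 ∧ (jacobian f).det = C a * rootProduct W := by
  have h0 := jacobian_det_ne_zero hgen hf
  obtain ⟨g, hg⟩ := rootProduct_dvd (jacobian_det_isAntiinvariant hf.mem)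
  have hg0 : g ≠ 0 := by rintro rfl; rw [mul_zero] at hg; exact h0 hg
  have h1 := (jacobian_det_isHomogeneous hf.homogeneous).totalDegree h0
  rw [hg, totalDegree_mul_of_isDomain rootProduct_ne_zero hg0,
    rootProduct_isHomogeneous.totalDegree rootProduct_ne_zero] at h1
  have h2 : ∑ i, (d i - 1) + n = ∑ i, d i := by
    have h : ∑ i, d i = ∑ i, ((d i - 1) + 1) :=
      Finset.sum_congr rfl fun i _ => (Nat.sub_add_cancel (hf.pos i)).symm
    rw [h, Finset.sum_add_distrib]
    simp
  have h3 := eq_C_of_totalDegree_eq_zero (q := g) (by omega)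
  refine ⟨by omega, constantCoeff g, ?_, ?_⟩
  · intro h4
    rw [h4, C_0] at h3
    exact hg0 h3
  · rw [hg, mul_comm, ← h3]

/-- Chevalley's theorem, with the sum of the degrees and the factorization of the Jacobian. -/
theorem exists_minimalGenerators_jacobian (hgen : Subgroup.closure (reflections W) = W) :
    ∃ (d : Fin n → ℕ) (f : Fin n → S n), IsMinimalGenerators W d f ∧
      ∑ i, (d i - 1) = Fintype.card (reflections W) ∧
      ∃ a : ℂ, a ≠ 0 ∧ (jacobian f).det = C a * rootProduct W := by
  obtain ⟨m, d, f, hf⟩ := exists_isMinimalGenerators W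
  obtain ⟨rfl, hd⟩ := hf.card_eq_and_sum_le hgen (isHomogeneous_mem_posIdeal hgen)
  exact ⟨d, f, hf, jacobian_det_eq hgen hf hd⟩

omit [Fintype (reflections W)] in
theorem IsMinimalGenerators.isElementaryInvariants (hgen : Subgroup.closure (reflections W) = W)
    (hf : IsMinimalGenerators W d f) : IsElementaryInvariants W d f :=
  ⟨hf.homogeneous, hf.algebraicIndependent hgen, hf.adjoin_eq⟩

end Jacobian

end CherednikQH

end

noncomputable section

namespace CherednikQH

open MvPolynomial

/-! ### Invariants of degree at most two -/

section LowDegree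

variable {n : ℕ} {W : Subgroup (E n ≃ₗᵢ[ℝ] E n)}

theorem dirDeriv_add (u v : E n) (q : S n) :
    dirDeriv (u + v) q = dirDeriv u q + dirDeriv v q := by
  simp [dirDeriv_apply, add_smul, Finset.sum_add_distrib]

theorem dirDeriv_smul (a : ℝ) (v : E n) (q : S n) :
    dirDeriv (a • v) q = (a : ℂ) • dirDeriv v q := by
  simp [dirDeriv_apply, mul_smul, Finset.smul_sum]

theorem constantCoeff_dirDeriv_apply {q : S n} {w : E n ≃ₗᵢ[ℝ] E n} (hq : act w q = q) (v : E n) :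
    constantCoeff (dirDeriv (w v) q) = constantCoeff (dirDeriv v q) := by
  conv_lhs => rw [← hq]
  rw [← act_dirDeriv, constantCoeff_act]

theorem constantCoeff_dirDeriv_dirDeriv_apply {q : S n} {w : E n ≃ₗᵢ[ℝ] E n} (hq : act w q = q)
    (u v : E n) : constantCoeff (dirDeriv (w u) (dirDeriv (w v) q)) =
      constantCoeff (dirDeriv u (dirDeriv v q)) := by
  conv_lhs => rw [← hq]
  rw [← act_dirDeriv, ← act_dirDeriv, constantCoeff_act]

theorem eq_C_of_isHomogeneous_zero {q : S n} (hq : q.IsHomogeneous 0) : q = C (constantCoeff q) := by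
  rcases eq_or_ne q 0 with rfl | h
  · simp
  · exact eq_C_of_totalDegree_eq_zero (hq.totalDegree h)

/-- The real and the imaginary part of an invariant linear form have invariant kernels. -/
theorem eq_zero_of_isHomogeneous_one (hn : 2 ≤ n)
    (hirr : ∀ U : Submodule ℝ (E n), (∀ w ∈ W, ∀ u ∈ U, w u ∈ U) → U = ⊥ ∨ U = ⊤) {q : S n}
    (hq : q ∈ invariants W) (hd : q.IsHomogeneous 1) : q = 0 := by
  have key : ∀ L : ℂ →ₗ[ℝ] ℝ, ∀ v, L (constantCoeff (dirDeriv v q)) = 0 := by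
    intro L
    let φ : E n →ₗ[ℝ] ℝ :=
      { toFun := fun v => L (constantCoeff (dirDeriv v q))
        map_add' := fun u v => by rw [dirDeriv_add, map_add, map_add]
        map_smul' := fun a v => by
          rw [dirDeriv_smul, smul_eq_C_mul, map_mul, constantCoeff_C, ← Complex.real_smul, map_smul]
          rfl }
    have hφ : ∀ v, φ v = L (constantCoeff (dirDeriv v q)) := fun v => rfl
    rcases hirr (LinearMap.ker φ) fun w hw u hu => by
      rw [LinearMap.mem_ker, hφ] at hu ⊢
      rw [constantCoeff_dirDeriv_apply (hq w hw), hu] with h | h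
    -- A functional on a space of dimension at least two is not injective, so its invariant kernel
    -- is the whole space.
    · have h1 := LinearMap.finrank_le_finrank_of_injective (LinearMap.ker_eq_bot.1 h)
      rw [finrank_euclideanSpace_fin, Module.finrank_self] at h1
      omega
    · intro v
      have : v ∈ LinearMap.ker φ := h ▸ Submodule.mem_top
      exact this
  have h0 : ∀ v, dirDeriv v q = 0 := by
    intro v
    have h1 : constantCoeff (dirDeriv v q) = 0 :=
      Complex.ext (key Complex.reLm v) (key Complex.imLm v)
    rw [eq_C_of_isHomogeneous_zero (dirDeriv_isHomogeneous v hd), h1, C_0]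
  have h1 := hd.sum_X_mul_pderiv
  simp only [← dirDeriv_single, h0, mul_zero, Finset.sum_const_zero, one_smul] at h1
  exact h1.symm

theorem exists_reflection (hn : 2 ≤ n) (hgen : Subgroup.closure (reflections W) = W)
    (hirr : ∀ U : Submodule ℝ (E n), (∀ w ∈ W, ∀ u ∈ U, w u ∈ U) → U = ⊥ ∨ U = ⊤) :
    Nonempty (reflections W) := by
  by_contra h
  rw [Set.nonempty_coe_sort, Set.not_nonempty_iff_eq_empty] at h
  rw [h, Subgroup.closure_empty] at hgen
  let v : E n := EuclideanSpace.single ⟨0, by omega⟩ 1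
  have hv : v ≠ 0 := by simp [v]
  have h1 := finrank_span_singleton (K := ℝ) hv
  rcases hirr (ℝ ∙ v) fun w hw u hu => by
    rw [← hgen, Subgroup.mem_bot] at hw
    rw [hw]
    exact hu with h2 | h2
  · exact hv (Submodule.span_singleton_eq_bot.1 h2)
  · rw [h2, finrank_top, finrank_euclideanSpace_fin] at h1
    omega

/-- The standard quadratic invariant. -/
def sqNorm (n : ℕ) : S n := ∑ i, X i ^ 2

/-- A root is an eigenvector of every invariant bilinear form. -/
theorem exists_eq_smul_sqNorm (hn : 2 ≤ n) (hgen : Subgroup.closure (reflections W) = W)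
    (hirr : ∀ U : Submodule ℝ (E n), (∀ w ∈ W, ∀ u ∈ U, w u ∈ U) → U = ⊥ ∨ U = ⊤) {q : S n}
    (hq : q ∈ invariants W) (hd : q.IsHomogeneous 2) : ∃ a : ℂ, q = a • sqNorm n := by
  obtain ⟨s⟩ := exists_reflection hn hgen hirr
  set α := root s
  have hα : α ≠ 0 := root_ne_zero s
  let B : E n → E n → ℂ := fun u v => constantCoeff (dirDeriv u (dirDeriv v q))
  have hB : ∀ w ∈ W, ∀ u v, B (w u) (w v) = B u v := fun w hw u v =>
    constantCoeff_dirDeriv_dirDeriv_apply (hq w hw) u v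
  have hadd : ∀ u u' v, B (u + u') v = B u v + B u' v := fun u u' v => by
    simp only [B, dirDeriv_add, map_add]
  have hsmul : ∀ (a : ℝ) u v, B (a • u) v = a * B u v := fun a u v => by
    simp only [B, dirDeriv_smul, smul_eq_C_mul, map_mul, constantCoeff_C]
  have hadd' : ∀ u v v', B u (v + v') = B u v + B u v' := fun u u' v => by
    simp only [B, dirDeriv_add, map_add]
  have hsmul' : ∀ (a : ℝ) u v, B u (a • v) = a * B u v := fun a u v => by
    simp only [B, dirDeriv_smul]
    rw [Derivation.map_smul, smul_eq_C_mul, map_mul, constantCoeff_C]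
  have hrefl : ∀ v, B α v = (B α α / 2) * (reflCoeff α v : ℝ) := by
    intro v
    have h1 := hB s s.2.1 α v
    have h2 : (s : E n ≃ₗᵢ[ℝ] E n) α = (-1 : ℝ) • α := by
      rw [eq_reflection_root s, reflection_self hα, neg_one_smul]
    have h3 : (s : E n ≃ₗᵢ[ℝ] E n) v = v + (-reflCoeff α v) • α := by
      rw [refl_apply, neg_smul, sub_eq_add_neg]
    rw [h2, h3, hsmul, hadd', hsmul'] at h1
    push_cast at h1
    linear_combination (-1 / 2 : ℂ) * h1
  obtain ⟨a, ha⟩ : ∃ a : ℂ, ∀ v, B α v = a * (inner ℝ α v : ℝ) := by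
    refine ⟨(B α α / 2) * (2 / ‖α‖ ^ 2 : ℝ), fun v => ?_⟩
    rw [hrefl, reflCoeff]
    push_cast
    ring
  -- The vectors on which the form `B` is `a` times the inner product form an invariant subspace
  -- containing the root. The root is available because the reflection forces `B α v` to be
  -- proportional to `⟨α, v⟩`, which also works for a complex-valued form.
  let U : Submodule ℝ (E n) :=
    { carrier := {u | ∀ v, B u v = a * (inner ℝ u v : ℝ)}
      add_mem' := fun {u u'} hu hu' v => by
        rw [hadd, hu, hu', inner_add_left]; push_cast; ring
      zero_mem' := fun v => by
        have := hsmul 0 0 v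
        rw [zero_smul] at this
        rw [this, inner_zero_left]; simp
      smul_mem' := fun b u hu v => by
        rw [hsmul, hu, real_inner_smul_left]; push_cast; ring }
  have hU : U = ⊤ := by
    refine (hirr U fun w hw u hu v => ?_).resolve_left fun h => ?_
    · have h1 := hB w hw u (w.symm v)
      have h2 := w.inner_map_map u (w.symm v)
      rw [LinearIsometryEquiv.apply_symm_apply] at h1 h2
      rw [h1, h2, hu]
    · have : α ∈ U := ha
      rw [h, Submodule.mem_bot] at this
      exact hα this
  have hBa : ∀ u v, B u v = a * (inner ℝ u v : ℝ) := fun u v => by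
    have : u ∈ U := hU ▸ Submodule.mem_top
    exact this v
  have h2 : ∀ i j, pderiv j (pderiv i q) = C (if i = j then a else 0) := by
    intro i j
    rw [eq_C_of_isHomogeneous_zero (hd.pderiv (i := i)).pderiv, ← dirDeriv_single, ← dirDeriv_single]
    change C (B _ _) = _
    rw [hBa, EuclideanSpace.inner_single_left]
    congr 1
    by_cases h : i = j
    · simp [h]
    · simp [h, Ne.symm h]
  have h3 : ∀ i, pderiv i q = C a * X i := by
    intro i
    have h1 := (hd.pderiv (i := i)).sum_X_mul_pderiv
    rw [Finset.sum_eq_single i (fun j _ hj => by rw [h2, if_neg (Ne.symm hj), C_0, mul_zero])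
      (by simp), h2, if_pos rfl] at h1
    rw [mul_comm, h1]
    simp
  refine ⟨a / 2, ?_⟩
  have h4 := hd.sum_X_mul_pderiv
  simp only [h3] at h4
  have h5 : (2 : ℂ) • q = a • sqNorm n := by
    rw [sqNorm, Finset.smul_sum, ofNat_smul_eq_nsmul, ← h4]
    refine Finset.sum_congr rfl fun i _ => ?_
    rw [smul_eq_C_mul]
    ring
  rw [div_eq_inv_mul, mul_smul, ← h5, smul_smul, inv_mul_cancel₀ two_ne_zero, one_smul]

theorem isomMatrix_mul_transpose (w : E n ≃ₗᵢ[ℝ] E n) :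
    isomMatrix w * (isomMatrix w).transpose = 1 := by
  ext i j
  have h := ((EuclideanSpace.basisFun (Fin n) ℝ).map w).sum_inner_mul_inner
    (EuclideanSpace.single i 1) (EuclideanSpace.single j 1)
  rw [Matrix.mul_apply, Matrix.one_apply]
  simp only [OrthonormalBasis.map_apply, EuclideanSpace.basisFun_apply,
    EuclideanSpace.inner_single_left, EuclideanSpace.inner_single_right] at h
  simp only [isomMatrix, Matrix.transpose_apply, Matrix.of_apply, ← Complex.ofReal_mul,
    ← Complex.ofReal_sum]
  simp only [map_one, one_mul, conj_trivial] at h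
  rw [h]
  by_cases hij : i = j
  · simp [hij]
  · simp [hij]

theorem sqNorm_mem_invariants : sqNorm n ∈ invariants W := by
  intro w _
  have h : ∀ i, act w (X i : S n) = ∑ j, C (isomMatrix w j i) * X j := fun i => by
    rw [act_X]; rfl
  have h1 : ∀ j k, ∑ i, isomMatrix w j i * isomMatrix w k i = if j = k then 1 else 0 := by
    intro j k
    rw [← Matrix.one_apply, ← isomMatrix_mul_transpose w, Matrix.mul_apply]
    rfl
  simp only [sqNorm, map_sum, sq, map_mul, h, Finset.sum_mul_sum]
  rw [Finset.sum_comm]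
  refine Finset.sum_congr rfl fun j _ => ?_
  rw [Finset.sum_comm, Finset.sum_eq_single j]
  · have h2 : ∀ i, C (isomMatrix w j i) * X j * (C (isomMatrix w j i) * X j) =
        C (isomMatrix w j i * isomMatrix w j i) * (X j * X j : S n) := fun i => by
      rw [C_mul]; ring
    simp only [h2]
    rw [← Finset.sum_mul, ← map_sum, h1, if_pos rfl, C_1, one_mul]
  · intro k _ hk
    have h2 : ∀ i, C (isomMatrix w j i) * X j * (C (isomMatrix w k i) * X k) =
        C (isomMatrix w j i * isomMatrix w k i) * (X j * X k : S n) := fun i => by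
      rw [C_mul]; ring
    simp only [h2]
    rw [← Finset.sum_mul, ← map_sum, h1, if_neg (Ne.symm hk), C_0, zero_mul]
  · simp

theorem sqNorm_isHomogeneous : (sqNorm n).IsHomogeneous 2 :=
  IsHomogeneous.sum _ _ _ fun i _ => (isHomogeneous_X ℂ i).pow 2

theorem sqNorm_ne_zero (hn : 0 < n) : sqNorm n ≠ 0 := by
  intro h
  have h1 := congrArg (eval (Pi.single (⟨0, hn⟩ : Fin n) (1 : ℂ))) h
  rw [sqNorm, map_sum, Finset.sum_eq_single ⟨0, hn⟩ (fun j _ hj => by simp [hj]) (by simp)] at h1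
  simp at h1

variable {d : Fin n → ℕ} {f : Fin n → S n}

/-- The quadratic form is a nonzero invariant of degree `2`, which could not be a polynomial in
generators of larger degrees. -/
theorem IsElementaryInvariants.exists_degree_le_two (hf : IsElementaryInvariants W d f)
    (hn : 0 < n) : ∃ i, d i ≤ 2 := by
  by_contra! h
  obtain ⟨P, hP, hPq⟩ := hf.exists_aeval_isWeightedHomogeneous (sqNorm_mem_invariants (W := W))
    sqNorm_isHomogeneous
  refine sqNorm_ne_zero hn ?_
  have : P = 0 := by
    ext m
    by_contra hm
    have h1 : Finsupp.weight d m = 2 := hP hm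
    by_cases h0 : m = 0
    · rw [h0, map_zero] at h1; omega
    · obtain ⟨i, hi⟩ := DFunLike.ne_iff.1 h0
      have h3 : m i ≠ 0 := hi
      have h4 := Finsupp.le_weight_of_ne_zero (w := d) (fun _ => Nat.zero_le _) h3
      have := h i
      omega
  rw [← hPq, this, map_zero]

theorem IsElementaryInvariants.two_le_degree (hf : IsElementaryInvariants W d f) (hn : 2 ≤ n)
    (hirr : ∀ U : Submodule ℝ (E n), (∀ w ∈ W, ∀ u ∈ U, w u ∈ U) → U = ⊥ ∨ U = ⊤)
    (hpos : ∀ i, 0 < d i) (i : Fin n) : 2 ≤ d i := by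
  by_contra h
  have h1 : d i = 1 := by have := hpos i; omega
  exact hf.algebraicIndependent.ne_zero i
    (eq_zero_of_isHomogeneous_one hn hirr (hf.mem i) (h1 ▸ hf.homogeneous i))

/-- Two quadratic generators would both be multiples of `sqNorm n`, hence linearly dependent. -/
theorem IsElementaryInvariants.eq_of_degree_eq_two (hf : IsElementaryInvariants W d f) (hn : 2 ≤ n)
    (hgen : Subgroup.closure (reflections W) = W)
    (hirr : ∀ U : Submodule ℝ (E n), (∀ w ∈ W, ∀ u ∈ U, w u ∈ U) → U = ⊥ ∨ U = ⊤)
    {i j : Fin n} (hi : d i = 2) (hj : d j = 2) : i = j := by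
  by_contra hij
  obtain ⟨a, ha⟩ := exists_eq_smul_sqNorm hn hgen hirr (hf.mem i) (hi ▸ hf.homogeneous i)
  obtain ⟨b, hb⟩ := exists_eq_smul_sqNorm hn hgen hirr (hf.mem j) (hj ▸ hf.homogeneous j)
  have h1 : aeval f (C b * X i - C a * X j : MvPolynomial (Fin n) ℂ) = 0 := by
    rw [map_sub, map_mul, map_mul, aeval_X, aeval_X, ha, hb, aeval_C, aeval_C, smul_eq_C_mul,
      smul_eq_C_mul]
    simp only [algebraMap_eq]
    ring
  have h2 := hf.algebraicIndependent.eq_zero_of_aeval_eq_zero _ h1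
  have h3 := congrArg (coeff (Finsupp.single j 1)) h2
  rw [coeff_sub, coeff_C_mul, coeff_C_mul, coeff_X, coeff_X, if_neg, mul_zero, zero_sub, if_pos rfl,
    mul_one, coeff_zero, neg_eq_zero] at h3
  · exact hf.algebraicIndependent.ne_zero i (by rw [ha, h3, zero_smul])
  · rw [Finsupp.single_left_inj one_ne_zero]
    exact hij

end LowDegree

end CherednikQH

end

noncomputable section

namespace CherednikQH

open MvPolynomial

/-! ### Degrees and regular eigenvectors -/

section RegularEigenvector

variable {n : ℕ} {W : Subgroup (E n ≃ₗᵢ[ℝ] E n)} {d : Fin n → ℕ} {f : Fin n → S n}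

/-- `v` is an eigenvector of `g`, with eigenvalue `ζ`, under the contragredient action. -/
def IsEigenvector (g : E n ≃ₗᵢ[ℝ] E n) (ζ : ℂ) (v : Fin n → ℂ) : Prop :=
  ∀ q : S n, eval v (act g q) = eval (ζ • v) q

theorem eval_smul_of_isHomogeneous {q : S n} {k : ℕ} (hq : q.IsHomogeneous k) (ζ : ℂ)
    (v : Fin n → ℂ) : eval (ζ • v) q = ζ ^ k * eval v q := by
  rw [eval_eq, eval_eq, Finset.mul_sum]
  refine Finset.sum_congr rfl fun m hm => ?_
  have h : ∑ i ∈ m.support, m i = k := (hq.degree_eq_sum_deg_support hm).symm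
  simp only [Pi.smul_apply, smul_eq_mul, mul_pow, Finset.prod_mul_distrib]
  rw [Finset.prod_pow_eq_pow_sum, h]
  ring

theorem IsEigenvector.pow {g : E n ≃ₗᵢ[ℝ] E n} {ζ : ℂ} {v : Fin n → ℂ} (h : IsEigenvector g ζ v)
    (k : ℕ) : IsEigenvector (g ^ k) (ζ ^ k) v := by
  induction k with
  | zero => intro q; rw [pow_zero, pow_zero, one_smul, act_one_apply]
  | succ k ih =>
    intro q
    have h1 : ∀ q : S n, eval (ζ ^ k • v) (act g q) = eval (ζ ^ k • ζ • v) q := by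
      intro q
      rw [← sum_homogeneousComponent q, map_sum, map_sum, map_sum]
      refine Finset.sum_congr rfl fun j _ => ?_
      have hj := homogeneousComponent_isHomogeneous j q
      rw [eval_smul_of_isHomogeneous (act_isHomogeneous g hj), eval_smul_of_isHomogeneous hj, h]
    rw [pow_succ, act_mul_apply, ih, h1, smul_smul, pow_succ]

theorem eval_jacobian_mul {w : E n ≃ₗᵢ[ℝ] E n} (hw : w ∈ W) (hf : ∀ i, f i ∈ invariants W)
    {v : Fin n → ℂ} (hv : IsEigenvector w 1 v) :
    (jacobian f).map (eval v) * isomMatrix w = (jacobian f).map (eval v) := by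
  have h := congrArg (fun M : Matrix (Fin n) (Fin n) (S n) => M.map (eval v))
    (map_act_jacobian hf hw)
  rw [Matrix.map_mul, Matrix.map_map, Matrix.map_map] at h
  have h1 : (isomMatrix w).map (eval v ∘ C) = isomMatrix w := by
    ext i j
    simp
  rw [h1] at h
  rw [← h]
  ext i j
  have := hv (jacobian f i j)
  rw [one_smul] at this
  exact this

theorem eq_one_of_isomMatrix_eq_one {w : E n ≃ₗᵢ[ℝ] E n} (h : isomMatrix w = 1) : w = 1 := by
  have h1 : ∀ i, w (EuclideanSpace.single i 1) = EuclideanSpace.single i 1 := by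
    intro i
    ext j
    have h2 := congrFun (congrFun h j) i
    rw [isomMatrix, Matrix.of_apply, Matrix.one_apply] at h2
    have h3 : w (EuclideanSpace.single i 1) j = if j = i then 1 else 0 := by
      split_ifs at h2 ⊢ <;> exact_mod_cast h2
    rw [h3]
    simp
  ext v : 1
  rw [eq_sum_single v, map_sum]
  refine (Finset.sum_congr rfl fun i _ => ?_)
  rw [map_smul, h1]

/-- At a fixed point `v` the transformation law of the Jacobian matrix becomes `J(v) * w = J(v)`,
and `J(v)` can be cancelled. -/
theorem eq_one_of_isEigenvector_one {w : E n ≃ₗᵢ[ℝ] E n} (hw : w ∈ W)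
    (hf : ∀ i, f i ∈ invariants W) {v : Fin n → ℂ} (hv : IsEigenvector w 1 v)
    (hJ : ((jacobian f).map (eval v)).det ≠ 0) : w = 1 := by
  refine eq_one_of_isomMatrix_eq_one ?_
  have hu : IsUnit ((jacobian f).map (eval v)) :=
    (Matrix.isUnit_iff_isUnit_det _).2 (isUnit_iff_ne_zero.2 hJ)
  refine hu.mul_left_cancel ?_
  rw [eval_jacobian_mul hw hf hv, mul_one]

/-- The Gram matrix of the differentials of the elementary invariants. -/
theorem jacobian_mul_transpose_mem (hf : ∀ i, f i ∈ invariants W) (i j : Fin n) :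
    (jacobian f * (jacobian f).transpose) i j ∈ invariants W := by
  intro w hw
  have h1 : (jacobian f * (jacobian f).transpose).map (act w) =
      jacobian f * (jacobian f).transpose := by
    have h2 : (isomMatrix w).map (C : ℂ → S n) * ((isomMatrix w).map (C : ℂ → S n)).transpose =
        1 := by
      rw [← Matrix.transpose_map, ← Matrix.map_mul, isomMatrix_mul_transpose,
        Matrix.map_one _ C_0 C_1]
    rw [Matrix.map_mul, Matrix.transpose_map, map_act_jacobian hf hw, Matrix.transpose_mul,
      Matrix.mul_assoc, ← Matrix.mul_assoc _ _ (jacobian f).transpose, h2, Matrix.one_mul]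
  exact congrFun (congrFun h1 i) j

theorem jacobian_mul_transpose_isHomogeneous (hf : ∀ i, (f i).IsHomogeneous (d i)) (i j : Fin n) :
    ((jacobian f * (jacobian f).transpose) i j).IsHomogeneous ((d i - 1) + (d j - 1)) := by
  rw [Matrix.mul_apply]
  exact IsHomogeneous.sum _ _ _ fun k _ => (hf i).pderiv.mul (hf j).pderiv

/-- The Gram matrix `J * Jᵀ` has invariant homogeneous entries and is invertible at `v`, so some
term of its determinant has all factors nonzero at `v`. An invariant of degree `m` not vanishing at
`v` forces `ζ ^ m = 1`; then `g ^ m` fixes `v` and is trivial. -/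
theorem exists_perm_orderOf_dvd {g : E n ≃ₗᵢ[ℝ] E n} (hg : g ∈ W)
    (hf : ∀ i, f i ∈ invariants W) (hd : ∀ i, (f i).IsHomogeneous (d i)) {ζ : ℂ} {v : Fin n → ℂ}
    (hv : IsEigenvector g ζ v) (hJ : ((jacobian f).map (eval v)).det ≠ 0) :
    ∃ σ : Equiv.Perm (Fin n), ∀ i, orderOf g ∣ (d (σ i) - 1) + (d i - 1) := by
  have hdet : ((jacobian f * (jacobian f).transpose).map (eval v)).det ≠ 0 := by
    rw [Matrix.map_mul, Matrix.transpose_map, Matrix.det_mul, Matrix.det_transpose]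
    exact mul_ne_zero hJ hJ
  rw [Matrix.det_apply] at hdet
  obtain ⟨σ, _, hσ⟩ := Finset.exists_ne_zero_of_sum_ne_zero hdet
  refine ⟨σ, fun i => orderOf_dvd_of_pow_eq_one ?_⟩
  have h1 : eval v ((jacobian f * (jacobian f).transpose) (σ i) i) ≠ 0 := by
    intro h0
    refine hσ ?_
    rw [Finset.prod_eq_zero (Finset.mem_univ i) h0, smul_zero]
  have h2 := hv ((jacobian f * (jacobian f).transpose) (σ i) i)
  rw [jacobian_mul_transpose_mem hf _ _ g hg,
    eval_smul_of_isHomogeneous (jacobian_mul_transpose_isHomogeneous hd _ _)] at h2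
  have h3 : ζ ^ ((d (σ i) - 1) + (d i - 1)) = 1 :=
    mul_right_cancel₀ h1 (by rw [← h2, one_mul])
  have h4 := hv.pow ((d (σ i) - 1) + (d i - 1))
  rw [h3] at h4
  exact eq_one_of_isEigenvector_one (pow_mem hg _) hf h4 hJ

/-- A regular eigenvector of an element of sufficiently large order forces the largest degree to be
attained only once. -/
theorem exists_max_degree [Fintype W] [Fintype (reflections W)] (hn : 2 ≤ n)
    (hgen : Subgroup.closure (reflections W) = W)
    (hirr : ∀ U : Submodule ℝ (E n), (∀ w ∈ W, ∀ u ∈ U, w u ∈ U) → U = ⊥ ∨ U = ⊤)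
    (hf : IsMinimalGenerators W d f) (hsum : ∑ i, (d i - 1) = Fintype.card (reflections W))
    (hjac : ∃ a : ℂ, a ≠ 0 ∧ (jacobian f).det = C a * rootProduct W)
    {g : E n ≃ₗᵢ[ℝ] E n} (hg : g ∈ W) {ζ : ℂ} {v : Fin n → ℂ} (hv : IsEigenvector g ζ v)
    (hreg : ∀ s : reflections W, eval v (lin (root s)) ≠ 0)
    (hcard : 2 * Fintype.card (reflections W) ≤ n * orderOf g) :
    ∃ i₀, ∀ i ≠ i₀, d i < d i₀ := by
  have he := hf.isElementaryInvariants hgen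
  have hJ : ((jacobian f).map (eval v)).det ≠ 0 := by
    obtain ⟨a, ha, hJ⟩ := hjac
    have h1 : ((jacobian f).map (eval v)).det = eval v (jacobian f).det :=
      ((eval v).map_det _).symm
    rw [h1, hJ, map_mul, eval_C, rootProduct, map_prod]
    exact mul_ne_zero ha (Finset.prod_ne_zero_iff.2 fun s _ => hreg s)
  obtain ⟨σ, hσ⟩ := exists_perm_orderOf_dvd hg hf.mem hf.homogeneous hv hJ
  have h2 := he.two_le_degree hn hirr hf.pos
  -- Divisibility gives an inequality since all degrees are at least `2`. Summed over `i` the right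
  -- sides give twice the number of reflections, which by `hcard` is at most the sum of the left
  -- sides, so all inequalities are equalities.
  have hle : ∀ i, orderOf g ≤ (d (σ i) - 1) + (d i - 1) := fun i =>
    Nat.le_of_dvd (by have := h2 i; omega) (hσ i)
  have hsum2 : ∑ i, ((d (σ i) - 1) + (d i - 1)) ≤ ∑ _i : Fin n, orderOf g := by
    rw [Finset.sum_add_distrib, Equiv.sum_comp σ fun i => d i - 1, hsum, Finset.sum_const,
      Finset.card_univ, Fintype.card_fin, smul_eq_mul]
    omega
  have heq : ∀ i, orderOf g = (d (σ i) - 1) + (d i - 1) := fun i =>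
    (Finset.sum_eq_sum_iff_of_le fun i _ => hle i).1
      (le_antisymm (Finset.sum_le_sum fun i _ => hle i) hsum2) i (Finset.mem_univ i)
  -- `i₁` carries the least degree, so by the equalities `σ i₁` carries the largest; any other index
  -- carrying it would come from a second generator of degree `2`.
  obtain ⟨i₁, hi₁⟩ := he.exists_degree_le_two (by omega)
  refine ⟨σ i₁, fun i hi => ?_⟩
  obtain ⟨j, rfl⟩ := σ.surjective i
  have h3 : d j ≠ 2 := fun h3 => hi (by
    rw [he.eq_of_degree_eq_two hn hgen hirr h3 (le_antisymm hi₁ (h2 i₁))])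
  have := heq j
  have := heq i₁
  have := h2 j
  have := h2 (σ j)
  omega

end RegularEigenvector

end CherednikQH

end

noncomputable section

namespace CherednikQH

/-! ### Simple systems of roots -/

section SimpleSystem

open scoped NNReal

variable {V : Type*} [NormedAddCommGroup V] [InnerProductSpace ℝ V]

/-- A finite set of unit vectors which is stable under the reflections in its elements. -/
structure IsUnitRootSystem (Φ : Finset V) : Prop where
  inner_self : ∀ α ∈ Φ, inner ℝ α α = (1 : ℝ)
  refl_mem : ∀ α ∈ Φ, ∀ β ∈ Φ, β - (2 * inner ℝ α β : ℝ) • α ∈ Φ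

/-- `Δ` is the simple system of the positive system that `h` defines. -/
structure IsSimpleSystem (Φ : Finset V) (h : Module.Dual ℝ V) (Δ : Finset V) : Prop where
  ne_zero : ∀ α ∈ Φ, h α ≠ 0
  subset : Δ ⊆ Φ
  pos : ∀ α ∈ Δ, 0 < h α
  mem_span : ∀ β ∈ Φ, 0 < h β → β ∈ Submodule.span ℝ≥0 (Δ : Set V)
  inner_nonpos : ∀ α ∈ Δ, ∀ β ∈ Δ, α ≠ β → inner ℝ α β ≤ (0 : ℝ)
  linearIndepOn : LinearIndepOn ℝ id (Δ : Set V)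

theorem IsUnitRootSystem.neg_mem {Φ : Finset V} (hΦ : IsUnitRootSystem Φ) {α : V} (hα : α ∈ Φ) :
    -α ∈ Φ := by
  have := hΦ.refl_mem α hα α hα
  rw [hΦ.inner_self α hα] at this
  convert this using 1
  module

theorem nonneg_of_mem_span {Δ : Set V} {h : Module.Dual ℝ V} (hpos : ∀ α ∈ Δ, 0 < h α) {x : V}
    (hx : x ∈ Submodule.span ℝ≥0 Δ) : 0 ≤ h x := by
  induction hx using Submodule.span_induction with
  | mem x hx => exact (hpos x hx).le
  | zero => rw [map_zero]
  | add x y _ _ hx hy => rw [map_add]; exact add_nonneg hx hy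
  | smul a x _ hx =>
    rw [NNReal.smul_def, map_smul]
    exact mul_nonneg a.2 hx

theorem smul_mem_span {Δ : Set V} {a : ℝ} (ha : 0 ≤ a) {x : V}
    (hx : x ∈ Submodule.span ℝ≥0 Δ) : a • x ∈ Submodule.span ℝ≥0 Δ :=
  Submodule.smul_mem _ (⟨a, ha⟩ : ℝ≥0) hx

theorem mem_span_of_smul_mem {Δ : Set V} {h : Module.Dual ℝ V} {α : V} (hα : 0 < h α) {a : ℝ}
    (hx : a • α ∈ Submodule.span ℝ≥0 Δ) (hpos : 0 < h (a • α)) : α ∈ Submodule.span ℝ≥0 Δ := by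
  rw [map_smul, smul_eq_mul, mul_pos_iff_of_pos_right hα] at hpos
  have := smul_mem_span (inv_nonneg.2 hpos.le) hx
  rwa [smul_smul, inv_mul_cancel₀ hpos.ne', one_smul] at this

theorem exists_eq_smul_add_of_mem_span [DecidableEq V] {Δ : Finset V} {α x : V} (hα : α ∈ Δ)
    (hx : x ∈ Submodule.span ℝ≥0 (Δ : Set V)) :
    ∃ a : ℝ, 0 ≤ a ∧ ∃ z ∈ Submodule.span ℝ≥0 (Δ.erase α : Set V), x = a • α + z := by
  rw [← Finset.insert_erase hα, Finset.coe_insert, Submodule.mem_span_insert] at hx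
  obtain ⟨a, z, hz, rfl⟩ := hx
  exact ⟨a, a.2, z, hz, rfl⟩

theorem exists_coeff_of_mem_span {Δ : Finset V} {x : V}
    (hx : x ∈ Submodule.span ℝ≥0 (Δ : Set V)) :
    ∃ c : V → ℝ, (∀ α, 0 ≤ c α) ∧ x = ∑ α ∈ Δ, c α • α := by
  obtain ⟨c, _, rfl⟩ := Submodule.mem_span_finset.1 hx
  exact ⟨fun α => c α, fun α => (c α).2, rfl⟩

/-- Vectors on one side of a hyperplane with pairwise obtuse angles are linearly independent. -/
theorem linearIndepOn_of_inner_nonpos {Δ : Finset V} {h : Module.Dual ℝ V}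
    (hpos : ∀ α ∈ Δ, 0 < h α) (hΔ : ∀ α ∈ Δ, ∀ β ∈ Δ, α ≠ β → inner ℝ α β ≤ (0 : ℝ)) :
    LinearIndepOn ℝ id (Δ : Set V) := by
  rw [linearIndepOn_finset_iff]
  intro f hf
  have h1 : ∀ α, f α = max (f α) 0 - max (-f α) 0 := fun α => by
    rcases le_total (f α) 0 with h | h <;> simp [h]
  have h2 : ∀ α, max (f α) 0 * max (-f α) 0 = 0 := fun α => by
    rcases le_total (f α) 0 with h | h <;> simp [h]
  set x := ∑ α ∈ Δ, max (f α) 0 • α with hx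
  have hxy : x = ∑ α ∈ Δ, max (-f α) 0 • α := by
    rw [← sub_eq_zero, hx, ← Finset.sum_sub_distrib, ← hf]
    refine Finset.sum_congr rfl fun α _ => ?_
    rw [← sub_smul, ← h1]
    rfl
  -- `x` is the positive part of the relation and equals its negative part. Their supports are
  -- disjoint, so `⟨x, x⟩` expands into nonpositive terms only.
  have hx0 : x = 0 := by
    refine real_inner_self_nonpos.1 ?_
    nth_rewrite 1 [hxy]
    rw [hx]
    simp only [sum_inner, inner_sum, real_inner_smul_left, real_inner_smul_right]
    refine Finset.sum_nonpos fun α hα => Finset.sum_nonpos fun β hβ => ?_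
    rcases eq_or_ne α β with rfl | hne
    · rw [← mul_assoc, h2, zero_mul]
    · exact mul_nonpos_of_nonneg_of_nonpos (le_max_right _ _)
        (mul_nonpos_of_nonneg_of_nonpos (le_max_right _ _) (hΔ _ hβ _ hα hne.symm))
  have h3 : ∀ c : V → ℝ, (∀ α, 0 ≤ c α) → ∑ α ∈ Δ, c α • α = 0 → ∀ α ∈ Δ, c α = 0 := by
    intro c hc hc0 α hα
    have h4 := congrArg h hc0
    simp only [map_sum, map_smul, smul_eq_mul, map_zero] at h4
    have h5 := (Finset.sum_eq_zero_iff_of_nonneg fun β hβ =>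
      mul_nonneg (hc β) (hpos β hβ).le).1 h4 α hα
    exact (mul_eq_zero.1 h5).resolve_right (hpos α hα).ne'
  intro α hα
  rw [h1, h3 _ (fun α => le_max_right _ _) hx0 α hα,
    h3 (fun α => max (-f α) 0) (fun α => le_max_right _ _) (hxy.symm.trans hx0) α hα, sub_zero]

/-- If `k = 2⟨α, β⟩` were positive, the root `β - k α` or its negative would lie in the cone of `Δ`.
Solving for `α` or for `β`, with `h` controlling the sign of the coefficient, makes one of them
redundant. -/
theorem inner_nonpos_of_minimal [DecidableEq V] {Φ Δ : Finset V} {h : Module.Dual ℝ V}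
    (hΦ : IsUnitRootSystem Φ) (hne : ∀ α ∈ Φ, h α ≠ 0) (hsub : Δ ⊆ Φ) (hpos : ∀ α ∈ Δ, 0 < h α)
    (hmem : ∀ β ∈ Φ, 0 < h β → β ∈ Submodule.span ℝ≥0 (Δ : Set V))
    (hmin : ∀ α ∈ Δ, α ∉ Submodule.span ℝ≥0 (Δ.erase α : Set V)) {α β : V} (hα : α ∈ Δ)
    (hβ : β ∈ Δ) (hαβ : α ≠ β) : inner ℝ α β ≤ (0 : ℝ) := by
  by_contra! hc
  have hpos' : ∀ γ, ∀ δ ∈ (Δ.erase γ : Set V), 0 < h δ := fun γ δ hδ =>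
    hpos δ (Finset.mem_of_mem_erase hδ)
  have hγ := hΦ.refl_mem α (hsub hα) β (hsub hβ)
  set k : ℝ := 2 * inner ℝ α β with hk
  have hk0 : 0 < k := by positivity
  rcases lt_or_gt_of_ne (hne _ hγ) with h1 | h1
  · have h2 := hmem _ (hΦ.neg_mem hγ) (by rw [map_neg]; linarith)
    obtain ⟨a, ha, z, hz, h3⟩ := exists_eq_smul_add_of_mem_span hα h2
    have h4 : (k - a) • α = β + z := by
      rw [sub_smul, sub_eq_iff_eq_add, add_assoc, add_comm z, ← h3]
      abel
    refine hmin α hα (mem_span_of_smul_mem (hpos α hα) (a := k - a) ?_ ?_)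
    · rw [h4]
      exact add_mem (Submodule.subset_span (Finset.mem_erase.2 ⟨hαβ.symm, hβ⟩)) hz
    · rw [h4, map_add]
      exact add_pos_of_pos_of_nonneg (hpos β hβ) (nonneg_of_mem_span (hpos' α) hz)
  · obtain ⟨a, ha, z, hz, h3⟩ := exists_eq_smul_add_of_mem_span hβ (hmem _ hγ h1)
    have h4 : (1 - a) • β = k • α + z := by
      rw [sub_smul, one_smul, sub_eq_iff_eq_add, add_assoc, add_comm z, ← h3]
      abel
    refine hmin β hβ (mem_span_of_smul_mem (hpos β hβ) (a := 1 - a) ?_ ?_)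
    · rw [h4]
      exact add_mem (smul_mem_span hk0.le
        (Submodule.subset_span (Finset.mem_erase.2 ⟨hαβ, hα⟩))) hz
    · rw [h4, map_add, map_smul]
      exact add_pos_of_pos_of_nonneg (mul_pos hk0 (hpos α hα)) (nonneg_of_mem_span (hpos' β) hz)

theorem exists_isSimpleSystem {Φ : Finset V} (hΦ : IsUnitRootSystem Φ) :
    ∃ h Δ, IsSimpleSystem Φ h Δ := by
  classical
  obtain ⟨h, hh⟩ : ∃ h : Module.Dual ℝ V, ∀ α : Φ, h α ≠ 0 := by
    refine Module.exists_dual_forall_apply_ne_zero (fun α : Φ => (α : V)) fun α h0 => ?_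
    have h1 := hΦ.inner_self α α.2
    rw [h0, inner_zero_left] at h1
    exact zero_ne_one h1
  have hne : ∀ α ∈ Φ, h α ≠ 0 := fun α hα => hh ⟨α, hα⟩
  -- The simple roots are a minimal set of positive roots that generates the cone of all of them.
  obtain ⟨Δ, ⟨hΔ, hmem⟩, hmin⟩ := WellFounded.has_min (wellFounded_lt (α := Finset V))
    {Δ | Δ ⊆ Φ.filter (fun α => 0 < h α) ∧
      ∀ β ∈ Φ, 0 < h β → β ∈ Submodule.span ℝ≥0 (Δ : Set V)}
    ⟨Φ.filter fun α => 0 < h α, subset_rfl, fun β hβ hβ0 =>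
      Submodule.subset_span (by simp [hβ, hβ0])⟩
  have hsub : Δ ⊆ Φ := fun α hα => (Finset.mem_filter.1 (hΔ hα)).1
  have hpos : ∀ α ∈ Δ, 0 < h α := fun α hα => (Finset.mem_filter.1 (hΔ hα)).2
  have hmin' : ∀ α ∈ Δ, α ∉ Submodule.span ℝ≥0 (Δ.erase α : Set V) := by
    intro α hα h1
    refine hmin (Δ.erase α) ⟨(Finset.erase_subset _ _).trans hΔ, fun β hβ hβ0 => ?_⟩
      (Finset.erase_ssubset hα)
    have h2 := hmem β hβ hβ0
    have h3 : Submodule.span ℝ≥0 (Δ : Set V) ≤ Submodule.span ℝ≥0 (Δ.erase α : Set V) := by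
      refine Submodule.span_le.2 fun γ hγ => ?_
      rcases eq_or_ne γ α with rfl | hne
      · exact h1
      · exact Submodule.subset_span (Finset.mem_erase.2 ⟨hne, hγ⟩)
    exact h3 h2
  have hobt : ∀ α ∈ Δ, ∀ β ∈ Δ, α ≠ β → inner ℝ α β ≤ (0 : ℝ) := fun α hα β hβ hαβ =>
    inner_nonpos_of_minimal hΦ hne hsub hpos hmem hmin' hα hβ hαβ
  exact ⟨h, Δ, hne, hsub, hpos, hmem, hobt, linearIndepOn_of_inner_nonpos hpos hobt⟩

end SimpleSystem

end CherednikQH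

end

noncomputable section

namespace CherednikQH

/-! ### Inversions and orbits of roots -/

section Inversions

open scoped NNReal

variable {V : Type*} [NormedAddCommGroup V] [InnerProductSpace ℝ V] {Φ Δ : Finset V}
  {h : Module.Dual ℝ V}

theorem isometry_mul_apply (g w : V ≃ₗᵢ[ℝ] V) (v : V) : (g * w) v = g (w v) := rfl

theorem IsSimpleSystem.coeff_eq (hΔ : IsSimpleSystem Φ h Δ) {b c : V → ℝ}
    (hbc : ∑ α ∈ Δ, b α • α = ∑ α ∈ Δ, c α • α) {α : V} (hα : α ∈ Δ) : b α = c α :=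
  linearIndepOn_finset_iffₛ.1 hΔ.linearIndepOn b c hbc α hα

theorem IsSimpleSystem.coeff_nonneg (hΔ : IsSimpleSystem Φ h Δ) {c : V → ℝ} {β : V} (hβ : β ∈ Φ)
    (hpos : 0 < h β) (hc : β = ∑ α ∈ Δ, c α • α) {α : V} (hα : α ∈ Δ) : 0 ≤ c α := by
  obtain ⟨b, hb, hβb⟩ := exists_coeff_of_mem_span (hΔ.mem_span β hβ hpos)
  rw [← hΔ.coeff_eq (hβb.symm.trans hc) hα]
  exact hb α

theorem IsSimpleSystem.coeff_nonpos (hΦ : IsUnitRootSystem Φ) (hΔ : IsSimpleSystem Φ h Δ)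
    {c : V → ℝ} {β : V} (hβ : β ∈ Φ) (hneg : h β < 0) (hc : β = ∑ α ∈ Δ, c α • α) {α : V}
    (hα : α ∈ Δ) : c α ≤ 0 := by
  have := hΔ.coeff_nonneg (c := -c) (hΦ.neg_mem hβ) (by rw [map_neg]; linarith)
    (by rw [hc]; simp) hα
  simpa using this

/-- The product of two simple reflections shows that an obtuse angle is at least `2π/3`. -/
theorem IsSimpleSystem.inner_le_neg_half (hΦ : IsUnitRootSystem Φ) (hΔ : IsSimpleSystem Φ h Δ)
    {α β : V} (hα : α ∈ Δ) (hβ : β ∈ Δ) (hne : inner ℝ α β ≠ (0 : ℝ)) (hαβ : α ≠ β) :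
    inner ℝ α β ≤ (-1 / 2 : ℝ) := by
  classical
  have hαΦ := hΔ.subset hα
  have hβΦ := hΔ.subset hβ
  set c : ℝ := inner ℝ α β with hc
  have hc0 : c < 0 := lt_of_le_of_ne (hΔ.inner_nonpos α hα β hβ hαβ) hne
  by_contra! hlt
  -- This root is the image of `α` under the reflection in `β` followed by that in `α`. For `-1/2 <
  -- c < 0` its two coefficients have opposite signs.
  have hγ : (4 * c ^ 2 - 1) • α + (-2 * c) • β ∈ Φ := by
    have h1 := hΦ.refl_mem α hαΦ _ (hΦ.refl_mem β hβΦ α hαΦ)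
    rw [inner_sub_right, real_inner_smul_right, hΦ.inner_self α hαΦ, real_inner_comm α β,
      ← hc] at h1
    convert h1 using 1
    module
  have hsum : (4 * c ^ 2 - 1) • α + (-2 * c) • β =
      ∑ δ ∈ Δ, (if δ = α then 4 * c ^ 2 - 1 else if δ = β then -2 * c else 0) • δ := by
    rw [← Finset.add_sum_erase Δ _ hα, if_pos rfl, Finset.sum_eq_single β, if_neg hαβ.symm,
      if_pos rfl]
    · intro δ hδ hδβ
      rw [if_neg (Finset.ne_of_mem_erase hδ), if_neg hδβ, zero_smul]
    · intro hβ'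
      exact absurd (Finset.mem_erase.2 ⟨hαβ.symm, hβ⟩) hβ'
  rcases lt_or_gt_of_ne (hΔ.ne_zero _ hγ) with h1 | h1
  · have := hΔ.coeff_nonpos hΦ hγ h1 hsum hβ
    rw [if_neg hαβ.symm, if_pos rfl] at this
    linarith
  · have := hΔ.coeff_nonneg hγ h1 hsum hα
    rw [if_pos rfl] at this
    nlinarith

/-- Reflection in `α` changes only the coefficient at `α`. If the image were negative, `β` would
have no other coefficient, and being of length one it would be `α`. -/
theorem IsSimpleSystem.refl_pos (hΦ : IsUnitRootSystem Φ) (hΔ : IsSimpleSystem Φ h Δ) {α β : V}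
    (hα : α ∈ Δ) (hβ : β ∈ Φ) (hpos : 0 < h β) (hne : β ≠ α) :
    0 < h (β - (2 * inner ℝ α β : ℝ) • α) := by
  classical
  obtain ⟨c, hc, hβc⟩ := exists_coeff_of_mem_span (hΔ.mem_span β hβ hpos)
  have hγ := hΦ.refl_mem α (hΔ.subset hα) β hβ
  by_contra! hle
  have hneg := lt_of_le_of_ne hle (hΔ.ne_zero _ hγ)
  set k : ℝ := 2 * inner ℝ α β
  have hsum : β - k • α = ∑ δ ∈ Δ, (c δ - if δ = α then k else 0) • δ := by
    simp only [sub_smul, ite_smul, zero_smul, Finset.sum_sub_distrib, Finset.sum_ite_eq', hα,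
      if_true]
    rw [← hβc]
  have h0 : ∀ δ ∈ Δ, δ ≠ α → c δ = 0 := fun δ hδ hδα => by
    have := hΔ.coeff_nonpos hΦ hγ hneg hsum hδ
    rw [if_neg hδα, sub_zero] at this
    exact le_antisymm this (hc δ)
  have h1 : β = c α • α := by
    rw [hβc, Finset.sum_eq_single_of_mem α hα fun δ hδ hδα => by rw [h0 δ hδ hδα, zero_smul]]
  have h2 := hΦ.inner_self β hβ
  rw [h1, real_inner_smul_left, real_inner_smul_right, hΦ.inner_self α (hΔ.subset hα)] at h2
  have h3 : c α = 1 := by nlinarith [hc α]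
  rw [h3, one_smul] at h1
  exact hne h1

/-- The number of positive roots which `g` makes negative. -/
def inversions (Φ : Finset V) (h : Module.Dual ℝ V) (g : V ≃ₗᵢ[ℝ] V) : ℕ :=
  (Φ.filter fun β => 0 < h β ∧ h (g β) < 0).card

/-- A simple reflection makes only its own root negative, so the only possible new inversion is the
preimage of `α` under `g`. -/
theorem inversions_refl_mul (hΦ : IsUnitRootSystem Φ) (hΔ : IsSimpleSystem Φ h Δ) {α : V}
    (hα : α ∈ Δ) {s g : V ≃ₗᵢ[ℝ] V} (hs : ∀ v, s v = v - (2 * inner ℝ α v : ℝ) • α)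
    (hg : ∀ β ∈ Φ, g β ∈ Φ) : inversions Φ h (s * g) ≤ inversions Φ h g + 1 := by
  classical
  refine (Finset.card_le_card (t := insert (g.symm α)
    (Φ.filter fun β => 0 < h β ∧ h (g β) < 0)) fun β hβ => ?_).trans (Finset.card_insert_le _ _)
  rw [Finset.mem_filter] at hβ
  obtain ⟨hβ, hpos, hneg⟩ := hβ
  rw [Finset.mem_insert, Finset.mem_filter]
  by_cases h1 : h (g β) < 0
  · exact Or.inr ⟨hβ, hpos, h1⟩
  · left
    by_contra hne
    have h2 := hΔ.refl_pos hΦ hα (hg β hβ)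
      (lt_of_le_of_ne (not_lt.1 h1) (hΔ.ne_zero _ (hg β hβ)).symm)
      fun h3 => hne (by rw [← h3, LinearIsometryEquiv.symm_apply_apply])
    rw [← hs] at h2
    exact lt_asymm h2 hneg

/-- The product of the reflections in pairwise orthogonal simple roots. -/
theorem exists_prod_refl (hΦ : IsUnitRootSystem Φ) (hΔ : IsSimpleSystem Φ h Δ)
    {G : Subgroup (V ≃ₗᵢ[ℝ] V)} (hG : ∀ w ∈ G, ∀ β ∈ Φ, w β ∈ Φ)
    (hrefl : ∀ α ∈ Φ, ∃ s ∈ G, ∀ v, s v = v - (2 * inner ℝ α v : ℝ) • α) {I : Finset V}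
    (hI : I ⊆ Δ) (horth : ∀ α ∈ I, ∀ β ∈ I, α ≠ β → inner ℝ α β = (0 : ℝ)) :
    ∃ w ∈ G, (∀ v, w v = v - ∑ α ∈ I, (2 * inner ℝ α v : ℝ) • α) ∧
      ∀ g ∈ G, inversions Φ h (w * g) ≤ inversions Φ h g + I.card := by
  classical
  induction I using Finset.induction_on with
  | empty => exact ⟨1, one_mem _, by simp, by simp⟩
  | insert α I hα ih =>
    obtain ⟨w, hw, hwv, hinv⟩ := ih ((Finset.subset_insert _ _).trans hI) fun β hβ γ hγ =>
      horth β (Finset.mem_insert_of_mem hβ) γ (Finset.mem_insert_of_mem hγ)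
    obtain ⟨s, hs, hsv⟩ := hrefl α (hΔ.subset (hI (Finset.mem_insert_self _ _)))
    refine ⟨s * w, mul_mem hs hw, fun v => ?_, fun g hg => ?_⟩
    · have h1 : inner ℝ α (w v) = (inner ℝ α v : ℝ) := by
        rw [hwv, inner_sub_right, inner_sum, Finset.sum_eq_zero fun β hβ => ?_, sub_zero]
        rw [real_inner_smul_right, horth α (Finset.mem_insert_self _ _) β
          (Finset.mem_insert_of_mem hβ) (by rintro rfl; exact hα hβ), mul_zero]
      rw [isometry_mul_apply, hsv, h1, hwv, Finset.sum_insert hα]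
      abel
    · rw [mul_assoc, Finset.card_insert_of_notMem hα]
      have h1 := inversions_refl_mul hΦ hΔ (hI (Finset.mem_insert_self _ _)) hsv
        (hG (w * g) (mul_mem hw hg))
      have h2 := hinv g hg
      omega

/-- Each orbit of an element without fixed vectors on the roots passes from the positive to the
negative roots. -/
theorem exists_pow_inversion (hΔ : IsSimpleSystem Φ h Δ) {g : V ≃ₗᵢ[ℝ] V}
    (hg : ∀ k : ℕ, ∀ β ∈ Φ, (g ^ k) β ∈ Φ) (hfix : ∀ v, g v = v → v = 0) (hord : 0 < orderOf g)
    {β : V} (hβ : β ∈ Φ) :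
    ∃ k < orderOf g, 0 < h ((g ^ k) β) ∧ h ((g ^ (k + 1)) β) < 0 := by
  set m := orderOf g
  -- The sum over a full period is fixed by `g`. Hence `h` has both signs along the orbit of a root,
  -- and somewhere changes from positive to negative.
  have hsum : ∀ v, ∑ k ∈ Finset.range m, (g ^ k) v = 0 := by
    intro v
    refine hfix _ ?_
    rw [map_sum]
    have h1 : ∀ k, g ((g ^ k) v) = (g ^ (k + 1)) v := fun k => by rw [pow_succ']; rfl
    simp only [h1]
    have h2 := Finset.sum_range_succ' (fun k => (g ^ k) v) m
    rw [Finset.sum_range_succ, pow_orderOf_eq_one, pow_zero] at h2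
    exact (add_right_cancel h2).symm
  have hsum' : ∀ v, ∑ k ∈ Finset.range m, h ((g ^ k) v) = 0 := fun v => by
    rw [← map_sum, hsum, map_zero]
  obtain ⟨k₀, hk₀⟩ : ∃ k, 0 < h ((g ^ k) β) := by
    by_contra! hle
    have := Finset.sum_lt_sum_of_nonempty (Finset.nonempty_range_iff.2 hord.ne')
      (f := fun k => h ((g ^ k) β)) (g := fun _ => 0)
      fun k _ => lt_of_le_of_ne (hle k) (hΔ.ne_zero _ (hg k β hβ))
    rw [hsum', Finset.sum_const_zero] at this
    exact lt_irrefl _ this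
  obtain ⟨k, hk, hk'⟩ : ∃ k, 0 < h ((g ^ k) β) ∧ h ((g ^ (k + 1)) β) < 0 := by
    by_contra! hstep
    have h1 : ∀ j, 0 < h ((g ^ j) ((g ^ k₀) β)) := by
      intro j
      rw [← isometry_mul_apply, ← pow_add]
      induction j with
      | zero => rwa [zero_add]
      | succ j ih =>
        rw [add_right_comm]
        exact lt_of_le_of_ne (hstep _ ih) (hΔ.ne_zero _ (hg _ β hβ)).symm
    have := Finset.sum_pos (s := Finset.range m) (fun j _ => h1 j)
      (Finset.nonempty_range_iff.2 hord.ne')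
    rw [hsum'] at this
    exact lt_irrefl _ this
  refine ⟨k % m, Nat.mod_lt _ hord, ?_, ?_⟩
  · rwa [pow_mod_orderOf]
  · rw [pow_succ, pow_mod_orderOf, ← pow_succ]
    exact hk'

/-- Every root arises from an inversion of `g` by the inverse of some `g ^ k` with `k` below the
order. -/
theorem card_le_orderOf_mul_inversions (hΔ : IsSimpleSystem Φ h Δ) {g : V ≃ₗᵢ[ℝ] V}
    (hg : ∀ k : ℕ, ∀ β ∈ Φ, (g ^ k) β ∈ Φ) (hfix : ∀ v, g v = v → v = 0)
    (hord : 0 < orderOf g) : Φ.card ≤ orderOf g * inversions Φ h g := by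
  classical
  have h1 : Φ ⊆ (Finset.range (orderOf g)).biUnion fun k =>
      (Φ.filter fun β => 0 < h β ∧ h (g β) < 0).image (g ^ k).symm := by
    intro β hβ
    obtain ⟨k, hk, hpos, hneg⟩ := exists_pow_inversion hΔ hg hfix hord hβ
    refine Finset.mem_biUnion.2 ⟨k, Finset.mem_range.2 hk, Finset.mem_image.2
      ⟨(g ^ k) β, Finset.mem_filter.2 ⟨hg k β hβ, hpos, ?_⟩, (g ^ k).symm_apply_apply β⟩⟩
    rw [← isometry_mul_apply, ← pow_succ']
    exact hneg
  refine (Finset.card_le_card h1).trans (Finset.card_biUnion_le.trans ?_)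
  refine (Finset.sum_le_sum fun k _ => Finset.card_image_le).trans ?_
  rw [Finset.sum_const, Finset.card_range, smul_eq_mul]
  rfl

/-- The simple roots of an irreducible root system do not split into orthogonal parts. -/
theorem IsSimpleSystem.not_orthogonal (hΦ : IsUnitRootSystem Φ) (hΔ : IsSimpleSystem Φ h Δ)
    (hirr : ∀ U : Submodule ℝ V, (∀ α ∈ Φ, ∀ u ∈ U, u - (2 * inner ℝ α u : ℝ) • α ∈ U) →
      U = ⊥ ∨ U = ⊤) {A B : Set V} (hAB : (Δ : Set V) = A ∪ B)
    (horth : ∀ α ∈ A, ∀ β ∈ B, inner ℝ α β = (0 : ℝ)) (hA : A.Nonempty) (hB : B.Nonempty) :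
    False := by
  classical
  have hAΔ : ∀ α ∈ A, α ∈ Δ := fun α hα => by
    have : α ∈ (Δ : Set V) := hAB ▸ Or.inl hα
    exact this
  have hBΔ : ∀ α ∈ B, α ∈ Δ := fun α hα => by
    have : α ∈ (Δ : Set V) := hAB ▸ Or.inr hα
    exact this
  have horth1 : ∀ x ∈ Submodule.span ℝ A, ∀ β ∈ B, inner ℝ x β = (0 : ℝ) := by
    intro x hx β hβ
    induction hx using Submodule.span_induction with
    | mem x hx => exact horth x hx β hβ
    | zero => rw [inner_zero_left]
    | add x y _ _ hx hy => rw [inner_add_left, hx, hy, add_zero]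
    | smul a x _ hx => rw [real_inner_smul_left, hx, mul_zero]
  have horth2 : ∀ x ∈ Submodule.span ℝ A, ∀ y ∈ Submodule.span ℝ B, inner ℝ x y = (0 : ℝ) := by
    intro x hx y hy
    induction hy using Submodule.span_induction with
    | mem y hy => exact horth1 x hx y hy
    | zero => rw [inner_zero_right]
    | add y z _ _ hy hz => rw [inner_add_right, hy, hz, add_zero]
    | smul a y _ hy => rw [real_inner_smul_right, hy, mul_zero]
  -- A counterexample `β` of least height has positive inner product with some simple root `δ`. Its
  -- reflection `γ` is a lower positive root, hence lies in one of the spans; `⟨γ, δ⟩ ≠ 0` then puts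
  -- `δ`, and so `β`, in the same span.
  have hsplit : ∀ β ∈ Φ, 0 < h β → β ∈ Submodule.span ℝ A ∨ β ∈ Submodule.span ℝ B := by
    by_contra! hcon
    obtain ⟨β₀, hβ₀, hβ₀pos, hβ₀A, hβ₀B⟩ := hcon
    obtain ⟨β, hβ, hmin⟩ := Finset.exists_min_image
      (Φ.filter fun β => 0 < h β ∧ β ∉ Submodule.span ℝ A ∧ β ∉ Submodule.span ℝ B) h
      ⟨β₀, Finset.mem_filter.2 ⟨hβ₀, hβ₀pos, hβ₀A, hβ₀B⟩⟩
    obtain ⟨hβ, hpos, hβA, hβB⟩ := Finset.mem_filter.1 hβ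
    obtain ⟨c, hc, hβc⟩ := exists_coeff_of_mem_span (hΔ.mem_span β hβ hpos)
    obtain ⟨δ, hδ, hδβ⟩ : ∃ δ ∈ Δ, 0 < (inner ℝ δ β : ℝ) := by
      by_contra! hle
      have h1 := hΦ.inner_self β hβ
      nth_rewrite 1 [hβc] at h1
      rw [sum_inner] at h1
      have h2 : ∑ δ ∈ Δ, inner ℝ (c δ • δ) β ≤ (0 : ℝ) := Finset.sum_nonpos fun δ hδ => by
        rw [real_inner_smul_left]
        exact mul_nonpos_of_nonneg_of_nonpos (hc δ) (hle δ hδ)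
      linarith
    have hne : β ≠ δ := by
      rintro rfl
      have : β ∈ A ∪ B := hAB ▸ hδ
      rcases this with h1 | h1
      · exact hβA (Submodule.subset_span h1)
      · exact hβB (Submodule.subset_span h1)
    have hγ := hΦ.refl_mem δ (hΔ.subset hδ) β hβ
    have hγpos := hΔ.refl_pos hΦ hδ hβ hpos hne
    set γ := β - (2 * inner ℝ δ β : ℝ) • δ with hγdef
    have hβγ : β = γ + (2 * inner ℝ δ β : ℝ) • δ := by rw [hγdef]; abel
    have hlt : h γ < h β := by
      rw [hγdef, map_sub, map_smul, smul_eq_mul, sub_lt_self_iff]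
      exact mul_pos (by positivity) (hΔ.pos δ hδ)
    have hγδ : inner ℝ γ δ = (-inner ℝ δ β : ℝ) := by
      rw [hγdef, inner_sub_left, real_inner_smul_left, hΦ.inner_self δ (hΔ.subset hδ),
        real_inner_comm δ β]
      ring
    have hγAB : γ ∈ Submodule.span ℝ A ∨ γ ∈ Submodule.span ℝ B := by
      by_contra! hcon
      exact absurd (hmin γ (Finset.mem_filter.2 ⟨hγ, hγpos, hcon⟩)) (not_le.2 hlt)
    have hδAB : δ ∈ A ∪ B := hAB ▸ hδ
    rcases hγAB with h1 | h1 <;> rcases hδAB with h2 | h2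
    · refine hβA ?_
      rw [hβγ]
      exact add_mem h1 (Submodule.smul_mem _ _ (Submodule.subset_span h2))
    · rw [horth1 γ h1 δ h2] at hγδ
      linarith
    · rw [real_inner_comm, horth2 δ (Submodule.subset_span h2) γ h1] at hγδ
      linarith
    · refine hβB ?_
      rw [hβγ]
      exact add_mem h1 (Submodule.smul_mem _ _ (Submodule.subset_span h2))
  have hsplit' : ∀ β ∈ Φ, β ∈ Submodule.span ℝ A ∨ β ∈ Submodule.span ℝ B := by
    intro β hβ
    rcases lt_or_gt_of_ne (hΔ.ne_zero β hβ) with h1 | h1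
    · have := hsplit (-β) (hΦ.neg_mem hβ) (by rw [map_neg]; linarith)
      rwa [Submodule.neg_mem_iff, Submodule.neg_mem_iff] at this
    · exact hsplit β hβ h1
  obtain ⟨a, ha⟩ := hA
  obtain ⟨b, hb⟩ := hB
  rcases hirr (Submodule.span ℝ A) fun α hα u hu => by
    rcases hsplit' α hα with h1 | h1
    · exact sub_mem hu (Submodule.smul_mem _ _ h1)
    · rw [real_inner_comm, horth2 u hu α h1, mul_zero, zero_smul, sub_zero]
      exact hu with h1 | h1
  · have h2 : a ∈ Submodule.span ℝ A := Submodule.subset_span ha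
    rw [h1, Submodule.mem_bot] at h2
    have := hΔ.pos a (hAΔ a ha)
    rw [h2, map_zero] at this
    exact lt_irrefl _ this
  · have h2 := horth1 b (h1 ▸ Submodule.mem_top) b hb
    rw [hΦ.inner_self b (hΔ.subset (hBΔ b hb))] at h2
    exact one_ne_zero h2

end Inversions

end CherednikQH

end

noncomputable section

namespace CherednikQH

/-! ### A positive eigenvector of the Gram matrix of the simple roots -/

section Perron

open Matrix

theorem eq_zero_of_forall_quadratic_nonneg {b c : ℝ} (h : ∀ t : ℝ, 0 ≤ 2 * t * b + t ^ 2 * c) :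
    b = 0 := by
  have h1 : discrim c (2 * b) 0 ≤ 0 := discrim_le_zero fun t => by
    have := h t
    linarith
  rw [discrim] at h1
  nlinarith [sq_nonneg b]

/-- Minimise the quadratic form on the unit sphere. Taking absolute values of the coordinates does
not increase it, as the off-diagonal entries are nonpositive, and the first variation at a minimiser
is the eigenvector equation. -/
theorem exists_nonneg_eigenvector {ι : Type*} [Fintype ι] [Nonempty ι] {G : Matrix ι ι ℝ}
    (hsymm : G.IsSymm) (hoff : ∀ i j, i ≠ j → G i j ≤ 0) :
    ∃ (r : ℝ) (x : ι → ℝ), (∀ i, 0 ≤ x i) ∧ x ≠ 0 ∧ G *ᵥ x = r • x := by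
  classical
  let Q : (ι → ℝ) → ℝ := fun x => x ⬝ᵥ G *ᵥ x
  have hself : ∀ x : ι → ℝ, x ⬝ᵥ x = ∑ i, x i ^ 2 := fun x =>
    Finset.sum_congr rfl fun i _ => (sq (x i)).symm
  let K : Set (ι → ℝ) := {x | x ⬝ᵥ x = 1}
  have hK : IsCompact K := by
    refine Metric.isCompact_of_isClosed_isBounded ?_ ?_
    · exact isClosed_eq (by fun_prop) continuous_const
    · refine (Metric.isBounded_closedBall (x := (0 : ι → ℝ)) (r := 1)).subset fun x hx => ?_
      rw [mem_closedBall_zero_iff, pi_norm_le_iff_of_nonneg zero_le_one]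
      intro i
      have h1 : x ⬝ᵥ x = 1 := hx
      have h2 : x i ^ 2 ≤ ∑ j, x j ^ 2 :=
        Finset.single_le_sum (f := fun j => x j ^ 2) (fun j _ => sq_nonneg _) (Finset.mem_univ i)
      rw [← hself, h1] at h2
      rw [Real.norm_eq_abs]
      exact abs_le_one_iff_mul_self_le_one.2 (by nlinarith)
  obtain ⟨i₀⟩ := ‹Nonempty ι›
  obtain ⟨x₀, hx₀, hmin⟩ := hK.exists_isMinOn (f := Q)
    ⟨Pi.single i₀ 1, by simp [K]⟩ (Continuous.continuousOn (by fun_prop))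
  set y : ι → ℝ := fun i => |x₀ i| with hy
  have hyK : y ⬝ᵥ y = 1 := by
    have h1 : x₀ ⬝ᵥ x₀ = 1 := hx₀
    rw [hself] at h1 ⊢
    rw [← h1]
    exact Finset.sum_congr rfl fun i _ => sq_abs _
  have hyQ : Q y ≤ Q x₀ := by
    simp only [Q, dotProduct, mulVec, Finset.mul_sum]
    refine Finset.sum_le_sum fun i _ => Finset.sum_le_sum fun j _ => ?_
    rcases eq_or_ne i j with rfl | hij
    · have : |x₀ i| * |x₀ i| = x₀ i * x₀ i := abs_mul_abs_self _
      simp only [hy]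
      exact le_of_eq (by linear_combination G i i * this)
    · have h1 : x₀ i * x₀ j ≤ |x₀ i| * |x₀ j| := by
        rw [← abs_mul]
        exact le_abs_self _
      simp only [hy]
      nlinarith [hoff i j hij]
  have hge : ∀ z : ι → ℝ, Q y * (z ⬝ᵥ z) ≤ Q z := by
    intro z
    rcases eq_or_ne z 0 with rfl | hz
    · simp [Q]
    have hz0 : 0 < z ⬝ᵥ z := by
      rw [hself]
      obtain ⟨i, hi⟩ := Function.ne_iff.1 hz
      exact Finset.sum_pos' (fun i _ => sq_nonneg _) ⟨i, Finset.mem_univ i, by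
        have : z i ≠ 0 := hi
        positivity⟩
    set a := (Real.sqrt (z ⬝ᵥ z))⁻¹ with ha
    have ha2 : a * a * (z ⬝ᵥ z) = 1 := by
      rw [ha, ← mul_inv, Real.mul_self_sqrt hz0.le, inv_mul_cancel₀ hz0.ne']
    have h1 : a • z ∈ K := by
      change (a • z) ⬝ᵥ (a • z) = 1
      rw [smul_dotProduct, dotProduct_smul, smul_eq_mul, smul_eq_mul, ← mul_assoc, ha2]
    have h2 : Q x₀ ≤ Q (a • z) := hmin h1
    have h3 : Q (a • z) = a * a * Q z := by
      simp only [Q, mulVec_smul, smul_dotProduct, dotProduct_smul, smul_eq_mul]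
      ring
    have h4 : Q y ≤ a * a * Q z := by linarith
    calc Q y * (z ⬝ᵥ z) ≤ (a * a * Q z) * (z ⬝ᵥ z) := mul_le_mul_of_nonneg_right h4 hz0.le
      _ = (a * a * (z ⬝ᵥ z)) * Q z := by ring
      _ = Q z := by rw [ha2, one_mul]
  refine ⟨Q y, y, fun i => abs_nonneg _, ?_, ?_⟩
  · intro h0
    rw [h0, zero_dotProduct] at hyK
    exact zero_ne_one hyK
  · funext i
    rw [Pi.smul_apply, smul_eq_mul, ← sub_eq_zero]
    set e : ι → ℝ := Pi.single i 1 with he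
    have h1 : e ⬝ᵥ G *ᵥ y = (G *ᵥ y) i := by rw [he, single_dotProduct, one_mul]
    have h2 : y ⬝ᵥ G *ᵥ e = (G *ᵥ y) i := by
      rw [dotProduct_mulVec, ← mulVec_transpose, hsymm.eq, he, dotProduct_single, mul_one]
    have h3 : e ⬝ᵥ y = y i := by rw [he, single_dotProduct, one_mul]
    have h4 : y ⬝ᵥ e = y i := by rw [he, dotProduct_single, mul_one]
    refine eq_zero_of_forall_quadratic_nonneg (c := Q e - Q y * (e ⬝ᵥ e)) fun t => ?_
    have h5 := hge (y + t • e)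
    have h6 : Q (y + t • e) = Q y + 2 * t * (G *ᵥ y) i + t ^ 2 * Q e := by
      simp only [Q, mulVec_add, mulVec_smul, add_dotProduct, dotProduct_add, smul_dotProduct,
        dotProduct_smul, smul_eq_mul, h1, h2]
      ring
    have h7 : (y + t • e) ⬝ᵥ (y + t • e) = 1 + 2 * t * y i + t ^ 2 * (e ⬝ᵥ e) := by
      simp only [add_dotProduct, dotProduct_add, smul_dotProduct, dotProduct_smul, smul_eq_mul, h3,
        h4, hyK]
      ring
    rw [h6, h7] at h5
    linarith

end Perron

/-! ### Two-colouring of the simple roots and the Perron vector -/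

section Colouring

variable {V : Type*} [NormedAddCommGroup V] [InnerProductSpace ℝ V] {Φ Δ : Finset V}
  {h : Module.Dual ℝ V}

/-- The sum of `T` is nonzero, so it has positive inner product with some `α ∈ T`. There `α`
contributes `1` and each neighbour at most `-1/2`, so two neighbours are too many. Thus the Coxeter
graph is a forest. -/
theorem IsSimpleSystem.exists_leaf [DecidableEq V] (hΦ : IsUnitRootSystem Φ)
    (hΔ : IsSimpleSystem Φ h Δ) {T : Finset V} (hT : T ⊆ Δ) (hne : T.Nonempty) :
    ∃ α ∈ T, ∀ β ∈ T.erase α, ∀ γ ∈ T.erase α, inner ℝ α β ≠ (0 : ℝ) →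
      inner ℝ α γ ≠ (0 : ℝ) → β = γ := by
  have h0 : ∑ α ∈ T, α ≠ 0 := by
    intro h0
    have h1 := congrArg h h0
    rw [map_sum, map_zero] at h1
    exact (Finset.sum_pos (fun α hα => hΔ.pos α (hT hα)) hne).ne' h1
  obtain ⟨α, hα, hpos⟩ : ∃ α ∈ T, 0 < ∑ β ∈ T, (inner ℝ α β : ℝ) := by
    by_contra! hle
    refine h0 (real_inner_self_nonpos.1 ?_)
    rw [sum_inner]
    refine Finset.sum_nonpos fun α hα => ?_
    rw [inner_sum]
    exact hle α hα
  refine ⟨α, hα, fun β hβ γ hγ hβ0 hγ0 => ?_⟩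
  by_contra hβγ
  rw [← Finset.add_sum_erase T _ hα, hΦ.inner_self α (hΔ.subset (hT hα)),
    ← Finset.add_sum_erase _ _ hβ,
    ← Finset.add_sum_erase _ _ (Finset.mem_erase.2 ⟨Ne.symm hβγ, hγ⟩)] at hpos
  have hmem : ∀ δ ∈ T.erase α, δ ∈ Δ := fun δ hδ => hT (Finset.mem_of_mem_erase hδ)
  have h1 := hΔ.inner_le_neg_half hΦ (hT hα) (hmem β hβ) hβ0 (Finset.ne_of_mem_erase hβ).symm
  have h2 := hΔ.inner_le_neg_half hΦ (hT hα) (hmem γ hγ) hγ0 (Finset.ne_of_mem_erase hγ).symm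
  have h3 : ∑ δ ∈ ((T.erase α).erase β).erase γ, (inner ℝ α δ : ℝ) ≤ 0 :=
    Finset.sum_nonpos fun δ hδ => by
      have hδ' := Finset.mem_of_mem_erase (Finset.mem_of_mem_erase hδ)
      exact hΔ.inner_nonpos α (hT hα) δ (hmem δ hδ') (Finset.ne_of_mem_erase hδ').symm
  linarith

/-- The simple roots split into two orthogonal systems. -/
theorem IsSimpleSystem.exists_colouring [DecidableEq V] (hΦ : IsUnitRootSystem Φ)
    (hΔ : IsSimpleSystem Φ h Δ) (T : Finset V) (hT : T ⊆ Δ) :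
    ∃ I J : Finset V, Disjoint I J ∧ I ∪ J = T ∧
      (∀ α ∈ I, ∀ β ∈ I, α ≠ β → inner ℝ α β = (0 : ℝ)) ∧
      ∀ α ∈ J, ∀ β ∈ J, α ≠ β → inner ℝ α β = (0 : ℝ) := by
  induction T using Finset.strongInduction with
  | H T ih =>
    rcases T.eq_empty_or_nonempty with rfl | hne
    · exact ⟨∅, ∅, by simp⟩
    obtain ⟨α, hα, hleaf⟩ := hΔ.exists_leaf hΦ hT hne
    have insert_orth : ∀ K ⊆ T.erase α, (∀ β ∈ K, ∀ γ ∈ K, β ≠ γ → inner ℝ β γ = (0 : ℝ)) →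
        (∀ β ∈ K, inner ℝ α β = (0 : ℝ)) →
        ∀ β ∈ insert α K, ∀ γ ∈ insert α K, β ≠ γ → inner ℝ β γ = (0 : ℝ) := by
      intro K _ hK hαK β hβ γ hγ hβγ
      rcases Finset.mem_insert.1 hβ with rfl | hβ' <;> rcases Finset.mem_insert.1 hγ with rfl | hγ'
      · exact absurd rfl hβγ
      · exact hαK γ hγ'
      · rw [real_inner_comm]
        exact hαK β hβ'
      · exact hK β hβ' γ hγ' hβγ
    obtain ⟨I, J, hdisj, hIJ, hI, hJ⟩ := ih (T.erase α) (Finset.erase_ssubset hα)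
      ((Finset.erase_subset _ _).trans hT)
    have hIT : I ⊆ T.erase α := hIJ ▸ Finset.subset_union_left
    have hJT : J ⊆ T.erase α := hIJ ▸ Finset.subset_union_right
    have hαI : α ∉ I := fun h => Finset.notMem_erase α T (hIT h)
    have hαJ : α ∉ J := fun h => Finset.notMem_erase α T (hJT h)
    by_cases hex : ∀ β ∈ I, inner ℝ α β = (0 : ℝ)
    · exact ⟨insert α I, J, Finset.disjoint_insert_left.2 ⟨hαJ, hdisj⟩,
        by rw [Finset.insert_union, hIJ, Finset.insert_erase hα], insert_orth I hIT hI hex, hJ⟩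
    · push Not at hex
      obtain ⟨β, hβ, hβ0⟩ := hex
      refine ⟨I, insert α J, Finset.disjoint_insert_right.2 ⟨hαI, hdisj⟩,
        by rw [Finset.union_insert, hIJ, Finset.insert_erase hα], hI,
        insert_orth J hJT hJ fun γ hγ => ?_⟩
      by_contra hγ0
      have := hleaf β (hIT hβ) γ (hJT hγ) hβ0 hγ0
      exact Finset.disjoint_left.1 hdisj hβ (this ▸ hγ)

/-- A positive eigenvector of the Gram matrix of the simple roots. -/
theorem IsSimpleSystem.exists_perron (hΦ : IsUnitRootSystem Φ) (hΔ : IsSimpleSystem Φ h Δ)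
    (hirr : ∀ U : Submodule ℝ V, (∀ α ∈ Φ, ∀ u ∈ U, u - (2 * inner ℝ α u : ℝ) • α ∈ U) →
      U = ⊥ ∨ U = ⊤) (hcard : 2 ≤ Δ.card) :
    ∃ (r : ℝ) (x : V → ℝ), 0 < r ∧ r < 1 ∧ (∀ α ∈ Δ, 0 < x α) ∧
      ∀ α ∈ Δ, inner ℝ α (∑ β ∈ Δ, x β • β) = r * x α := by
  classical
  have hne : Nonempty Δ := by
    rw [Finset.nonempty_coe_sort, ← Finset.card_pos]
    omega
  obtain ⟨r, y, hy, hy0, hGy⟩ := exists_nonneg_eigenvector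
    (G := Matrix.of fun i j : Δ => (inner ℝ (i : V) (j : V) : ℝ))
    (Matrix.IsSymm.ext fun i j => real_inner_comm _ _)
    fun i j hij => hΔ.inner_nonpos i i.2 j j.2 fun h => hij (Subtype.ext h)
  let x : V → ℝ := Function.extend Subtype.val y 0
  have hxy : ∀ i : Δ, x i = y i := fun i => Subtype.val_injective.extend_apply _ _ _
  have hx : ∀ α ∈ Δ, 0 ≤ x α := fun α hα => by rw [hxy ⟨α, hα⟩]; exact hy _
  have heig : ∀ α ∈ Δ, inner ℝ α (∑ β ∈ Δ, x β • β) = r * x α := by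
    intro α hα
    have h1 := congrFun hGy ⟨α, hα⟩
    rw [Pi.smul_apply, smul_eq_mul, ← hxy, Matrix.mulVec, dotProduct] at h1
    rw [← h1, inner_sum, ← Finset.sum_coe_sort]
    refine Finset.sum_congr rfl fun j _ => ?_
    rw [real_inner_smul_right, hxy, mul_comm]
    rfl
  have hsplit : ∀ α ∈ Δ, r * x α = x α + ∑ β ∈ Δ.erase α, x β * inner ℝ α β := by
    intro α hα
    rw [← heig α hα, inner_sum, ← Finset.add_sum_erase Δ _ hα, real_inner_smul_right,
      hΦ.inner_self α (hΔ.subset hα), mul_one]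
    simp only [real_inner_smul_right]
  have hterm : ∀ α ∈ Δ, ∀ β ∈ Δ.erase α, x β * inner ℝ α β ≤ 0 := fun α hα β hβ =>
    mul_nonpos_of_nonneg_of_nonpos (hx β (Finset.mem_of_mem_erase hβ))
      (hΔ.inner_nonpos α hα β (Finset.mem_of_mem_erase hβ) (Finset.ne_of_mem_erase hβ).symm)
  obtain ⟨⟨α₀, hα₀⟩, hα₀0⟩ := Function.ne_iff.1 hy0
  rw [← hxy, Pi.zero_apply] at hα₀0
  -- Where `x` vanishes, the eigenvector equation is a vanishing sum of nonpositive terms, so the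
  -- zero set would be orthogonal to its complement in `Δ`.
  have hpos : ∀ α ∈ Δ, 0 < x α := by
    by_contra! hcon
    obtain ⟨β₀, hβ₀, hβ₀0⟩ := hcon
    refine hΔ.not_orthogonal hΦ hirr (A := {α | α ∈ Δ ∧ x α = 0}) (B := {α | α ∈ Δ ∧ x α ≠ 0}) ?_
      ?_ ⟨β₀, hβ₀, le_antisymm hβ₀0 (hx β₀ hβ₀)⟩ ⟨α₀, hα₀, hα₀0⟩
    · ext α
      simp only [Finset.mem_coe, Set.mem_union, Set.mem_ofPred_eq]
      tauto
    · rintro α ⟨hα, hα0⟩ β ⟨hβ, hβ0⟩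
      have h1 := hsplit α hα
      rw [hα0, mul_zero, zero_add] at h1
      have h2 := (Finset.sum_eq_zero_iff_of_nonpos (hterm α hα)).1 h1.symm β
        (Finset.mem_erase.2 ⟨by rintro rfl; exact hβ0 hα0, hβ⟩)
      exact (mul_eq_zero.1 h2).resolve_left hβ0
  refine ⟨r, x, ?_, ?_, hpos, heig⟩
  · set u := ∑ β ∈ Δ, x β • β with hu
    have hu0 : u ≠ 0 := by
      intro h0
      have h1 := congrArg h h0
      rw [hu, map_sum, map_zero] at h1
      refine (Finset.sum_pos (fun α hα => ?_) (Finset.nonempty_coe_sort.1 hne)).ne' h1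
      rw [map_smul]
      exact mul_pos (hpos α hα) (hΔ.pos α hα)
    have h1 : (0 : ℝ) < inner ℝ u u := real_inner_self_pos.2 hu0
    nth_rewrite 1 [hu] at h1
    rw [sum_inner, Finset.sum_congr rfl fun α hα => by
      rw [real_inner_smul_left, heig α hα, mul_left_comm], ← Finset.mul_sum] at h1
    exact pos_of_mul_pos_left h1
      (Finset.sum_nonneg fun α hα => mul_nonneg (hx α hα) (hx α hα))
  -- For `1 ≤ r` the equation at `α₀` makes `α₀` orthogonal to all other simple roots.
  · by_contra! hr
    refine hΔ.not_orthogonal hΦ hirr (A := {α₀}) (B := (Δ.erase α₀ : Set V)) ?_ ?_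
      (Set.singleton_nonempty _) ?_
    · rw [← Set.insert_eq, ← Finset.coe_insert, Finset.insert_erase hα₀]
    · rintro α rfl β hβ
      have h1 := hsplit α hα₀
      have h2 := Finset.sum_nonpos (hterm α hα₀)
      have h3 : ∑ β ∈ Δ.erase α, x β * inner ℝ α β = 0 :=
        le_antisymm h2 (by nlinarith [hpos α hα₀])
      have h4 := (Finset.sum_eq_zero_iff_of_nonpos (hterm α hα₀)).1 h3 β hβ
      exact (mul_eq_zero.1 h4).resolve_left (hpos β (Finset.mem_of_mem_erase hβ)).ne'
    · rw [Finset.coe_nonempty, ← Finset.card_pos, Finset.card_erase_of_mem hα₀]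
      omega

end Colouring

end CherednikQH

end

noncomputable section

namespace CherednikQH

/-! ### The Coxeter plane -/

section CoxeterElement

variable {V : Type*} [NormedAddCommGroup V] [InnerProductSpace ℝ V] {Φ Δ : Finset V}
  {h : Module.Dual ℝ V}

theorem IsSimpleSystem.span_eq_top (hΦ : IsUnitRootSystem Φ) (hΔ : IsSimpleSystem Φ h Δ)
    (hirr : ∀ U : Submodule ℝ V, (∀ α ∈ Φ, ∀ u ∈ U, u - (2 * inner ℝ α u : ℝ) • α ∈ U) →
      U = ⊥ ∨ U = ⊤) (hne : Φ.Nonempty) : Submodule.span ℝ (Δ : Set V) = ⊤ := by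
  have hpos : ∀ β ∈ Φ, 0 < h β → β ∈ Submodule.span ℝ (Δ : Set V) := by
    intro β hβ hβ0
    obtain ⟨c, _, hc⟩ := exists_coeff_of_mem_span (hΔ.mem_span β hβ hβ0)
    rw [hc]
    exact Submodule.sum_mem _ fun α hα => Submodule.smul_mem _ _ (Submodule.subset_span hα)
  have hmem : ∀ β ∈ Φ, β ∈ Submodule.span ℝ (Δ : Set V) := by
    intro β hβ
    rcases lt_or_gt_of_ne (hΔ.ne_zero β hβ) with h1 | h1
    · rw [← Submodule.neg_mem_iff]
      exact hpos _ (hΦ.neg_mem hβ) (by rw [map_neg]; linarith)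
    · exact hpos β hβ h1
  refine (hirr _ fun α hα u hu => sub_mem hu (Submodule.smul_mem _ _ (hmem α hα))).resolve_left ?_
  intro h0
  obtain ⟨β, hβ⟩ := hne
  have h1 := hmem β hβ
  rw [h0, Submodule.mem_bot] at h1
  exact hΔ.ne_zero β hβ (by rw [h1, map_zero])

theorem eq_zero_of_inner_eq_zero (hspan : Submodule.span ℝ (Δ : Set V) = ⊤) {v : V}
    (hv : ∀ α ∈ Δ, inner ℝ α v = (0 : ℝ)) : v = 0 := by
  have h1 : ∀ x ∈ Submodule.span ℝ (Δ : Set V), inner ℝ x v = (0 : ℝ) := by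
    intro x hx
    induction hx using Submodule.span_induction with
    | mem x hx => exact hv x hx
    | zero => rw [inner_zero_left]
    | add x y _ _ hx hy => rw [inner_add_left, hx, hy, add_zero]
    | smul a x _ hx => rw [real_inner_smul_left, hx, mul_zero]
  exact inner_self_eq_zero.1 (h1 v (hspan ▸ Submodule.mem_top))

/-- A product of reflections in all simple roots has no nonzero fixed vector. -/
theorem IsSimpleSystem.eq_zero_of_fixed [DecidableEq V] (hΔ : IsSimpleSystem Φ h Δ)
    (hspan : Submodule.span ℝ (Δ : Set V) = ⊤) {I J : Finset V} (hdisj : Disjoint I J)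
    (hIJ : I ∪ J = Δ) {s t : V ≃ₗᵢ[ℝ] V}
    (hs : ∀ v, s v = v - ∑ α ∈ I, (2 * inner ℝ α v : ℝ) • α)
    (ht : ∀ v, t v = v - ∑ α ∈ J, (2 * inner ℝ α v : ℝ) • α) {v : V} (hv : s (t v) = v) :
    v = 0 := by
  set a := ∑ α ∈ J, (2 * inner ℝ α v : ℝ) • α with ha
  rw [ht, ← ha, hs, sub_sub, sub_eq_self] at hv
  -- The displacement of `v` is a combination of simple roots, so all coefficients vanish: first
  -- those of `J`, whence `a = 0`, and then those of `I` are inner products with `v` itself.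
  have h1 : ∑ α ∈ Δ, (if α ∈ J then (2 * inner ℝ α v : ℝ) else 2 * inner ℝ α (v - a)) • α = 0 := by
    rw [← hIJ, Finset.sum_union hdisj, add_comm]
    convert hv using 2
    · exact Finset.sum_congr rfl fun α hα => by rw [if_pos hα]
    · exact Finset.sum_congr rfl fun α hα => by
        rw [if_neg (Finset.disjoint_left.1 hdisj hα)]
  have h2 := linearIndepOn_finset_iff.1 hΔ.linearIndepOn _ h1
  have hJ : ∀ α ∈ J, inner ℝ α v = (0 : ℝ) := fun α hα => by
    have := h2 α (hIJ ▸ Finset.mem_union_right I hα)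
    rw [if_pos hα] at this
    linarith
  have ha0 : a = 0 := Finset.sum_eq_zero fun α hα => by rw [hJ α hα, mul_zero, zero_smul]
  refine eq_zero_of_inner_eq_zero hspan fun α hα => ?_
  by_cases hαJ : α ∈ J
  · exact hJ α hαJ
  · have := h2 α hα
    rw [if_neg hαJ, ha0, sub_zero] at this
    linarith

/-- Here `I` is one colour class, the sum over it is one half of the Perron vector and `q` the other
half. Since `I` is orthonormal, the eigenvector equation reads `⟨α, q⟩ = (r - 1) * x α`, so the
product of the reflections in `I` preserves the plane of the two halves. -/
theorem refl_prod_apply {I : Finset V} (hI : ∀ α ∈ I, inner ℝ α α = (1 : ℝ))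
    (horth : ∀ α ∈ I, ∀ β ∈ I, α ≠ β → inner ℝ α β = (0 : ℝ)) (x : V → ℝ) {r : ℝ} {q : V}
    (hq : ∀ α ∈ I, inner ℝ α (∑ β ∈ I, x β • β + q) = r * x α) :
    (∑ β ∈ I, x β • β - ∑ α ∈ I, (2 * inner ℝ α (∑ β ∈ I, x β • β) : ℝ) • α = -∑ β ∈ I, x β • β) ∧
      q - ∑ α ∈ I, (2 * inner ℝ α q : ℝ) • α = q + (2 * (1 - r)) • ∑ β ∈ I, x β • β := by
  have h1 : ∀ α ∈ I, inner ℝ α (∑ β ∈ I, x β • β) = x α := by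
    intro α hα
    rw [inner_sum, Finset.sum_eq_single_of_mem α hα, real_inner_smul_right, hI α hα, mul_one]
    intro β hβ hne
    rw [real_inner_smul_right, horth α hα β hβ hne.symm, mul_zero]
  constructor
  · have h2 : ∑ α ∈ I, (2 * inner ℝ α (∑ β ∈ I, x β • β) : ℝ) • α = (2 : ℝ) • ∑ β ∈ I, x β • β := by
      rw [Finset.smul_sum]
      exact Finset.sum_congr rfl fun α hα => by rw [h1 α hα, mul_smul]
    rw [h2]
    module
  · rw [sub_eq_add_neg, ← Finset.sum_neg_distrib, Finset.smul_sum]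
    congr 1
    refine Finset.sum_congr rfl fun α hα => ?_
    have h3 := hq α hα
    rw [inner_add_right, h1 α hα] at h3
    have h4 : inner ℝ α q = (r - 1) * x α := by linarith
    rw [h4]
    module

/-- A Coxeter element, with the basis of its plane. -/
theorem IsSimpleSystem.exists_coxeter (hΦ : IsUnitRootSystem Φ) (hΔ : IsSimpleSystem Φ h Δ)
    (hirr : ∀ U : Submodule ℝ V, (∀ α ∈ Φ, ∀ u ∈ U, u - (2 * inner ℝ α u : ℝ) • α ∈ U) →
      U = ⊥ ∨ U = ⊤) (hspan : Submodule.span ℝ (Δ : Set V) = ⊤) (hcard : 2 ≤ Δ.card)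
    {G : Subgroup (V ≃ₗᵢ[ℝ] V)} (hG : ∀ w ∈ G, ∀ β ∈ Φ, w β ∈ Φ)
    (hrefl : ∀ α ∈ Φ, ∃ s ∈ G, ∀ v, s v = v - (2 * inner ℝ α v : ℝ) • α) :
    ∃ g ∈ G, ∃ (p q : V) (k : ℝ), 0 < k ∧ k < 1 ∧ g p = (4 * k ^ 2 - 1) • p + (2 * k) • q ∧
      g q = -q - (2 * k) • p ∧
      (∀ β ∈ Φ, inner ℝ p β = (0 : ℝ) → inner ℝ q β = (0 : ℝ) → False) ∧
      (∀ v, g v = v → v = 0) ∧ inversions Φ h g ≤ Δ.card := by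
  classical
  obtain ⟨r, x, hr0, hr1, hx, heig⟩ := hΔ.exists_perron hΦ hirr hcard
  obtain ⟨I, J, hdisj, hIJ, hI, hJ⟩ := hΔ.exists_colouring hΦ Δ subset_rfl
  have hIΔ : I ⊆ Δ := hIJ ▸ Finset.subset_union_left
  have hJΔ : J ⊆ Δ := hIJ ▸ Finset.subset_union_right
  obtain ⟨s, hs, hsv, hsinv⟩ := exists_prod_refl hΦ hΔ hG hrefl hIΔ hI
  obtain ⟨t, ht, htv, htinv⟩ := exists_prod_refl hΦ hΔ hG hrefl hJΔ hJ
  set p := ∑ β ∈ I, x β • β with hp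
  set q := ∑ β ∈ J, x β • β with hq
  have hpq : ∑ β ∈ Δ, x β • β = p + q := by rw [← hIJ, Finset.sum_union hdisj]
  rw [hpq] at heig
  obtain ⟨hsp, hsq⟩ := refl_prod_apply (r := r) (q := q)
    (fun α hα => hΦ.inner_self α (hΔ.subset (hIΔ hα))) hI x fun α hα => heig α (hIΔ hα)
  obtain ⟨htq, htp⟩ := refl_prod_apply (r := r) (q := p)
    (fun α hα => hΦ.inner_self α (hΔ.subset (hJΔ hα))) hJ x fun α hα => by
      rw [← hq, add_comm]
      exact heig α (hJΔ hα)
  rw [← hp, ← hsv] at hsp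
  rw [← hp, ← hsv] at hsq
  rw [← hq, ← htv] at htq
  rw [← hq, ← htv] at htp
  refine ⟨s * t, mul_mem hs ht, p, q, 1 - r, by linarith, by linarith, ?_, ?_, ?_, fun v hv => ?_,
    ?_⟩
  · rw [isometry_mul_apply, htp, map_add, map_smul, hsp, hsq]
    module
  · rw [isometry_mul_apply, htq, map_neg, hsq]
    module
  -- The Perron vector `p + q` has inner product `r * x α > 0` with every simple root, so no root is
  -- orthogonal to the plane.
  · have key : ∀ β ∈ Φ, 0 < h β → inner ℝ (p + q) β ≠ (0 : ℝ) := by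
      intro β hβ hβ0 h0
      obtain ⟨c, hc, hβc⟩ := exists_coeff_of_mem_span (hΔ.mem_span β hβ hβ0)
      rw [real_inner_comm, hβc, sum_inner] at h0
      have h1 : ∀ α ∈ Δ, inner ℝ (c α • α) (p + q) = c α * (r * x α) := fun α hα => by
        rw [real_inner_smul_left, heig α hα]
      rw [Finset.sum_congr rfl h1] at h0
      have h2 := (Finset.sum_eq_zero_iff_of_nonneg fun α hα =>
        mul_nonneg (hc α) (mul_pos hr0 (hx α hα)).le).1 h0
      rw [hβc, Finset.sum_eq_zero fun α hα => ?_, map_zero] at hβ0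
      · exact lt_irrefl _ hβ0
      · rw [(mul_eq_zero.1 (h2 α hα)).resolve_right (mul_pos hr0 (hx α hα)).ne', zero_smul]
    intro β hβ h1 h2
    rcases lt_or_gt_of_ne (hΔ.ne_zero β hβ) with h3 | h3
    · refine key (-β) (hΦ.neg_mem hβ) (by rw [map_neg]; linarith) ?_
      rw [inner_neg_right, inner_add_left, h1, h2, add_zero, neg_zero]
    · exact key β hβ h3 (by rw [inner_add_left, h1, h2, add_zero])
  · rw [isometry_mul_apply] at hv
    exact hΔ.eq_zero_of_fixed hspan hdisj hIJ hsv htv hv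
  · have h1 := hsinv t ht
    have h2 := htinv 1 (one_mem _)
    have h3 : inversions Φ h (1 : V ≃ₗᵢ[ℝ] V) = 0 := by
      refine Finset.card_eq_zero.2 (Finset.filter_eq_empty_iff.2 fun β _ hβ => ?_)
      exact lt_asymm hβ.1 hβ.2
    rw [mul_one, h3] at h2
    rw [← hIJ, Finset.card_union_of_disjoint hdisj]
    omega

end CoxeterElement

end CherednikQH

end

noncomputable section

namespace CherednikQH

open MvPolynomial

/-! ### The regular eigenvector of a Coxeter element -/

section UnitRoots

variable {n : ℕ} {W : Subgroup (E n ≃ₗᵢ[ℝ] E n)}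

/-- The root of length one of a reflection. -/
def unitRoot (s : reflections W) : E n := ‖root s‖⁻¹ • root s

theorem norm_root_pos (s : reflections W) : 0 < ‖root s‖ := norm_pos_iff.2 (root_ne_zero s)

theorem unitRoot_inner_self (s : reflections W) :
    inner ℝ (unitRoot s) (unitRoot s) = (1 : ℝ) := by
  have := (norm_root_pos s).ne'
  rw [unitRoot, real_inner_smul_left, real_inner_smul_right, real_inner_self_eq_norm_sq]
  field_simp

theorem reflection_unitRoot (s : reflections W) :
    (ℝ ∙ unitRoot s)ᗮ.reflection = (s : E n ≃ₗᵢ[ℝ] E n) := by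
  rw [unitRoot, reflection_smul (inv_ne_zero (norm_root_pos s).ne'), ← eq_reflection_root]

theorem unitRoot_ne_zero (s : reflections W) : unitRoot s ≠ 0 :=
  smul_ne_zero (inv_ne_zero (norm_root_pos s).ne') (root_ne_zero s)

variable [Fintype (reflections W)]

open Classical in
/-- The roots of length one. -/
def unitRoots (W : Subgroup (E n ≃ₗᵢ[ℝ] E n)) [Fintype (reflections W)] : Finset (E n) :=
  Finset.univ.image fun sb : reflections W × Bool =>
    cond sb.2 (unitRoot sb.1) (-unitRoot sb.1)

theorem reflection_neg (u : E n) : (ℝ ∙ -u)ᗮ.reflection = (ℝ ∙ u)ᗮ.reflection := by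
  rw [← neg_one_smul ℝ u]
  exact reflection_smul (by norm_num) u

theorem mem_unitRoots {α : E n} : α ∈ unitRoots W ↔
    inner ℝ α α = (1 : ℝ) ∧ (ℝ ∙ α)ᗮ.reflection ∈ W := by
  classical
  rw [unitRoots, Finset.mem_image]
  constructor
  · rintro ⟨⟨s, b⟩, _, rfl⟩
    cases b
    · simp only [cond_false]
      rw [inner_neg_neg, reflection_neg, reflection_unitRoot]
      exact ⟨unitRoot_inner_self s, s.2.1⟩
    · simp only [cond_true]
      rw [reflection_unitRoot]
      exact ⟨unitRoot_inner_self s, s.2.1⟩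
  · rintro ⟨h1, h2⟩
    have hα : α ≠ 0 := by
      rintro rfl
      rw [inner_zero_left] at h1
      exact zero_ne_one h1
    let s : reflections W := ⟨(ℝ ∙ α)ᗮ.reflection, h2, α, hα, rfl⟩
    obtain ⟨a, _, ha⟩ := exists_smul_of_reflection_eq (α := unitRoot s) hα (reflection_unitRoot s)
    rw [ha, real_inner_smul_left, real_inner_smul_right, unitRoot_inner_self, mul_one] at h1
    rcases mul_self_eq_one_iff.1 h1 with h3 | h3
    · exact ⟨(s, true), Finset.mem_univ _, by rw [ha, h3, one_smul]; rfl⟩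
    · exact ⟨(s, false), Finset.mem_univ _, by rw [ha, h3, neg_one_smul]; rfl⟩

theorem card_unitRoots : (unitRoots W).card = 2 * Fintype.card (reflections W) := by
  classical
  rw [unitRoots, Finset.card_image_of_injective, Finset.card_univ, Fintype.card_prod,
    Fintype.card_bool, mul_comm]
  rintro ⟨s, b⟩ ⟨t, c⟩ h
  have hrefl : ∀ (s : reflections W) (b : Bool),
      (ℝ ∙ (cond b (unitRoot s) (-unitRoot s)))ᗮ.reflection = (s : E n ≃ₗᵢ[ℝ] E n) := by
    intro s b
    cases b
    · exact (reflection_neg _).trans (reflection_unitRoot s)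
    · exact reflection_unitRoot s
  simp only at h
  have hst : s = t := Subtype.ext (by rw [← hrefl s b, ← hrefl t c]; simp only [h])
  subst hst
  have hne : unitRoot s ≠ -unitRoot s := fun h0 => unitRoot_ne_zero s (by
    rw [eq_neg_iff_add_eq_zero, ← two_smul ℝ] at h0
    exact (smul_eq_zero.1 h0).resolve_left two_ne_zero)
  cases b <;> cases c
  · rfl
  · exact absurd h.symm hne
  · exact absurd h hne
  · rfl

theorem map_mem_unitRoots {w : E n ≃ₗᵢ[ℝ] E n} (hw : w ∈ W) {α : E n} (hα : α ∈ unitRoots W) :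
    w α ∈ unitRoots W := by
  rw [mem_unitRoots] at hα ⊢
  rw [w.inner_map_map, ← conj_reflection]
  exact ⟨hα.1, mul_mem (mul_mem hw hα.2) (inv_mem hw)⟩

theorem reflection_unit_apply {α : E n} (hα : inner ℝ α α = (1 : ℝ)) (v : E n) :
    (ℝ ∙ α)ᗮ.reflection v = v - (2 * inner ℝ α v : ℝ) • α := by
  rw [reflection_apply, reflCoeff, ← real_inner_self_eq_norm_sq, hα, div_one]

theorem unitRoots_isUnitRootSystem : IsUnitRootSystem (unitRoots W) where
  inner_self α hα := (mem_unitRoots.1 hα).1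
  refl_mem α hα β hβ := by
    obtain ⟨h1, h2⟩ := mem_unitRoots.1 hα
    rw [← reflection_unit_apply h1]
    exact map_mem_unitRoots h2 hβ

theorem unitRoots_irreducible (hgen : Subgroup.closure (reflections W) = W)
    (hirr : ∀ U : Submodule ℝ (E n), (∀ w ∈ W, ∀ u ∈ U, w u ∈ U) → U = ⊥ ∨ U = ⊤)
    (U : Submodule ℝ (E n))
    (hU : ∀ α ∈ unitRoots W, ∀ u ∈ U, u - (2 * inner ℝ α u : ℝ) • α ∈ U) : U = ⊥ ∨ U = ⊤ := by
  have hs : ∀ s : reflections W, ∀ u ∈ U, (s : E n ≃ₗᵢ[ℝ] E n) u ∈ U := by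
    intro s u hu
    have h1 : unitRoot s ∈ unitRoots W := by
      rw [mem_unitRoots, reflection_unitRoot]
      exact ⟨unitRoot_inner_self s, s.2.1⟩
    have h2 := hU _ h1 u hu
    rwa [← reflection_unit_apply (unitRoot_inner_self s), reflection_unitRoot] at h2
  refine hirr U fun w hw => ?_
  rw [← hgen] at hw
  induction hw using Subgroup.closure_induction'' with
  | mem s hs' => exact hs ⟨s, hs'⟩
  | inv_mem s hs' =>
    intro u hu
    have := refl_inv (⟨s, hs'⟩ : reflections W)
    simp only at this
    rw [this]
    exact hs ⟨s, hs'⟩ u hu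
  | one => exact fun u hu => hu
  | mul x y _ _ hx hy => exact fun u hu => hx _ (hy u hu)

end UnitRoots

/-! ### The eigenvector in the Coxeter plane -/

section Eigenvector

variable {n : ℕ} {W : Subgroup (E n ≃ₗᵢ[ℝ] E n)}

theorem eval_lin (a b : ℂ) (p q v : E n) :
    eval (fun j => a * ((p j : ℝ) : ℂ) + b * ((q j : ℝ) : ℂ)) (lin v) =
      a * (inner ℝ p v : ℝ) + b * (inner ℝ q v : ℝ) := by
  rw [lin, map_sum, ofReal_inner, ofReal_inner, Finset.mul_sum, Finset.mul_sum,
    ← Finset.sum_add_distrib]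
  refine Finset.sum_congr rfl fun j _ => ?_
  rw [map_mul, eval_C, eval_X]
  ring

/-- On the plane of `p` and `q`, `g` has trace `4k² - 2` and determinant `1`, and `(ζ + 1) p + 2k q`
is its `ζ`-eigenvector. The inverse appears because evaluation at a vector is contragredient to the
action on polynomials. -/
theorem isEigenvector_inv {g : E n ≃ₗᵢ[ℝ] E n} {p q : E n} {k : ℝ}
    (hp : g p = (4 * k ^ 2 - 1) • p + (2 * k) • q) (hq : g q = -q - (2 * k) • p) {ζ : ℂ}
    (hζ : ζ ^ 2 - (4 * k ^ 2 - 2) * ζ + 1 = 0) :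
    IsEigenvector g⁻¹ ζ fun j => (ζ + 1) * ((p j : ℝ) : ℂ) + (2 * k) * ((q j : ℝ) : ℂ) := by
  intro f
  set v : Fin n → ℂ := fun j => (ζ + 1) * ((p j : ℝ) : ℂ) + (2 * k) * ((q j : ℝ) : ℂ) with hv
  have key : (aeval v).comp (act g⁻¹) = (aeval (ζ • v) : S n →ₐ[ℂ] ℂ) := by
    refine algHom_ext fun i => ?_
    have h1 : ∀ x : E n, (inner ℝ x (g⁻¹ (EuclideanSpace.single i 1)) : ℝ) = g x i := by
      intro x
      have h2 := g.inner_map_map x (g⁻¹ (EuclideanSpace.single i 1))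
      have h3 : g (g⁻¹ (EuclideanSpace.single i 1)) = EuclideanSpace.single i 1 :=
        g.apply_symm_apply _
      rw [← h2, h3, EuclideanSpace.inner_single_right]
      simp
    rw [AlgHom.comp_apply, act_X, aeval_X, aeval_eq_eval, hv]
    change eval _ _ = _
    rw [eval_lin, h1, h1, hp, hq]
    simp only [PiLp.add_apply, PiLp.sub_apply, PiLp.neg_apply, PiLp.smul_apply, smul_eq_mul,
      Pi.smul_apply]
    push_cast
    linear_combination (-(p i : ℂ)) * hζ
  have := congrArg (fun φ : S n →ₐ[ℂ] ℂ => φ f) key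
  simpa [aeval_eq_eval] using this

/-- With `k = cos θ` the root is `exp(2iθ)`; it is not real for `0 < k < 1`. -/
theorem exists_root_of_pos {k : ℝ} (hk0 : 0 < k) (hk1 : k < 1) :
    ∃ ζ : ℂ, ζ.im ≠ 0 ∧ ζ ^ 2 - (4 * k ^ 2 - 2) * ζ + 1 = 0 := by
  have h1 : 0 < 1 - k ^ 2 := by nlinarith
  have h2 := Real.sq_sqrt h1.le
  refine ⟨⟨2 * k ^ 2 - 1, 2 * k * Real.sqrt (1 - k ^ 2)⟩, ?_, ?_⟩
  · have := Real.sqrt_pos.2 h1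
    positivity
  · rw [Complex.mk_eq_add_mul_I]
    set r := Real.sqrt (1 - k ^ 2)
    have h3 : (r : ℂ) ^ 2 = 1 - k ^ 2 := by exact_mod_cast h2
    push_cast
    linear_combination (4 * (k : ℂ) ^ 2 * (r : ℂ) ^ 2) * Complex.I_sq - 4 * (k : ℂ) ^ 2 * h3

/-- An element of `W` with a regular eigenvector, whose order is at least the Coxeter number. -/
theorem exists_regular_eigenvector [Fintype W] [Fintype (reflections W)] (hn : 2 ≤ n)
    (hgen : Subgroup.closure (reflections W) = W)
    (hirr : ∀ U : Submodule ℝ (E n), (∀ w ∈ W, ∀ u ∈ U, w u ∈ U) → U = ⊥ ∨ U = ⊤) :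
    ∃ g ∈ W, ∃ (ζ : ℂ) (v : Fin n → ℂ), IsEigenvector g ζ v ∧
      (∀ s : reflections W, eval v (lin (root s)) ≠ 0) ∧
      2 * Fintype.card (reflections W) ≤ n * orderOf g := by
  have hΦ := unitRoots_isUnitRootSystem (W := W)
  have hΦirr := unitRoots_irreducible hgen hirr
  obtain ⟨h, Δ, hΔ⟩ := exists_isSimpleSystem hΦ
  have hmem : ∀ s : reflections W, unitRoot s ∈ unitRoots W := fun s => by
    rw [mem_unitRoots, reflection_unitRoot]
    exact ⟨unitRoot_inner_self s, s.2.1⟩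
  obtain ⟨s₀⟩ := exists_reflection hn hgen hirr
  have hspan := hΔ.span_eq_top hΦ hΦirr ⟨_, hmem s₀⟩
  have hcard : Δ.card = n := by
    rw [← finrank_span_finset_eq_card hΔ.linearIndepOn, hspan, finrank_top,
      finrank_euclideanSpace_fin]
  obtain ⟨g, hg, p, q, k, hk0, hk1, hp, hq, hreg, hfix, hinv⟩ :=
    hΔ.exists_coxeter hΦ hΦirr hspan (hcard.symm ▸ hn) (fun w hw β hβ => map_mem_unitRoots hw hβ)
      fun α hα => ⟨_, (mem_unitRoots.1 hα).2, reflection_unit_apply (mem_unitRoots.1 hα).1⟩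
  obtain ⟨ζ, hζim, hζ⟩ := exists_root_of_pos hk0 hk1
  refine ⟨g⁻¹, inv_mem hg, ζ, _, isEigenvector_inv hp hq hζ, fun s h0 => ?_, ?_⟩
  · have h1 : lin (root s) = C ((‖root s‖ : ℝ) : ℂ) * lin (unitRoot s) := by
      rw [← lin_smul, unitRoot, smul_smul, mul_inv_cancel₀ (norm_root_pos s).ne', one_smul]
    rw [h1, map_mul, eval_C, eval_lin] at h0
    have h2 := (mul_eq_zero.1 h0).resolve_left
      (Complex.ofReal_ne_zero.2 (norm_root_pos s).ne')
    -- As `p`, `q` and the root are real and `ζ` is not, the imaginary part isolates the inner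
    -- product with `p`; the one with `q` then vanishes too, against `hreg`.
    have h3 := congrArg Complex.im h2
    have h4 : inner ℝ p (unitRoot s) = (0 : ℝ) := by
      have : ζ.im * inner ℝ p (unitRoot s) = 0 := by simpa using h3
      exact (mul_eq_zero.1 this).resolve_left hζim
    rw [h4, Complex.ofReal_zero, mul_zero, zero_add] at h2
    refine hreg _ (hmem s) h4 (Complex.ofReal_eq_zero.1 ((mul_eq_zero.1 h2).resolve_left ?_))
    exact mul_ne_zero two_ne_zero (Complex.ofReal_ne_zero.2 hk0.ne')
  · have hord : 0 < orderOf g := by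
      have := orderOf_pos (⟨g, hg⟩ : W)
      rwa [← Subgroup.orderOf_coe] at this
    have h1 := card_le_orderOf_mul_inversions hΔ (fun k β hβ => map_mem_unitRoots (pow_mem hg k) hβ)
      hfix hord
    rw [card_unitRoots] at h1
    rw [orderOf_inv, mul_comm n]
    exact h1.trans (Nat.mul_le_mul_left _ (hinv.trans hcard.le))

end Eigenvector

/-! ### Uniqueness of the largest degree -/

section Main

/-- There is exactly one elementary invariant of the largest degree. -/
theorem exists_elementaryInvariants {n : ℕ} {W : Subgroup (E n ≃ₗᵢ[ℝ] E n)}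
    (hW : IsIrreducibleReflectionGroup W) :
    ∃ (d : Fin n → ℕ) (e : Fin n → S n), IsElementaryInvariants W d e ∧ (∀ i, 0 < d i) ∧
      ∃ i₀, d i₀ = coxeterNumber W ∧ ∀ i ≠ i₀, d i < coxeterNumber W := by
  have := hW.finite
  have : Fintype W := Fintype.ofFinite W
  have : Finite (reflections W) :=
    Finite.of_injective (fun s : reflections W => (⟨s, s.2.1⟩ : W)) fun _ _ h =>
      Subtype.ext (Subtype.mk.inj h)
  have : Fintype (reflections W) := Fintype.ofFinite _
  obtain ⟨d, f, hf, hsum, hjac⟩ := exists_minimalGenerators_jacobian hW.generated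
  have he := hf.isElementaryInvariants hW.generated
  obtain ⟨i₀, hi₀⟩ : ∃ i₀, ∀ i ≠ i₀, d i < d i₀ := by
    rcases Nat.lt_or_ge n 2 with hn | hn
    · have hn1 : n = 1 := by have := hW.nontrivial; omega
      subst hn1
      exact ⟨0, fun i hi => absurd (Subsingleton.elim i 0) hi⟩
    · obtain ⟨g, hg, ζ, v, hv, hreg, hcard⟩ :=
        exists_regular_eigenvector hn hW.generated hW.irreducible
      exact exists_max_degree hn hW.generated hW.irreducible hf hsum hjac hg hv hreg hcard
  have hcox : coxeterNumber W = d i₀ := coxeterNumber_eq he fun i => by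
    rcases eq_or_ne i i₀ with rfl | hi
    · exact le_rfl
    · exact (hi₀ i hi).le
  exact ⟨d, f, he, hf.pos, i₀, hcox.symm, fun i hi => hcox ▸ hi₀ i hi⟩

end Main

end CherednikQH

end

theorem mainTheorem4 {n : ℕ} (W : Subgroup (CherednikQH.E n ≃ₗᵢ[ℝ] CherednikQH.E n))
    (hW : CherednikQH.IsIrreducibleReflectionGroup W)
    (c : CherednikQH.reflections W → ℂ) (hc : CherednikQH.IsRegular c) :
    (∀ (d : ℕ) (q : CherednikQH.S n), q ≠ 0 → q.IsHomogeneous d →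
      q ∈ CherednikQH.invariants W → CherednikQH.IsQuasiharmonic c q →
      CherednikQH.coxeterNumber W ∣ d) ∧
    (∀ k : ℕ, ∃ e : CherednikQH.S n,
      (e ≠ 0 ∧ e.IsHomogeneous (k * CherednikQH.coxeterNumber W) ∧
        e ∈ CherednikQH.invariants W ∧ CherednikQH.IsQuasiharmonic c e) ∧
      ∀ q : CherednikQH.S n, q.IsHomogeneous (k * CherednikQH.coxeterNumber W) →
        q ∈ CherednikQH.invariants W → CherednikQH.IsQuasiharmonic c q →
        ∃ a : ℂ, q = a • e) := by
  have := hW.finite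
  have : Fintype W := Fintype.ofFinite W
  have : Finite (CherednikQH.reflections W) :=
    Finite.of_injective (fun s : CherednikQH.reflections W => (⟨s, s.2.1⟩ : W)) fun _ _ h =>
      Subtype.ext (Subtype.mk.inj h)
  have : Fintype (CherednikQH.reflections W) := Fintype.ofFinite _
  obtain ⟨_, _, he, hpos, _, hi₀, hlt⟩ := CherednikQH.exists_elementaryInvariants hW
  exact CherednikQH.quasiharmonic_invariants hc he hpos hi₀ hlt
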